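/- **Setting.** Everything is $C^\infty$. Let $L$ be a smooth (Hausdorff, second countable, finite-dimensional, boundaryless) manifold and $(\xi,J)$ a Levi flat structure on $L$: $\xi\subset TL$ is an integrable (involutive) distribution of codimension $1$, and $J:\xi\to\xi$ is a complex structure whose Nijenhuis tensor $N_J(V,W)=[JV,JW]-[V,W]-J[JV,W]-J[V,JW]$ vanishes for all vector fields $V,W$ tangent to $\xi$, so that $J$ is an integrable complex structure on each leaf. Let $(\gamma,X)$ be a DGLA defining couple: a $1$-form $\gamma$ and a vector field $X$ with $\ker\gamma=\xi$, $\gamma(X)=1$. * $\mathcal Z^1(L)$ is the space of $1$-forms $\alpha$ with $\alpha(X)=0$; $\delta=d+\{\gamma,\cdot\}$ with $\{\alpha,\beta\}=\mathcal L_X\alpha\wedge\beta-\alpha\wedge\mathcal L_X\beta$. In particular, for a function $f$, $\delta f=df+f\,\mathcal L_X\gamma-X(f)\,\gamma$. * $\Lambda^{0,1}_J(\xi)\otimes\xi$ is the space of bundle endomorphisms $P$ of $\xi$ with $PJ=-JP$. For vector fields $V,W$ tangent to $\xi$, $(\bar\partial W)(V)=\tfrac12([V,W]+J[JV,W])+\tfrac14N_J(V,W)$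 and $\bar\partial P(V,W)=\bar\partial(PW)(V)-\bar\partial(PV)(W)-\tfrac12P([V,W]-[JV,JW])$. * For a vector field $Y$ on $L$ and $V$ tangent to $\xi$, $T_Y(V)=[V,Y]-\gamma([V,Y])X$ and $H_Y(V)=\tfrac12\,(T_Y(V)+J\,T_Y(JV))$; put $H=H_X$. Moreover $\beta^{0,1}(V)=\tfrac12(\beta(V)+i\beta(JV))$, where $i$ acts on $\xi$ as $J$, and $(\beta^{0,1}\wedge H)(V,W)=\beta^{0,1}(V)H(W)-\beta^{0,1}(W)H(V)$. * For $\alpha\in\mathcal Z^1(L)$ let $\omega_\alpha(V)=V-\alpha(V)X$. A pair $(\alpha,S)$ with $\alpha\in\mathcal Z^1(L)$, $S\in\Lambda^{0,1}_J(\xi)\otimes\xi$ and $I+S$ invertible on $\xi$ defines the distribution $\xi_\alpha=\ker(\gamma+\alpha)$ with the complex structure $J_{\alpha,S}=\omega_\alpha(I+S)J(I+S)^{-1}\omega_\alpha^{-1}$. A diffeomorphism $\Phi$ of $L$ moves $(\alpha,S)$ to $(\alpha',S')=\Phi\cdot(\alpha,S)$ if, with $\eta=(\Phi^{-1})^*(\gamma+\alpha)$,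 the function $\eta(X)$ has no zeros, $\alpha'=\eta(X)^{-1}\eta-\gamma$ (so that $\xi_{\alpha'}=\Phi_*\xi_\alpha$) and $J_{\alpha',S'}=\Phi_*J_{\alpha,S}\Phi_*^{-1}$. * A curve is a family $(\alpha_t,S_t)$ of elements of $\mathcal Z^1(L)\times(\Lambda^{0,1}_J(\xi)\otimes\xi)$, smooth in $(t,x)$ for $t$ in an open interval containing $0$, with $(\alpha_0,S_0)=(0,0)$; its tangent vector at the origin is $(\beta,P)=\lim_{t\to0}(\alpha_t,S_t)/t$. An isotopy moves a curve $(\alpha_t,S_t)$ to a curve $(\alpha'_t,S'_t)$ if there is, for some $\varepsilon>0$, a family $(\Phi_t)_{|t|<\varepsilon}$ of diffeomorphisms of $L$, smooth in $(t,x)$, with $\Phi_0=\mathrm{id}$ and $(\alpha'_t,S'_t)=\Phi_t\cdot(\alpha_t,S_t)$ for $|t|<\varepsilon$. Write $(\beta,P)\sim_{\mathcal G}(\beta',P')$ if an isotopy moves some curve with tangent vector $(\beta,P)$ to some curve with tangent vector $(\beta',P')$. **Theorem.** Let $\{(\xi_t,J_t)\}_{t\in I}$, $I$ an open interval containing $0$,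 be a deformation of $(\xi,J)$, that is, a smooth family of Levi flat structures with $(\xi_0,J_0)=(\xi,J)$, given by a curve $(\alpha_t,S_{\alpha_t})_{t\in I}$ (so $\xi_t=\xi_{\alpha_t}$ and $J_t=J_{\alpha_t,S_{\alpha_t}}$) with $\alpha_t=t\beta+o(t)$, $S_{\alpha_t}=tP+o(t)$, $\beta\in\mathcal Z^1(L)$, $P\in\Lambda^{0,1}_J(\xi)\otimes\xi$. Then: 1. $\delta\beta=0$ and $\bar\partial P=-\beta^{0,1}\wedge H$. 2. Let $\beta'\in\mathcal Z^1(L)$ and $P'\in\Lambda^{0,1}_J(\xi)\otimes\xi$ satisfy $\delta\beta'=0$ and $\bar\partial P'=-\beta'^{0,1}\wedge H$. Then $(\beta,P)\sim_{\mathcal G}(\beta',P')$ if and only if there is a vector field $Y$ on $L$ with $$\beta-\beta'=\delta\,\iota_Y\gamma,\qquad P-P'=-H_Y .$$ The same condition on $Y$ is also necessary and sufficient for an isotopy to move the given curve $(\alpha_t,S_{\alpha_t})$ to a curve with tangent vector $(\beta',P')$. -/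

import Mathlib

open Set Filter Topology
open scoped Manifold ContDiff Bundle

noncomputable section

namespace LeviFlat

/-! Throughout, `L` is a smooth manifold without boundary modelled on a finite-dimensional real
vector space `E`.  Vector fields, 1-forms and fields of endomorphisms are sections (a priori
arbitrary) of the corresponding bundles; smoothness is a separate predicate. -/

section Basic

variable (E : Type*) [NormedAddCommGroup E] [NormedSpace ℝ E]
  (L : Type*) [TopologicalSpace L] [ChartedSpace E L]

/-- Vector fields on `L`. -/
abbrev VField : Type _ := (x : L) → TangentSpace 𝓘(ℝ, E) x

/-- Real 1-forms on `L`. -/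
abbrev Form1 : Type _ := (x : L) → TangentSpace 𝓘(ℝ, E) x →L[ℝ] ℝ

/-- Fields of endomorphisms of the tangent spaces of `L`. -/
abbrev EndField : Type _ :=
  (x : L) → TangentSpace 𝓘(ℝ, E) x →L[ℝ] TangentSpace 𝓘(ℝ, E) x

/-- Distributions on `L`, i.e. fields of linear subspaces of the tangent spaces. -/
abbrev Distribution : Type _ := (x : L) → Submodule ℝ (TangentSpace 𝓘(ℝ, E) x)

end Basic

variable {E : Type*} [NormedAddCommGroup E] [NormedSpace ℝ E]
  {L : Type*} [TopologicalSpace L] [ChartedSpace E L]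

/-! ### Smoothness -/

section Smooth

variable [IsManifold 𝓘(ℝ, E) ∞ L]

/-- Smooth vector fields. -/
def SmoothVF (V : VField E L) : Prop :=
  ContMDiff 𝓘(ℝ, E) (𝓘(ℝ, E).prod 𝓘(ℝ, E)) ∞
    (fun x => (Bundle.TotalSpace.mk' E x (V x) : TangentBundle 𝓘(ℝ, E) L))

/-- Smooth 1-forms. -/
def SmoothForm (α : Form1 E L) : Prop :=
  ContMDiff 𝓘(ℝ, E) (𝓘(ℝ, E).prod 𝓘(ℝ, E →L[ℝ] ℝ)) ∞
    (fun x => Bundle.TotalSpace.mk' (E →L[ℝ] ℝ)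
      (E := fun x : L => TangentSpace 𝓘(ℝ, E) x →L[ℝ] ℝ) x (α x))

/-- Smooth fields of endomorphisms. -/
def SmoothEnd (S : EndField E L) : Prop :=
  ContMDiff 𝓘(ℝ, E) (𝓘(ℝ, E).prod 𝓘(ℝ, E →L[ℝ] E)) ∞
    (fun x => Bundle.TotalSpace.mk' (E →L[ℝ] E)
      (E := fun x : L => TangentSpace 𝓘(ℝ, E) x →L[ℝ] TangentSpace 𝓘(ℝ, E) x) x (S x))

/-- Families `(α_t)_{t ∈ I}` of 1-forms depending smoothly on `(t, x) ∈ I × L`. -/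
def SmoothFormFamily (I : Set ℝ) (α : ℝ → Form1 E L) : Prop :=
  ContMDiffOn (𝓘(ℝ, ℝ).prod 𝓘(ℝ, E)) (𝓘(ℝ, E).prod 𝓘(ℝ, E →L[ℝ] ℝ)) ∞
    (fun p : ℝ × L => Bundle.TotalSpace.mk' (E →L[ℝ] ℝ)
      (E := fun x : L => TangentSpace 𝓘(ℝ, E) x →L[ℝ] ℝ) p.2 (α p.1 p.2))
    (I ×ˢ univ)

/-- Families `(S_t)_{t ∈ I}` of endomorphism fields depending smoothly on `(t, x) ∈ I × L`. -/
def SmoothEndFamily (I : Set ℝ) (S : ℝ → EndField E L) : Prop :=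
  ContMDiffOn (𝓘(ℝ, ℝ).prod 𝓘(ℝ, E)) (𝓘(ℝ, E).prod 𝓘(ℝ, E →L[ℝ] E)) ∞
    (fun p : ℝ × L => Bundle.TotalSpace.mk' (E →L[ℝ] E)
      (E := fun x : L => TangentSpace 𝓘(ℝ, E) x →L[ℝ] TangentSpace 𝓘(ℝ, E) x) p.2 (S p.1 p.2))
    (I ×ˢ univ)

end Smooth

/-! ### Differential calculus for functions and 1-forms -/

/-- The Lie bracket of vector fields. -/
def br (V W : VField E L) : VField E L := VectorField.mlieBracket 𝓘(ℝ, E) V W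

/-- The derivative `V f` of a function along a vector field. -/
def der (V : VField E L) (f : L → ℝ) (x : L) : ℝ := mfderiv 𝓘(ℝ, E) 𝓘(ℝ, ℝ) f x (V x)

/-- The function `α(V)`. -/
def ev (α : Form1 E L) (V : VField E L) (x : L) : ℝ := α x (V x)

/-- The vector field `A V`. -/
def app (A : EndField E L) (V : VField E L) : VField E L := fun x => A x (V x)

/-- The exterior derivative of a 1-form:
`dα(V, W) = V(α(W)) - W(α(V)) - α([V, W])`. -/
def extD (α : Form1 E L) (V W : VField E L) (x : L) : ℝ :=
  der V (ev α W) x - der W (ev α V) x - ev α (br V W) x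

/-- The Lie derivative of a 1-form: `(𝓛_X α)(V) = X(α(V)) - α([X, V])`. -/
def lieD (X : VField E L) (α : Form1 E L) (V : VField E L) (x : L) : ℝ :=
  der X (ev α V) x - ev α (br X V) x

/-- The bracket `{α, β} = 𝓛_X α ∧ β - α ∧ 𝓛_X β` of two 1-forms, evaluated on `(V, W)`. -/
def dglaBracket (X : VField E L) (α β : Form1 E L) (V W : VField E L) (x : L) : ℝ :=
  (lieD X α V x * ev β W x - lieD X α W x * ev β V x)
    - (ev α V x * lieD X β W x - ev α W x * lieD X β V x)

/-- `δ = d + {γ, ·}` on 1-forms, evaluated on `(V, W)`. -/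
def delta (γ : Form1 E L) (X : VField E L) (α : Form1 E L) (V W : VField E L) (x : L) : ℝ :=
  extD α V W x + dglaBracket X γ α V W x

/-- `δ = d + {γ, ·}` on functions, where `{γ, f} = (𝓛_X γ) f - γ (X f)`, evaluated on `V`. -/
def deltaFun (γ : Form1 E L) (X : VField E L) (f : L → ℝ) (V : VField E L) (x : L) : ℝ :=
  der V f x + (lieD X γ V x * f x - ev γ V x * der X f x)

/-! ### Levi flat structures -/

/-- Vector fields tangent to a distribution. -/
def TangentTo (ξ : Distribution E L) (V : VField E L) : Prop := ∀ x, V x ∈ ξ x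

/-- The Nijenhuis tensor `[JV, JW] - [V, W] - J[JV, W] - J[V, JW]`. -/
def nijenhuis (J : EndField E L) (V W : VField E L) : VField E L := fun x =>
  br (app J V) (app J W) x - br V W x
    - J x (br (app J V) W x) - J x (br V (app J W) x)

section Structure

variable [IsManifold 𝓘(ℝ, E) ∞ L]

variable (E L) in
/-- A Levi flat structure `(ξ, J)`: a smooth involutive distribution `ξ` of codimension 1 with a
smooth complex structure `J` on `ξ` whose Nijenhuis tensor vanishes along `ξ` (so that `J` is an
integrable complex structure on each leaf).  `J` is written as a field of endomorphisms of the
tangent spaces, but only its restriction to `ξ` is meaningful: no condition and no definition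
below involves its values outside of `ξ`. -/
structure LeviFlatStructure where
  ξ : Distribution E L
  J : EndField E L
  codim_one : ∀ x, Module.finrank ℝ (TangentSpace 𝓘(ℝ, E) x ⧸ ξ x) = 1
  smooth_ξ : ∀ x, ∀ v ∈ ξ x, ∃ V : VField E L, SmoothVF V ∧ TangentTo ξ V ∧ V x = v
  involutive : ∀ V W : VField E L, SmoothVF V → SmoothVF W → TangentTo ξ V → TangentTo ξ W →
    TangentTo ξ (br V W)
  J_mem : ∀ x, ∀ v ∈ ξ x, J x v ∈ ξ x
  J_sq : ∀ x, ∀ v ∈ ξ x, J x (J x v) = -v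
  smooth_J : ∀ V : VField E L, SmoothVF V → TangentTo ξ V → SmoothVF (app J V)
  integrable_J : ∀ V W : VField E L, SmoothVF V → SmoothVF W → TangentTo ξ V → TangentTo ξ W →
    ∀ x, nijenhuis J V W x = 0

/-- Two data `(ξ, J)` define the same Levi flat structure. -/
def LeviFlatStructure.Same (F G : LeviFlatStructure E L) : Prop :=
  F.ξ = G.ξ ∧ ∀ x, ∀ v ∈ F.ξ x, F.J x v = G.J x v

/-- `(γ, X)` is a DGLA defining couple for `ξ`: `ker γ = ξ` and `γ(X) = 1`. -/
structure IsDefiningCouple (ξ : Distribution E L) (γ : Form1 E L) (X : VField E L) : Prop where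
  smooth_γ : SmoothForm γ
  smooth_X : SmoothVF X
  ker_γ : ∀ x v, v ∈ ξ x ↔ γ x v = 0
  γ_X : ∀ x, γ x (X x) = 1

/-- `α ∈ 𝒵¹(L)`: a smooth 1-form with `ι_X α = 0`. -/
structure IsZ1 (X : VField E L) (α : Form1 E L) : Prop where
  smooth : SmoothForm α
  ι_X : ∀ x, α x (X x) = 0

/-- Pointwise conditions for `S ∈ Λ^{0,1}(ξ) ⊗ ξ`: `S` maps `ξ` to `ξ` and `S J = -J S` on `ξ`.
A `ξ`-valued 1-form on `ξ` is identified with its extension by `0` on `X`, exactly as `Λ¹(ξ)` is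
identified with `𝒵¹(L)`. -/
structure IsAntilinear (F : LeviFlatStructure E L) (X : VField E L) (S : EndField E L) : Prop where
  apply_X : ∀ x, S x (X x) = 0
  mem : ∀ x, ∀ v ∈ F.ξ x, S x v ∈ F.ξ x
  anticomm : ∀ x, ∀ v ∈ F.ξ x, S x (F.J x v) = -F.J x (S x v)

/-- `P ∈ Λ^{0,1}_J(ξ) ⊗ ξ`. -/
structure IsForm01 (F : LeviFlatStructure E L) (X : VField E L) (P : EndField E L) : Prop where
  smooth : SmoothEnd P
  antilinear : IsAntilinear F X P

end Structure

/-! ### The forms `H_Y`, the operator `∂̄` and the products with `(0,1)`-parts -/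

/-- `T_Y(V) = [V, Y] - γ([V, Y]) X`. -/
def TForm (γ : Form1 E L) (X Y V : VField E L) : VField E L := fun x =>
  br V Y x - ev γ (br V Y) x • X x

/-- `H_Y(V) = (T_Y(V) + J T_Y(J V)) / 2`, for `V` tangent to `ξ`. -/
def HForm (J : EndField E L) (γ : Form1 E L) (X Y V : VField E L) : VField E L := fun x =>
  (1 / 2 : ℝ) • (TForm γ X Y V x + J x (TForm γ X Y (app J V) x))

/-- `(∂̄ W)(V) = ([V, W] + J [J V, W]) / 2 + N_J(V, W) / 4`, for `V`, `W` tangent to `ξ`. -/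
def dbarVF (J : EndField E L) (W V : VField E L) : VField E L := fun x =>
  (1 / 2 : ℝ) • (br V W x + J x (br (app J V) W x)) + (1 / 4 : ℝ) • nijenhuis J V W x

/-- For `P ∈ Λ^{0,1}(ξ) ⊗ ξ` and `V`, `W` tangent to `ξ`,
`(∂̄ P)(V, W) = ∂̄(P W)(V) - ∂̄(P V)(W) - P([V, W] - [J V, J W]) / 2`. -/
def dbar (J P : EndField E L) (V W : VField E L) : VField E L := fun x =>
  dbarVF J (app P W) V x - dbarVF J (app P V) W x
    - (1 / 2 : ℝ) • P x (br V W x - br (app J V) (app J W) x)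

/-- `β^{0,1}(V) Z`, where `β^{0,1}(V) = (β(V) + i β(J V)) / 2` and `i` acts on `ξ` as `J`. -/
def form01Smul (J : EndField E L) (β : Form1 E L) (V Z : VField E L) : VField E L := fun x =>
  (1 / 2 : ℝ) • (ev β V x • Z x + ev β (app J V) x • J x (Z x))

/-- `(β^{0,1} ∧ H)(V, W) = β^{0,1}(V) H(W) - β^{0,1}(W) H(V)`, where `H = H_X`. -/
def form01WedgeH (J : EndField E L) (γ : Form1 E L) (X : VField E L) (β : Form1 E L)
    (V W : VField E L) : VField E L := fun x =>
  form01Smul J β V (HForm J γ X X W) x - form01Smul J β W (HForm J γ X X V) x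

section Deformations

variable [IsManifold 𝓘(ℝ, E) ∞ L]

/-- The linearised equations `δβ = 0` and `∂̄P = -β^{0,1} ∧ H`. -/
structure LinearizedEq (F : LeviFlatStructure E L) (γ : Form1 E L) (X : VField E L)
    (β : Form1 E L) (P : EndField E L) : Prop where
  delta_eq_zero : ∀ V W : VField E L, SmoothVF V → SmoothVF W → ∀ x, delta γ X β V W x = 0
  dbar_eq : ∀ V W : VField E L, SmoothVF V → SmoothVF W → TangentTo F.ξ V → TangentTo F.ξ W →
    ∀ x, dbar F.J P V W x = -form01WedgeH F.J γ X β V W x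

/-! ### Deformations -/

/-- `ω_α(V) = V - α(V) X`. -/
def omega (X : VField E L) (α : Form1 E L) : EndField E L := fun x =>
  ContinuousLinearMap.id ℝ _ - (α x).smulRight (X x)

/-- `ω_α⁻¹(V) = V + α(V) X`, for `α ∈ 𝒵¹(L)`. -/
def omegaInv (X : VField E L) (α : Form1 E L) : EndField E L := fun x =>
  ContinuousLinearMap.id ℝ _ + (α x).smulRight (X x)

/-- `I + S`. -/
def onePlus (S : EndField E L) : EndField E L := fun x => ContinuousLinearMap.id ℝ _ + S x

/-- The complex structure `J_{α,S} = ω_α (I + S) J (I + S)⁻¹ ω_α⁻¹` on `ξ_α = ker (γ + α)`. -/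
def pairJ (J : EndField E L) (X : VField E L) (α : Form1 E L) (S : EndField E L) :
    EndField E L := fun x =>
  omega X α x ∘L onePlus S x ∘L J x ∘L (onePlus S x).inverse ∘L omegaInv X α x

/-- A smooth curve `(α_t, S_t)_{t ∈ I}` in `𝒵¹(L) × (Λ^{0,1}(ξ) ⊗ ξ)` through the origin. -/
structure IsPairCurve (F : LeviFlatStructure E L) (X : VField E L) (I : Set ℝ)
    (α : ℝ → Form1 E L) (S : ℝ → EndField E L) : Prop where
  smooth_α : SmoothFormFamily I α
  smooth_S : SmoothEndFamily I S
  ι_X : ∀ t ∈ I, ∀ x, α t x (X x) = 0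
  antilinear : ∀ t ∈ I, IsAntilinear F X (S t)
  α_zero : ∀ x, α 0 x = 0
  S_zero : ∀ x, S 0 x = 0

/-- `(β, P) = lim_{t → 0} (α_t, S_t) / t`, i.e. `α_t = tβ + o(t)` and `S_t = tP + o(t)`. -/
structure HasTangent (α : ℝ → Form1 E L) (S : ℝ → EndField E L)
    (β : Form1 E L) (P : EndField E L) : Prop where
  form : ∀ x v, Tendsto (fun t : ℝ => t⁻¹ • α t x v) (𝓝[≠] 0) (𝓝 (β x v))
  endo : ∀ x v, Tendsto (fun t : ℝ => t⁻¹ • S t x v) (𝓝[≠] 0) (𝓝 (P x v))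

/-- The deformation `(ξ_t, J_t)_{t ∈ I}` of the Levi flat structure `F = (ξ, J)` is given by the
smooth family `(α_t, S_t)`: `(ξ_0, J_0) = (ξ, J)`, `ξ_t = ker (γ + α_t)` and
`J_t = ω_{α_t} (I + S_t) J (I + S_t)⁻¹ ω_{α_t}⁻¹` on `ξ_t`. -/
structure IsDeformationGivenBy (F : LeviFlatStructure E L) (γ : Form1 E L) (X : VField E L)
    (I : Set ℝ) (D : ℝ → LeviFlatStructure E L)
    (α : ℝ → Form1 E L) (S : ℝ → EndField E L) : Prop where
  curve : IsPairCurve F X I α S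
  start : (D 0).Same F
  mem_iff : ∀ t ∈ I, ∀ x v, v ∈ (D t).ξ x ↔ (γ x + α t x) v = 0
  invertible : ∀ t ∈ I, ∀ x, (onePlus (S t) x).IsInvertible
  J_eq : ∀ t ∈ I, ∀ x, ∀ v ∈ (D t).ξ x, (D t).J x v = pairJ F.J X (α t) (S t) x v

/-! ### The action of diffeomorphisms -/

/-- The pull-back `Ψ^* η` of a 1-form. -/
def pullback (Ψ : L → L) (η : Form1 E L) : Form1 E L := fun y =>
  (η (Ψ y)).comp (mfderiv 𝓘(ℝ, E) 𝓘(ℝ, E) Ψ y)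

/-- `(α', S')` is the image of `(α, S)` under the diffeomorphism `Φ`, i.e. the push-forward by `Φ`
of the structure `(ξ_α, J_{α,S})` is `(ξ_{α'}, J_{α',S'})`: with `η = (Φ⁻¹)^* (γ + α)`, the
function `η(X)` has no zeros and `α' = η(X)⁻¹ η - γ`; moreover
`J_{α',S'} = Φ_* J_{α,S} Φ_*⁻¹`. -/
structure GaugeRel (F : LeviFlatStructure E L) (γ : Form1 E L) (X : VField E L)
    (Φ : L ≃ₘ^∞⟮𝓘(ℝ, E), 𝓘(ℝ, E)⟯ L)
    (α : Form1 E L) (S : EndField E L) (α' : Form1 E L) (S' : EndField E L) : Prop where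
  ne_zero : ∀ y, pullback Φ.symm (γ + α) y (X y) ≠ 0
  form_eq : ∀ y, α' y =
    (pullback Φ.symm (γ + α) y (X y))⁻¹ • pullback Φ.symm (γ + α) y - γ y
  invertible : ∀ x, (onePlus S x).IsInvertible
  invertible' : ∀ x, (onePlus S' x).IsInvertible
  J_eq : ∀ x v, (γ x + α x) v = 0 →
    pairJ F.J X α' S' (Φ x) (mfderiv 𝓘(ℝ, E) 𝓘(ℝ, E) Φ x v)
      = mfderiv 𝓘(ℝ, E) 𝓘(ℝ, E) Φ x (pairJ F.J X α S x v)

/-- Some smooth isotopy `Φ_t` of `L` with `Φ_0 = id` moves the curve `(α_t, S_t)_{t ∈ I}` to a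
smooth curve `(α'_t, S'_t) = Φ_t · (α_t, S_t)` whose tangent vector at the origin is
`(β', P')`. -/
def MovesTo (F : LeviFlatStructure E L) (γ : Form1 E L) (X : VField E L) (I : Set ℝ)
    (α : ℝ → Form1 E L) (S : ℝ → EndField E L) (β' : Form1 E L) (P' : EndField E L) : Prop :=
  ∃ ε : ℝ, 0 < ε ∧ Ioo (-ε) ε ⊆ I ∧
    ∃ Φ : ℝ → (L ≃ₘ^∞⟮𝓘(ℝ, E), 𝓘(ℝ, E)⟯ L),
      ContMDiffOn (𝓘(ℝ, ℝ).prod 𝓘(ℝ, E)) 𝓘(ℝ, E) ∞ (fun p : ℝ × L => Φ p.1 p.2)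
        (Ioo (-ε) ε ×ˢ univ) ∧
      (∀ x, Φ 0 x = x) ∧
      ∃ (α' : ℝ → Form1 E L) (S' : ℝ → EndField E L),
        IsPairCurve F X (Ioo (-ε) ε) α' S' ∧
        (∀ t ∈ Ioo (-ε) ε, GaugeRel F γ X (Φ t) (α t) (S t) (α' t) (S' t)) ∧
        HasTangent α' S' β' P'

/-- The equivalence `(β, P) ∼ (β', P')` induced on tangent vectors at the origin by the action of
the diffeomorphism group: some smooth curve with tangent vector `(β, P)` is moved by a smooth
isotopy starting at the identity to a curve with tangent vector `(β', P')`. -/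
def TangentEquiv (F : LeviFlatStructure E L) (γ : Form1 E L) (X : VField E L)
    (β : Form1 E L) (P : EndField E L) (β' : Form1 E L) (P' : EndField E L) : Prop :=
  ∃ ε : ℝ, 0 < ε ∧ ∃ (α : ℝ → Form1 E L) (S : ℝ → EndField E L),
    IsPairCurve F X (Ioo (-ε) ε) α S ∧ HasTangent α S β P ∧
    MovesTo F γ X (Ioo (-ε) ε) α S β' P'

/-- The conditions `β - β' = δ ι_Y γ` and `P - P' = -H_Y` (the latter on `ξ`). -/
structure DifferByField (F : LeviFlatStructure E L) (γ : Form1 E L) (X : VField E L)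
    (β : Form1 E L) (P : EndField E L) (β' : Form1 E L) (P' : EndField E L)
    (Y : VField E L) : Prop where
  form : ∀ V : VField E L, SmoothVF V → ∀ x,
    β x (V x) - β' x (V x) = deltaFun γ X (ev γ Y) V x
  endo : ∀ V : VField E L, SmoothVF V → TangentTo F.ξ V → ∀ x,
    P x (V x) - P' x (V x) = -HForm F.J γ X Y V x

end Deformations

end LeviFlat

end

/-! Both equations of part 1 are first-order terms at `t = 0` of integrability conditions. For `η =
γ + α_t`, with `η(X) = 1`, integrability of `ker η` gives `dη(v,w) = η(v) dη(X,w) + η(w) dη(v,X)`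
for all `v`, `w` (`dForm_transverse`). The `t`-derivative of this identity is `δβ = 0`, because `𝓛_X
η = ι_X dη` whenever `η(X)` is constant.

For the complex structures put `T_t V = ω_{α_t}(I + S_t)V`, so that `J_t T_t = T_t J` on `ξ`. The
equation `N_{J_t}(T_t V, T_t W) = 0` says that `J_t` sends `[T_t JV, T_t W] + [T_t V, T_t JW]` to
`[T_t JV, T_t JW] - [T_t V, T_t W]`. By `pairJ_relation`, `b = J_t c` implies `(I - S_t)πc + (I +
S_t)Jπb = 0`, where `π` is the projection onto `ξ` along `X`; no inverse occurs and only `S_t`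
moves. Differentiating (`nijenhuis_deriv`) and simplifying (`dbar_algebra`) gives the equation for
`∂̄P`.

Necessity in part 2 is the derivative of the gauge relation, with `Y` the velocity of `Φ_t` at `0`.
The relation is first rewritten at the moving point `Φ_t(x)` without `Φ_t⁻¹` and without the
normalising factor (`GaugeRel.form_relation`, `GaugeRel.endo_relation`). The forms give `β - β' =
𝓛_Y γ - (𝓛_Y γ)(X) γ`, which is `δ ι_Y γ` by integrability of `ξ`; the endomorphisms give `P - P' =
-H_Y`. The argument works for every curve tangent to `(β, P)`.

For sufficiency no tangent vector has to be computed. If an isotopy with velocity `Y` keeps the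
curve in the domain of the parametrization, the moved curve is smooth, hence has a tangent vector,
and the necessity half forces it to be `(β', P')` (`movesTo_of_isotopy`). The domain condition
`Admissible` asks that the push-forward, projected to `ξ`, be invertible (so the image of `ξ_α`
stays transverse to `X`) and that its `J`-linear part `N` be invertible; then `S' = Q N⁻¹` with `Q`
the antilinear part.

This condition is open, but `L` may be noncompact, so `Y` need not have a flow for a uniform time,
let alone an admissible one. Hence `exists_admissible_isotopy` splits `Y = ∑ ρ_n Y` by a partition
of unity and realises each term by a compactly supported perturbation of the identity in a chart.
The `n`-th perturbation is run at time `σ_n(t)`, which is `t` near `0` and `0` for `|t| ≥ δ_n`,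
where `δ_n → 0`. Compactness makes each step admissible. The infinite composition is locally finite:
because of the time cutoffs away from `t = 0`, because of the supports near `t = 0`. The velocity
sees only the germ at `t = 0`, so it is still `Y`. -/

open Set Filter Topology
open scoped Manifold ContDiff Bundle

noncomputable section

namespace LeviFlat

set_option linter.unusedSectionVars false

/-! ### Smoothness of families of vectors, covectors and linear maps, read in trivializations. -/

section Coordinates

variable {E : Type*} [NormedAddCommGroup E] [NormedSpace ℝ E]
  {L : Type*} [TopologicalSpace L] [ChartedSpace E L] [IsManifold 𝓘(ℝ, E) ∞ L]

/-- The trivialization of the tangent bundle centred at `x₀`, at the point `x`. -/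
def tr (x₀ x : L) : TangentSpace 𝓘(ℝ, E) x →L[ℝ] E :=
  (trivializationAt E (TangentSpace 𝓘(ℝ, E)) x₀).continuousLinearMapAt ℝ x

/-- The inverse of the trivialization of the tangent bundle centred at `x₀`. -/
def trs (x₀ x : L) : E →L[ℝ] TangentSpace 𝓘(ℝ, E) x :=
  (trivializationAt E (TangentSpace 𝓘(ℝ, E)) x₀).symmL ℝ x

theorem tr_trs {x₀ x : L} (hx : x ∈ (chartAt E x₀).source) (e : E) :
    tr x₀ x (trs x₀ x e) = e :=
  (trivializationAt E (TangentSpace 𝓘(ℝ, E)) x₀).continuousLinearMapAt_symmL hx e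

theorem trs_tr {x₀ x : L} (hx : x ∈ (chartAt E x₀).source) (v : TangentSpace 𝓘(ℝ, E) x) :
    trs x₀ x (tr x₀ x v) = v :=
  (trivializationAt E (TangentSpace 𝓘(ℝ, E)) x₀).symmL_continuousLinearMapAt hx v

theorem tr_eq_mfderiv {x₀ x : L} (hx : x ∈ (chartAt E x₀).source) :
    tr x₀ x = mfderiv 𝓘(ℝ, E) 𝓘(ℝ, E) (extChartAt 𝓘(ℝ, E) x₀) x :=
  TangentBundle.continuousLinearMapAt_trivializationAt hx

theorem trs_eq_mfderiv {x₀ x : L} (hx : x ∈ (chartAt E x₀).source) :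
    trs (E := E) x₀ x = mfderivWithin 𝓘(ℝ, E) 𝓘(ℝ, E) (extChartAt 𝓘(ℝ, E) x₀).symm (range 𝓘(ℝ, E))
      (extChartAt 𝓘(ℝ, E) x₀ x) :=
  TangentBundle.symmL_trivializationAt hx

theorem tr_self (x₀ : L) (v : TangentSpace 𝓘(ℝ, E) x₀) : tr x₀ x₀ v = v := by
  rw [tr_eq_mfderiv (mem_chart_source E x₀), mfderiv_extChartAt_self]; rfl

theorem trs_self (x₀ : L) (v : E) : trs x₀ x₀ v = v := by
  rw [trs_eq_mfderiv (mem_chart_source E x₀), mfderivWithin_range_extChartAt_symm]; rfl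

theorem eventually_mem_chart {N : Type*} [TopologicalSpace N] {f : N → L} {p₀ : N}
    (hf : ContinuousAt f p₀) : ∀ᶠ p in 𝓝 p₀, f p ∈ (chartAt E (f p₀)).source :=
  hf.eventually ((chartAt E (f p₀)).open_source.mem_nhds (mem_chart_source E _))

variable {EN : Type*} [NormedAddCommGroup EN] [NormedSpace ℝ EN] {HN : Type*} [TopologicalSpace HN]
  {N : Type*} [TopologicalSpace N] [ChartedSpace HN N] (IN : ModelWithCorners ℝ EN HN)

/-- A family of vectors `V p ∈ T_{g p} L` is smooth at `p₀`. -/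
def VecSmoothAt (g : N → L) (V : (p : N) → TangentSpace 𝓘(ℝ, E) (g p)) (p₀ : N) : Prop :=
  ContMDiffAt IN 𝓘(ℝ, E) ∞ (fun p => tr (g p₀) (g p) (V p)) p₀

/-- A family of covectors `η p ∈ T^*_{f p} L` is smooth at `p₀`. -/
def CovSmoothAt (f : N → L) (η : (p : N) → TangentSpace 𝓘(ℝ, E) (f p) →L[ℝ] ℝ) (p₀ : N) : Prop :=
  ContMDiffAt IN 𝓘(ℝ, E →L[ℝ] ℝ) ∞ (fun p => (η p) ∘L (trs (f p₀) (f p))) p₀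

/-- A family of linear maps `A p : T_{f p} L → T_{g p} L` is smooth at `p₀`. -/
def HomSmoothAt (f g : N → L)
    (A : (p : N) → TangentSpace 𝓘(ℝ, E) (f p) →L[ℝ] TangentSpace 𝓘(ℝ, E) (g p)) (p₀ : N) : Prop :=
  ContMDiffAt IN 𝓘(ℝ, E →L[ℝ] E) ∞
    (fun p => (tr (g p₀) (g p)) ∘L (A p) ∘L (trs (f p₀) (f p))) p₀

variable {IN} {f g h : N → L} {p₀ : N}
  {A A' : (p : N) → TangentSpace 𝓘(ℝ, E) (f p) →L[ℝ] TangentSpace 𝓘(ℝ, E) (g p)}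
  {B : (p : N) → TangentSpace 𝓘(ℝ, E) (g p) →L[ℝ] TangentSpace 𝓘(ℝ, E) (h p)}
  {η η' : (p : N) → TangentSpace 𝓘(ℝ, E) (g p) →L[ℝ] ℝ}
  {V V' : (p : N) → TangentSpace 𝓘(ℝ, E) (g p)} {U : (p : N) → TangentSpace 𝓘(ℝ, E) (f p)}

/-- Near `p₀` the middle point stays in the chart at `g p₀`, where the trivialization cancels its
inverse, so coordinate matrices multiply. Only continuity of the base map in the middle is needed.
-/
theorem HomSmoothAt.comp (hB : HomSmoothAt IN g h B p₀) (hA : HomSmoothAt IN f g A p₀)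
    (hg : ContinuousAt g p₀) : HomSmoothAt IN f h (fun p => (B p) ∘L (A p)) p₀ := by
  refine (hB.clm_comp hA).congr_of_eventuallyEq ?_
  filter_upwards [eventually_mem_chart (E := E) hg] with p hp
  ext e
  simp [trs_tr hp]

theorem HomSmoothAt.apply (hA : HomSmoothAt IN f g A p₀) (hU : VecSmoothAt IN f U p₀)
    (hf : ContinuousAt f p₀) : VecSmoothAt IN g (fun p => A p (U p)) p₀ := by
  refine (hA.clm_apply hU).congr_of_eventuallyEq ?_
  filter_upwards [eventually_mem_chart (E := E) hf] with p hp
  simp [trs_tr hp]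

theorem CovSmoothAt.comp (hη : CovSmoothAt IN g η p₀) (hA : HomSmoothAt IN f g A p₀)
    (hg : ContinuousAt g p₀) : CovSmoothAt IN f (fun p => (η p) ∘L (A p)) p₀ := by
  refine (hη.clm_comp hA).congr_of_eventuallyEq ?_
  filter_upwards [eventually_mem_chart (E := E) hg] with p hp
  ext e
  simp [trs_tr hp]

theorem CovSmoothAt.apply (hη : CovSmoothAt IN g η p₀) (hV : VecSmoothAt IN g V p₀)
    (hg : ContinuousAt g p₀) : ContMDiffAt IN 𝓘(ℝ, ℝ) ∞ (fun p => η p (V p)) p₀ := by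
  refine (hη.clm_apply hV).congr_of_eventuallyEq ?_
  filter_upwards [eventually_mem_chart (E := E) hg] with p hp
  simp [trs_tr hp]

theorem HomSmoothAt.add (hA : HomSmoothAt IN f g A p₀) (hA' : HomSmoothAt IN f g A' p₀) :
    HomSmoothAt IN f g (fun p => A p + A' p) p₀ := by
  refine (ContMDiffAt.add hA hA').congr_of_eventuallyEq (Eventually.of_forall fun p => ?_)
  ext e; simp

theorem HomSmoothAt.sub (hA : HomSmoothAt IN f g A p₀) (hA' : HomSmoothAt IN f g A' p₀) :
    HomSmoothAt IN f g (fun p => A p - A' p) p₀ := by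
  refine (ContMDiffAt.sub hA hA').congr_of_eventuallyEq (Eventually.of_forall fun p => ?_)
  ext e; simp

theorem HomSmoothAt.const_smul (c : ℝ) (hA : HomSmoothAt IN f g A p₀) :
    HomSmoothAt IN f g (fun p => c • A p) p₀ := by
  refine (contMDiffAt_const (I' := 𝓘(ℝ, ℝ)) (c := c)).smul hA |>.congr_of_eventuallyEq
    (Eventually.of_forall fun p => ?_)
  ext e; simp

theorem CovSmoothAt.add (hη : CovSmoothAt IN g η p₀) (hη' : CovSmoothAt IN g η' p₀) :
    CovSmoothAt IN g (fun p => η p + η' p) p₀ := by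
  refine (ContMDiffAt.add hη hη').congr_of_eventuallyEq (Eventually.of_forall fun p => ?_)
  ext e; simp

theorem CovSmoothAt.sub (hη : CovSmoothAt IN g η p₀) (hη' : CovSmoothAt IN g η' p₀) :
    CovSmoothAt IN g (fun p => η p - η' p) p₀ := by
  refine (ContMDiffAt.sub hη hη').congr_of_eventuallyEq (Eventually.of_forall fun p => ?_)
  ext e; simp

theorem CovSmoothAt.smul {c : N → ℝ} (hc : ContMDiffAt IN 𝓘(ℝ, ℝ) ∞ c p₀)
    (hη : CovSmoothAt IN g η p₀) : CovSmoothAt IN g (fun p => c p • η p) p₀ := by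
  refine (hc.smul hη).congr_of_eventuallyEq (Eventually.of_forall fun p => ?_)
  ext e; simp

theorem HomSmoothAt.id (hg : ContinuousAt g p₀) :
    HomSmoothAt IN g g (fun p => ContinuousLinearMap.id ℝ (TangentSpace 𝓘(ℝ, E) (g p))) p₀ := by
  refine (contMDiffAt_const (c := ContinuousLinearMap.id ℝ E)).congr_of_eventuallyEq ?_
  filter_upwards [eventually_mem_chart (E := E) hg] with p hp
  ext e
  simp [tr_trs hp]

theorem HomSmoothAt.smulRight {θ : (p : N) → TangentSpace 𝓘(ℝ, E) (f p) →L[ℝ] ℝ}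
    (hθ : CovSmoothAt IN f θ p₀) (hV : VecSmoothAt IN g V p₀) :
    HomSmoothAt IN f g (fun p => (θ p).smulRight (V p)) p₀ := by
  have h1 := ContMDiffAt.clm_apply
    (contMDiffAt_const (I := IN) (n := ∞) (x := p₀)
      (c := (ContinuousLinearMap.smulRightL ℝ E E))) hθ
  refine (h1.clm_apply hV).congr_of_eventuallyEq (Eventually.of_forall fun p => ?_)
  ext e; simp

/-- The continuous linear equivalence given by the trivialization. -/
def trEquiv {x₀ x : L} (hx : x ∈ (chartAt E x₀).source) : TangentSpace 𝓘(ℝ, E) x ≃L[ℝ] E :=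
  ContinuousLinearEquiv.equivOfInverse (tr x₀ x) (trs x₀ x) (trs_tr hx) (tr_trs hx)

theorem isInvertible_coord_iff {a b x y : L} (hx : x ∈ (chartAt E a).source)
    (hy : y ∈ (chartAt E b).source)
    (A : TangentSpace 𝓘(ℝ, E) x →L[ℝ] TangentSpace 𝓘(ℝ, E) y) :
    ((tr b y) ∘L A ∘L (trs a x)).IsInvertible ↔ A.IsInvertible := by
  have : (tr b y) ∘L A ∘L (trs a x)
      = (trEquiv hy : _ →L[ℝ] E) ∘L A ∘L ((trEquiv hx).symm : E →L[ℝ] _) := by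
    ext e; rfl
  rw [this, ContinuousLinearMap.isInvertible_equiv_comp,
    ContinuousLinearMap.isInvertible_comp_equiv]

theorem inverse_coord {a b x y : L} (hx : x ∈ (chartAt E a).source)
    (hy : y ∈ (chartAt E b).source)
    (A : TangentSpace 𝓘(ℝ, E) x →L[ℝ] TangentSpace 𝓘(ℝ, E) y) :
    ((tr b y) ∘L A ∘L (trs a x)).inverse = (tr a x) ∘L A.inverse ∘L (trs b y) := by
  have : (tr b y) ∘L A ∘L (trs a x)
      = (trEquiv hy : _ →L[ℝ] E) ∘L A ∘L ((trEquiv hx).symm : E →L[ℝ] _) := by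
    ext e; rfl
  rw [this, ContinuousLinearMap.inverse_equiv_comp, ContinuousLinearMap.inverse_comp_equiv]
  ext e; rfl

/-- Inversion is a smooth map near an invertible operator of a Banach space, and it commutes with
passing to coordinates. -/
theorem HomSmoothAt.inverse [CompleteSpace E] (hA : HomSmoothAt IN f g A p₀)
    (hf : ContinuousAt f p₀) (hg : ContinuousAt g p₀)
    (hinv : (A p₀).IsInvertible) : HomSmoothAt IN g f (fun p => (A p).inverse) p₀ := by
  have h0 := (isInvertible_coord_iff (mem_chart_source E (f p₀)) (mem_chart_source E (g p₀))
    (A p₀)).2 hinv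
  obtain ⟨e, he⟩ := h0
  have h1 : ContDiffAt ℝ ∞ (ContinuousLinearMap.inverse : (E →L[ℝ] E) → (E →L[ℝ] E))
      ((fun p => (tr (g p₀) (g p)) ∘L (A p) ∘L (trs (f p₀) (f p))) p₀) := by
    have := contDiffAt_map_inverse (𝕜 := ℝ) (n := ∞) e
    rw [he] at this
    exact this
  have h2 := h1.contMDiffAt.comp p₀ hA
  refine h2.congr_of_eventuallyEq ?_
  filter_upwards [eventually_mem_chart (E := E) hf, eventually_mem_chart (E := E) hg] with p hp hp'
  exact (inverse_coord hp hp' (A p)).symm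

theorem HomSmoothAt.eventually_isInvertible [CompleteSpace E] (hA : HomSmoothAt IN f g A p₀)
    (hf : ContinuousAt f p₀) (hg : ContinuousAt g p₀)
    (hinv : (A p₀).IsInvertible) : ∀ᶠ p in 𝓝 p₀, (A p).IsInvertible := by
  have h0 := (isInvertible_coord_iff (mem_chart_source E (f p₀)) (mem_chart_source E (g p₀))
    (A p₀)).2 hinv
  have h1 : {T : E →L[ℝ] E | T.IsInvertible} ∈
      𝓝 ((tr (g p₀) (g p₀)) ∘L (A p₀) ∘L (trs (f p₀) (f p₀))) := by
    obtain ⟨e, he⟩ := h0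
    rw [← he]
    exact ContinuousLinearEquiv.nhds e
  filter_upwards [hA.continuousAt.eventually h1, eventually_mem_chart (E := E) hf,
    eventually_mem_chart (E := E) hg] with p hp hp1 hp2
  exact (isInvertible_coord_iff hp1 hp2 (A p)).1 hp

/-- The differential of a moving map goes from the fibre at `g p` to the fibre at `Φ p (g p)`; this
is why source and target base points vary separately in `HomSmoothAt`. -/
theorem HomSmoothAt.mfderiv [IsManifold IN ∞ N] {Φ : N → L → L} {g : N → L}
    (hΦ : ContMDiffAt (IN.prod 𝓘(ℝ, E)) 𝓘(ℝ, E) ∞ (Function.uncurry Φ) (p₀, g p₀))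
    (hg : ContMDiffAt IN 𝓘(ℝ, E) ∞ g p₀) :
    HomSmoothAt IN g (fun p => Φ p (g p))
      (fun p => mfderiv 𝓘(ℝ, E) 𝓘(ℝ, E) (Φ p) (g p)) p₀ :=
  ContMDiffAt.mfderiv Φ g hΦ hg le_rfl

variable {EN' : Type*} [NormedAddCommGroup EN'] [NormedSpace ℝ EN'] {HN' : Type*}
  [TopologicalSpace HN']
  {N' : Type*} [TopologicalSpace N'] [ChartedSpace HN' N'] {IN' : ModelWithCorners ℝ EN' HN'}

theorem HomSmoothAt.comp_map {k : N' → N} {q₀ : N'} (hA : HomSmoothAt IN f g A (k q₀))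
    (hk : ContMDiffAt IN' IN ∞ k q₀) :
    HomSmoothAt IN' (fun q => f (k q)) (fun q => g (k q)) (fun q => A (k q)) q₀ :=
  ContMDiffAt.comp q₀ hA hk

theorem CovSmoothAt.comp_map {k : N' → N} {q₀ : N'} (hη : CovSmoothAt IN g η (k q₀))
    (hk : ContMDiffAt IN' IN ∞ k q₀) :
    CovSmoothAt IN' (fun q => g (k q)) (fun q => η (k q)) q₀ :=
  ContMDiffAt.comp q₀ hη hk

theorem VecSmoothAt.comp_map {k : N' → N} {q₀ : N'} (hV : VecSmoothAt IN g V (k q₀))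
    (hk : ContMDiffAt IN' IN ∞ k q₀) :
    VecSmoothAt IN' (fun q => g (k q)) (fun q => V (k q)) q₀ :=
  ContMDiffAt.comp q₀ hV hk

theorem smoothVF_iff {V : VField E L} :
    SmoothVF V ↔ ∀ x, VecSmoothAt 𝓘(ℝ, E) (fun x => x) V x := by
  refine forall_congr' fun x => ?_
  rw [Bundle.contMDiffAt_section]
  refine Filter.EventuallyEq.contMDiffAt_iff ?_
  filter_upwards [eventually_mem_chart (E := E) (continuousAt_id (x := x))] with y hy
  exact ((trivializationAt E (TangentSpace 𝓘(ℝ, E)) x).continuousLinearMapAt_apply_of_mem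
    (R := ℝ) hy _).symm

theorem covSmoothAt_iff {M : Type*} [TopologicalSpace M] [ChartedSpace HN M] {f : M → L}
    {α : (p : M) → TangentSpace 𝓘(ℝ, E) (f p) →L[ℝ] ℝ} {p₀ : M} :
    ContMDiffAt IN (𝓘(ℝ, E).prod 𝓘(ℝ, E →L[ℝ] ℝ)) ∞
      (fun p => Bundle.TotalSpace.mk' (E →L[ℝ] ℝ)
        (E := fun x : L => TangentSpace 𝓘(ℝ, E) x →L[ℝ] ℝ) (f p) (α p)) p₀ ↔
    ContMDiffAt IN 𝓘(ℝ, E) ∞ f p₀ ∧ CovSmoothAt IN f α p₀ := by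
  rw [contMDiffAt_hom_bundle]
  refine and_congr Iff.rfl ?_
  unfold CovSmoothAt
  refine iff_of_eq ?_
  congr 1
  funext p
  ext e
  simp [ContinuousLinearMap.inCoordinates, trs]

theorem homSmoothAt_iff {M : Type*} [TopologicalSpace M] [ChartedSpace HN M] {f : M → L}
    {S : (p : M) → TangentSpace 𝓘(ℝ, E) (f p) →L[ℝ] TangentSpace 𝓘(ℝ, E) (f p)} {p₀ : M} :
    ContMDiffAt IN (𝓘(ℝ, E).prod 𝓘(ℝ, E →L[ℝ] E)) ∞
      (fun p => Bundle.TotalSpace.mk' (E →L[ℝ] E)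
        (E := fun x : L => TangentSpace 𝓘(ℝ, E) x →L[ℝ] TangentSpace 𝓘(ℝ, E) x) (f p) (S p)) p₀ ↔
    ContMDiffAt IN 𝓘(ℝ, E) ∞ f p₀ ∧ HomSmoothAt IN f f S p₀ := by
  rw [contMDiffAt_hom_bundle]
  rfl

theorem smoothForm_iff {α : Form1 E L} :
    SmoothForm α ↔ ∀ x, CovSmoothAt 𝓘(ℝ, E) (fun x => x) α x :=
  forall_congr' fun _ => covSmoothAt_iff.trans (and_iff_right contMDiffAt_id)

theorem smoothEnd_iff {S : EndField E L} :
    SmoothEnd S ↔ ∀ x, HomSmoothAt 𝓘(ℝ, E) (fun x => x) (fun x => x) S x :=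
  forall_congr' fun _ => homSmoothAt_iff.trans (and_iff_right contMDiffAt_id)

theorem contMDiffOn_prod_univ_iff {F' : Type*} [NormedAddCommGroup F'] [NormedSpace ℝ F']
    {H' M' : Type*} [TopologicalSpace H'] [TopologicalSpace M'] [ChartedSpace H' M']
    {I' : ModelWithCorners ℝ F' H'} {I : Set ℝ} (hI : IsOpen I) {F : ℝ × L → M'} :
    ContMDiffOn (𝓘(ℝ, ℝ).prod 𝓘(ℝ, E)) I' ∞ F (I ×ˢ univ) ↔
      ∀ t ∈ I, ∀ x, ContMDiffAt (𝓘(ℝ, ℝ).prod 𝓘(ℝ, E)) I' ∞ F (t, x) := by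
  constructor
  · intro h t ht x
    exact h.contMDiffAt ((hI.prod isOpen_univ).mem_nhds ⟨ht, mem_univ x⟩)
  · rintro h ⟨t, x⟩ ⟨ht, -⟩
    exact (h t ht x).contMDiffWithinAt

theorem smoothFormFamily_iff {I : Set ℝ} (hI : IsOpen I) {α : ℝ → Form1 E L} :
    SmoothFormFamily I α ↔ ∀ t ∈ I, ∀ x, CovSmoothAt (𝓘(ℝ, ℝ).prod 𝓘(ℝ, E))
      (fun p : ℝ × L => p.2) (fun p => α p.1 p.2) (t, x) := by
  refine (contMDiffOn_prod_univ_iff hI).trans ?_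
  refine forall_congr' fun t => forall_congr' fun _ => forall_congr' fun x =>
    covSmoothAt_iff.trans (and_iff_right contMDiffAt_snd)

theorem smoothEndFamily_iff {I : Set ℝ} (hI : IsOpen I) {S : ℝ → EndField E L} :
    SmoothEndFamily I S ↔ ∀ t ∈ I, ∀ x, HomSmoothAt (𝓘(ℝ, ℝ).prod 𝓘(ℝ, E))
      (fun p : ℝ × L => p.2) (fun p : ℝ × L => p.2) (fun p => S p.1 p.2) (t, x) := by
  refine (contMDiffOn_prod_univ_iff hI).trans ?_
  refine forall_congr' fun t => forall_congr' fun _ => forall_congr' fun x =>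
    homSmoothAt_iff.trans (and_iff_right contMDiffAt_snd)

end Coordinates

/-! ### Interchange of parameter and space derivatives. -/

section MixedDerivative

variable {E F : Type*} [NormedAddCommGroup E] [NormedSpace ℝ E]
  [NormedAddCommGroup F] [NormedSpace ℝ F]

/-- Differentiation in the parameter commutes with differentiation in the variable. -/
theorem hasDerivAt_fderiv_of_contDiffAt {f : ℝ × E → F} {g : E → F} {t₀ : ℝ} {y₀ : E}
    (hf : ContDiffAt ℝ 2 f (t₀, y₀))
    (hg : ∀ᶠ y in 𝓝 y₀, HasDerivAt (fun t => f (t, y)) (g y) t₀) :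
    HasDerivAt (fun t => fderiv ℝ (fun y => f (t, y)) y₀) (fderiv ℝ g y₀) t₀ := by
  have hev : ∀ᶠ p in 𝓝 (t₀, y₀), DifferentiableAt ℝ f p :=
    (hf.eventually (by simp)).mono fun p hp => hp.differentiableAt (by simp)
  have hD : DifferentiableAt ℝ (fderiv ℝ f) (t₀, y₀) :=
    (hf.fderiv_right (m := 1) (by norm_num)).differentiableAt (by simp)
  have hc1 : Continuous fun t : ℝ => (t, y₀) := by fun_prop
  have hc2 : Continuous fun y : E => (t₀, y) := by fun_prop
  have h1 : (fun t => fderiv ℝ (fun y => f (t, y)) y₀) =ᶠ[𝓝 t₀]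
      fun t => (fderiv ℝ f (t, y₀)) ∘L (ContinuousLinearMap.inr ℝ ℝ E) := by
    filter_upwards [hc1.continuousAt.eventually hev] with t ht
    have h2 : HasFDerivAt (fun y : E => (t, y)) (ContinuousLinearMap.inr ℝ ℝ E) y₀ := by
      simpa using! (hasFDerivAt_prodMk_right (𝕜 := ℝ) t y₀)
    exact (ht.hasFDerivAt.comp y₀ h2).fderiv
  -- By uniqueness of derivatives `g` is the partial derivative of `f` in `t`, so its own derivative
  -- is a mixed second derivative of `f`.
  have h3 : g =ᶠ[𝓝 y₀] fun y => fderiv ℝ f (t₀, y) (1, 0) := by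
    filter_upwards [hc2.continuousAt.eventually hev, hg] with y hy hgy
    have h2 : HasDerivAt (fun t : ℝ => (t, y)) ((1 : ℝ), (0 : E)) t₀ :=
      (hasDerivAt_id t₀).prodMk (hasDerivAt_const t₀ y)
    exact hgy.unique (hy.hasFDerivAt.comp_hasDerivAt t₀ h2)
  have h4 : HasDerivAt (fun t => (fderiv ℝ f (t, y₀)) ∘L (ContinuousLinearMap.inr ℝ ℝ E))
      ((fderiv ℝ (fderiv ℝ f) (t₀, y₀) (1, 0)) ∘L (ContinuousLinearMap.inr ℝ ℝ E)) t₀ := by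
    have h2 : HasDerivAt (fun t : ℝ => (t, y₀)) ((1 : ℝ), (0 : E)) t₀ :=
      (hasDerivAt_id t₀).prodMk (hasDerivAt_const t₀ y₀)
    have h5 : HasDerivAt (fun t => fderiv ℝ f (t, y₀)) (fderiv ℝ (fderiv ℝ f) (t₀, y₀) (1, 0)) t₀ :=
      hD.hasFDerivAt.comp_hasDerivAt t₀ h2
    have h8 := h5.clm_comp (hasDerivAt_const t₀ (ContinuousLinearMap.inr ℝ ℝ E))
    simpa using h8
  have h6 : fderiv ℝ g y₀
      = (fderiv ℝ (fderiv ℝ f) (t₀, y₀) (1, 0)) ∘L (ContinuousLinearMap.inr ℝ ℝ E) := by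
    rw [h3.fderiv_eq]
    have h2 : HasFDerivAt (fun y : E => (t₀, y)) (ContinuousLinearMap.inr ℝ ℝ E) y₀ := by
      simpa using! (hasFDerivAt_prodMk_right (𝕜 := ℝ) t₀ y₀)
    have h5 : HasFDerivAt (fun y => fderiv ℝ f (t₀, y)) _ y₀ := hD.hasFDerivAt.comp y₀ h2
    have h7 := (h5.clm_apply (hasFDerivAt_const ((1 : ℝ), (0 : E)) y₀)).fderiv
    rw [h7]
    ext v
    -- Symmetry of the second derivative exchanges the two orders of differentiation.
    have hs := (hf.isSymmSndFDerivAt (by simp)).eq ((0 : ℝ), v) (1, 0)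
    simpa using hs
  rw [h6]
  exact h4.congr_of_eventuallyEq h1

end MixedDerivative

/-! ### Brackets, exterior and Lie derivatives at the centre of a chart. -/

section ChartFormulas

variable {E : Type*} [NormedAddCommGroup E] [NormedSpace ℝ E]
  {L : Type*} [TopologicalSpace L] [ChartedSpace E L] [IsManifold 𝓘(ℝ, E) ∞ L]

/-- The inverse of the preferred chart at `x₀`. -/
def cs (x₀ : L) : E → L := (extChartAt 𝓘(ℝ, E) x₀).symm

/-- The coordinates of `x₀` in its preferred chart. -/
def ctr (x₀ : L) : E := extChartAt 𝓘(ℝ, E) x₀ x₀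

/-- A vector field in the chart at `x₀`. -/
def vr (x₀ : L) (V : VField E L) (z : E) : E := tr x₀ (cs x₀ z) (V (cs x₀ z))

/-- A 1-form in the chart at `x₀`. -/
def fr (x₀ : L) (α : Form1 E L) (z : E) : E →L[ℝ] ℝ := (α (cs x₀ z)) ∘L (trs x₀ (cs x₀ z))

/-- A field of endomorphisms in the chart at `x₀`. -/
def er (x₀ : L) (S : EndField E L) (z : E) : E →L[ℝ] E :=
  (tr x₀ (cs x₀ z)) ∘L (S (cs x₀ z)) ∘L (trs x₀ (cs x₀ z))

theorem cs_ctr (x₀ : L) : cs x₀ (ctr (E := E) x₀) = x₀ := extChartAt_to_inv x₀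

theorem vr_ctr (x₀ : L) (V : VField E L) : vr x₀ V (ctr x₀) = V x₀ := by
  unfold vr; rw [cs_ctr]; exact tr_self x₀ _

theorem fr_ctr (x₀ : L) (α : Form1 E L) (v : E) : fr x₀ α (ctr x₀) v = α x₀ v := by
  unfold fr; rw [cs_ctr, ContinuousLinearMap.comp_apply, trs_self]

theorem er_ctr (x₀ : L) (S : EndField E L) (v : E) : er x₀ S (ctr x₀) v = S x₀ v := by
  unfold er; rw [cs_ctr]
  exact (tr_self x₀ _).trans (congrArg (S x₀) (trs_self x₀ v))

theorem er_ctr_eq (x₀ : L) (S : EndField E L) : er x₀ S (ctr x₀) = S x₀ :=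
  ContinuousLinearMap.ext fun v => er_ctr x₀ S v

theorem target_mem_nhds (x₀ : L) : (extChartAt 𝓘(ℝ, E) x₀).target ∈ 𝓝 (ctr (E := E) x₀) :=
  extChartAt_target_mem_nhds x₀

theorem ctr_mem_target (x₀ : L) : ctr (E := E) x₀ ∈ (extChartAt 𝓘(ℝ, E) x₀).target :=
  mem_extChartAt_target x₀

theorem cs_mem {x₀ : L} {z : E} (hz : z ∈ (extChartAt 𝓘(ℝ, E) x₀).target) :
    cs x₀ z ∈ (chartAt E x₀).source := by
  have := (extChartAt 𝓘(ℝ, E) x₀).map_target hz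
  rwa [extChartAt_source] at this

theorem contMDiffAt_cs {x₀ : L} {z : E} (hz : z ∈ (extChartAt 𝓘(ℝ, E) x₀).target) :
    ContMDiffAt 𝓘(ℝ, E) 𝓘(ℝ, E) ∞ (cs x₀) z :=
  (contMDiffOn_extChartAt_symm x₀).contMDiffAt ((isOpen_extChartAt_target x₀).mem_nhds hz)

theorem contMDiffAt_cs_ctr (x₀ : L) : ContMDiffAt 𝓘(ℝ, E) 𝓘(ℝ, E) ∞ (cs x₀) (ctr (E := E) x₀) :=
  contMDiffAt_cs (mem_extChartAt_target x₀)

theorem fr_apply_vr {x₀ : L} {z : E} (hz : z ∈ (extChartAt 𝓘(ℝ, E) x₀).target)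
    (α : Form1 E L) (V : VField E L) : fr x₀ α z (vr x₀ V z) = ev α V (cs x₀ z) := by
  simp [fr, vr, ev, trs_tr (cs_mem hz)]

theorem er_apply_vr {x₀ : L} {z : E} (hz : z ∈ (extChartAt 𝓘(ℝ, E) x₀).target)
    (S : EndField E L) (V : VField E L) : er x₀ S z (vr x₀ V z) = vr x₀ (app S V) z := by
  simp [er, vr, app, trs_tr (cs_mem hz)]

theorem VecSmoothAt.contDiffAt {x₀ : L} {V : VField E L}
    (h : VecSmoothAt 𝓘(ℝ, E) (fun x => x) V x₀) : ContDiffAt ℝ ∞ (vr x₀ V) (ctr x₀) :=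
  (ContMDiffAt.comp_of_eq h (contMDiffAt_cs_ctr x₀) (cs_ctr x₀)).contDiffAt

theorem CovSmoothAt.contDiffAt {x₀ : L} {α : Form1 E L}
    (h : CovSmoothAt 𝓘(ℝ, E) (fun x => x) α x₀) : ContDiffAt ℝ ∞ (fr x₀ α) (ctr x₀) :=
  (ContMDiffAt.comp_of_eq h (contMDiffAt_cs_ctr x₀) (cs_ctr x₀)).contDiffAt

theorem HomSmoothAt.contDiffAt {x₀ : L} {S : EndField E L}
    (h : HomSmoothAt 𝓘(ℝ, E) (fun x => x) (fun x => x) S x₀) :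
    ContDiffAt ℝ ∞ (er x₀ S) (ctr x₀) :=
  (ContMDiffAt.comp_of_eq h (contMDiffAt_cs_ctr x₀) (cs_ctr x₀)).contDiffAt

theorem contMDiffAt_prod_cs (t : ℝ) (x₀ : L) :
    ContMDiffAt 𝓘(ℝ, ℝ × E) (𝓘(ℝ, ℝ).prod 𝓘(ℝ, E)) ∞ (fun p : ℝ × E => (p.1, cs x₀ p.2))
      (t, ctr x₀) :=
  contDiff_fst.contMDiff.contMDiffAt.prodMk
    (ContMDiffAt.comp_of_eq (contMDiffAt_cs_ctr x₀) contDiff_snd.contMDiff.contMDiffAt rfl)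

theorem CovSmoothAt.contDiffAt_family {t : ℝ} {x₀ : L} {α : ℝ → Form1 E L}
    (h : CovSmoothAt (𝓘(ℝ, ℝ).prod 𝓘(ℝ, E)) (fun p : ℝ × L => p.2) (fun p => α p.1 p.2) (t, x₀)) :
    ContDiffAt ℝ ∞ (fun p : ℝ × E => fr x₀ (α p.1) p.2) (t, ctr x₀) :=
  (ContMDiffAt.comp_of_eq h (contMDiffAt_prod_cs t x₀) (by simp [cs_ctr])).contDiffAt

theorem HomSmoothAt.contDiffAt_family {t : ℝ} {x₀ : L} {S : ℝ → EndField E L}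
    (h : HomSmoothAt (𝓘(ℝ, ℝ).prod 𝓘(ℝ, E)) (fun p : ℝ × L => p.2) (fun p : ℝ × L => p.2)
      (fun p => S p.1 p.2) (t, x₀)) :
    ContDiffAt ℝ ∞ (fun p : ℝ × E => er x₀ (S p.1) p.2) (t, ctr x₀) :=
  (ContMDiffAt.comp_of_eq h (contMDiffAt_prod_cs t x₀) (by simp [cs_ctr])).contDiffAt

theorem der_eq {x₀ : L} {f : L → ℝ} (hf : MDifferentiableAt 𝓘(ℝ, E) 𝓘(ℝ, ℝ) f x₀)
    (V : VField E L) :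
    der V f x₀ = fderiv ℝ (fun z => f (cs x₀ z)) (ctr x₀) (vr x₀ V (ctr x₀)) := by
  have h1 : mfderiv 𝓘(ℝ, E) 𝓘(ℝ, ℝ) f x₀
      = fderiv ℝ (fun z : E => f (cs (E := E) x₀ z)) (ctr (E := E) x₀) := by
    refine hf.mfderiv.trans ?_
    simp only [writtenInExtChartAt, modelWithCornersSelf_coe, range_id, fderivWithin_univ]
    rfl
  rw [vr_ctr]
  exact DFunLike.congr_fun h1 (V x₀)

/-- The manifold bracket is the bracket in the model space of the fields pulled back by the chart.
These pull-backs have the germs of `vr x₀ V` and `vr x₀ W`, and the differential of the chart at its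
centre is the identity. -/
theorem br_eq (V W : VField E L) (x₀ : L) :
    vr x₀ (br V W) (ctr x₀) = fderiv ℝ (vr x₀ W) (ctr x₀) (vr x₀ V (ctr x₀))
      - fderiv ℝ (vr x₀ V) (ctr x₀) (vr x₀ W (ctr x₀)) := by
  have key : ∀ U : VField E L, VectorField.mpullbackWithin 𝓘(ℝ, E) 𝓘(ℝ, E)
      (extChartAt 𝓘(ℝ, E) x₀).symm U (range 𝓘(ℝ, E)) =ᶠ[𝓝 (ctr (E := E) x₀)] vr x₀ U := by
    intro U
    filter_upwards [target_mem_nhds x₀] with z hz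
    rw [VectorField.mpullbackWithin_apply]
    have h1 : extChartAt 𝓘(ℝ, E) x₀ (cs x₀ z) = z := (extChartAt 𝓘(ℝ, E) x₀).right_inv hz
    have h2 := trs_eq_mfderiv (cs_mem hz)
    rw [h1] at h2
    rw [← h2]
    have h3 : trs x₀ (cs x₀ z) = ((trEquiv (cs_mem hz)).symm : E →L[ℝ] _) := by ext e; rfl
    rw [h3]
    erw [ContinuousLinearMap.inverse_equiv]
    rfl
  have h1 := Filter.EventuallyEq.lieBracket_vectorField_eq (𝕜 := ℝ) (key V) (key W)
  rw [vr_ctr]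
  refine Eq.trans ?_ h1
  have h2 : (mfderiv 𝓘(ℝ, E) 𝓘(ℝ, E) (extChartAt 𝓘(ℝ, E) x₀) x₀).inverse
      = ContinuousLinearMap.id ℝ E := by
    rw [mfderiv_extChartAt_self]
    exact (ContinuousLinearMap.inverse_id : (ContinuousLinearMap.id ℝ E).inverse = _)
  let w : E := VectorField.lieBracketWithin (𝕜 := ℝ) (E := E)
      (VectorField.mpullbackWithin 𝓘(ℝ, E) 𝓘(ℝ, E) (extChartAt 𝓘(ℝ, E) x₀).symm V
        (range 𝓘(ℝ, E)))
      (VectorField.mpullbackWithin 𝓘(ℝ, E) 𝓘(ℝ, E) (extChartAt 𝓘(ℝ, E) x₀).symm W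
        (range 𝓘(ℝ, E)))
      ((extChartAt 𝓘(ℝ, E) x₀).symm ⁻¹' univ ∩ range 𝓘(ℝ, E)) (ctr (E := E) x₀)
  have h3 : br V W x₀ = (mfderiv 𝓘(ℝ, E) 𝓘(ℝ, E) (extChartAt 𝓘(ℝ, E) x₀) x₀).inverse w := rfl
  refine h3.trans ((DFunLike.congr_fun h2 w).trans ?_)
  simp only [w, modelWithCornersSelf_coe, range_id, preimage_univ, inter_univ]
  exact congrFun (VectorField.lieBracketWithin_univ (𝕜 := ℝ) (E := E)) (ctr (E := E) x₀)

theorem fderiv_ev {x₀ : L} {α : Form1 E L} {V : VField E L}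
    (hα : DifferentiableAt ℝ (fr x₀ α) (ctr x₀)) (hV : DifferentiableAt ℝ (vr x₀ V) (ctr x₀))
    (u : E) : fderiv ℝ (fun z => ev α V (cs x₀ z)) (ctr x₀) u
      = fderiv ℝ (fr x₀ α) (ctr x₀) u (vr x₀ V (ctr x₀))
        + fr x₀ α (ctr x₀) (fderiv ℝ (vr x₀ V) (ctr x₀) u) := by
  have h1 : (fun z => ev α V (cs x₀ z)) =ᶠ[𝓝 (ctr x₀)] fun z => fr x₀ α z (vr x₀ V z) := by
    filter_upwards [target_mem_nhds x₀] with z hz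
    exact (fr_apply_vr hz α V).symm
  rw [h1.fderiv_eq, fderiv_clm_apply hα hV]
  simp [add_comm]

theorem fderiv_app {x₀ : L} {S : EndField E L} {V : VField E L}
    (hS : DifferentiableAt ℝ (er x₀ S) (ctr x₀)) (hV : DifferentiableAt ℝ (vr x₀ V) (ctr x₀))
    (u : E) : fderiv ℝ (vr x₀ (app S V)) (ctr x₀) u
      = fderiv ℝ (er x₀ S) (ctr x₀) u (vr x₀ V (ctr x₀))
        + er x₀ S (ctr x₀) (fderiv ℝ (vr x₀ V) (ctr x₀) u) := by
  have h1 : vr x₀ (app S V) =ᶠ[𝓝 (ctr x₀)] fun z => er x₀ S z (vr x₀ V z) := by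
    filter_upwards [target_mem_nhds x₀] with z hz
    exact (er_apply_vr hz S V).symm
  rw [h1.fderiv_eq, fderiv_clm_apply hS hV]
  simp [add_comm]

theorem ev_eq_fr {x₀ : L} (α : Form1 E L) (V : VField E L) :
    ev α V x₀ = fr x₀ α (ctr x₀) (vr x₀ V (ctr x₀)) := by
  rw [fr_apply_vr (ctr_mem_target x₀), cs_ctr]

theorem SmoothForm.covSmoothAt {α : Form1 E L} (h : SmoothForm α) (x : L) :
    CovSmoothAt 𝓘(ℝ, E) (fun x => x) α x := smoothForm_iff.1 h x

theorem SmoothVF.vecSmoothAt {V : VField E L} (h : SmoothVF V) (x : L) :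
    VecSmoothAt 𝓘(ℝ, E) (fun x => x) V x := smoothVF_iff.1 h x

theorem SmoothEnd.homSmoothAt {S : EndField E L} (h : SmoothEnd S) (x : L) :
    HomSmoothAt 𝓘(ℝ, E) (fun x => x) (fun x => x) S x := smoothEnd_iff.1 h x

theorem SmoothForm.differentiableAt {α : Form1 E L} (h : SmoothForm α) (x₀ : L) :
    DifferentiableAt ℝ (fr x₀ α) (ctr x₀) :=
  (h.covSmoothAt x₀).contDiffAt.differentiableAt (by simp)

theorem SmoothVF.differentiableAt {V : VField E L} (h : SmoothVF V) (x₀ : L) :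
    DifferentiableAt ℝ (vr x₀ V) (ctr x₀) :=
  (h.vecSmoothAt x₀).contDiffAt.differentiableAt (by simp)

theorem SmoothEnd.differentiableAt {S : EndField E L} (h : SmoothEnd S) (x₀ : L) :
    DifferentiableAt ℝ (er x₀ S) (ctr x₀) :=
  (h.homSmoothAt x₀).contDiffAt.differentiableAt (by simp)

theorem contMDiff_ev {α : Form1 E L} {V : VField E L} (hα : SmoothForm α) (hV : SmoothVF V) :
    ContMDiff 𝓘(ℝ, E) 𝓘(ℝ, ℝ) ∞ (ev α V) := fun x =>
  (hα.covSmoothAt x).apply (hV.vecSmoothAt x) continuousAt_id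

theorem SmoothEnd.app {S : EndField E L} {V : VField E L} (hS : SmoothEnd S) (hV : SmoothVF V) :
    SmoothVF (app S V) :=
  smoothVF_iff.2 fun x => (hS.homSmoothAt x).apply (hV.vecSmoothAt x) continuousAt_id

theorem der_ev {x₀ : L} {α : Form1 E L} {V : VField E L} (hα : SmoothForm α) (hV : SmoothVF V)
    (U : VField E L) : der U (ev α V) x₀
      = fderiv ℝ (fr x₀ α) (ctr x₀) (vr x₀ U (ctr x₀)) (vr x₀ V (ctr x₀))
        + fr x₀ α (ctr x₀) (fderiv ℝ (vr x₀ V) (ctr x₀) (vr x₀ U (ctr x₀))) := by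
  rw [der_eq ((contMDiff_ev hα hV).mdifferentiableAt (by simp)),
    fderiv_ev (hα.differentiableAt x₀) (hV.differentiableAt x₀)]

/-- The derivatives of `V` and `W` cancel against the bracket term, leaving the antisymmetrised
derivative of the form. -/
theorem extD_eq {α : Form1 E L} {V W : VField E L} (hα : SmoothForm α) (hV : SmoothVF V)
    (hW : SmoothVF W) (x₀ : L) : extD α V W x₀
      = fderiv ℝ (fr x₀ α) (ctr x₀) (vr x₀ V (ctr x₀)) (vr x₀ W (ctr x₀))
        - fderiv ℝ (fr x₀ α) (ctr x₀) (vr x₀ W (ctr x₀)) (vr x₀ V (ctr x₀)) := by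
  rw [extD, der_ev hα hW, der_ev hα hV, ev_eq_fr α (br V W), br_eq, map_sub]
  ring

theorem lieD_eq {α : Form1 E L} {X V : VField E L} (hα : SmoothForm α) (hV : SmoothVF V)
    (x₀ : L) : lieD X α V x₀
      = fderiv ℝ (fr x₀ α) (ctr x₀) (vr x₀ X (ctr x₀)) (vr x₀ V (ctr x₀))
        + fr x₀ α (ctr x₀) (fderiv ℝ (vr x₀ X) (ctr x₀) (vr x₀ V (ctr x₀))) := by
  rw [lieD, der_ev hα hV, ev_eq_fr α (br X V), br_eq, map_sub]
  ring

end ChartFormulas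

/-! ### First-order expansion in `t` of a curve of pairs and of its 1-jets. -/

section TimeDerivatives

variable {E : Type*} [NormedAddCommGroup E] [NormedSpace ℝ E]
  {L : Type*} [TopologicalSpace L] [ChartedSpace E L] [IsManifold 𝓘(ℝ, E) ∞ L]

theorem two_le_infty : (2 : WithTop ℕ∞) ≤ ∞ := by
  have : ((2 : ℕ∞) : WithTop ℕ∞) ≤ ((⊤ : ℕ∞) : WithTop ℕ∞) := WithTop.coe_le_coe.2 le_top
  exact this

/-- `HasTangent` is only pointwise convergence on vectors. Joint smoothness supplies a derivative in
operator norm, and the pointwise limits identify it. -/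
theorem hasDerivAt_clm_of_apply {F G P : Type*} [NormedAddCommGroup F] [NormedSpace ℝ F]
    [NormedAddCommGroup G] [NormedSpace ℝ G] [NormedAddCommGroup P] [NormedSpace ℝ P]
    {f : ℝ × P → F →L[ℝ] G} {g : F →L[ℝ] G} {y : P}
    (hf : ContDiffAt ℝ 2 f (0, y)) (h : ∀ v, HasDerivAt (fun t => f (t, y) v) (g v) 0) :
    HasDerivAt (fun t => f (t, y)) g 0 := by
  have h2 : HasDerivAt (fun t : ℝ => (t, y)) ((1 : ℝ), (0 : P)) 0 :=
    (hasDerivAt_id 0).prodMk (hasDerivAt_const 0 y)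
  have h1 : DifferentiableAt ℝ (fun t => f (t, y)) 0 :=
    ((hf.differentiableAt (by simp)).hasFDerivAt.comp_hasDerivAt 0 h2).differentiableAt
  have h3 : deriv (fun t => f (t, y)) 0 = g := by
    ext v
    have h4 := h1.hasDerivAt.clm_apply (hasDerivAt_const (0 : ℝ) v)
    simpa using h4.unique (h v)
  exact h3 ▸ h1.hasDerivAt

theorem hasDerivAt_of_tendsto_inv_smul {F : Type*} [NormedAddCommGroup F] [NormedSpace ℝ F]
    {f : ℝ → F} {b : F} (h0 : f 0 = 0) (h : Tendsto (fun t : ℝ => t⁻¹ • f t) (𝓝[≠] 0) (𝓝 b)) :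
    HasDerivAt f b 0 := by
  rw [hasDerivAt_iff_tendsto_slope_zero]
  simpa [h0] using h

theorem tendsto_inv_smul_of_hasDerivAt {F : Type*} [NormedAddCommGroup F] [NormedSpace ℝ F]
    {f : ℝ → F} {b : F} (h0 : f 0 = 0) (h : HasDerivAt f b 0) :
    Tendsto (fun t : ℝ => t⁻¹ • f t) (𝓝[≠] 0) (𝓝 b) := by
  rw [hasDerivAt_iff_tendsto_slope_zero] at h
  simpa [h0] using h

variable {F : LeviFlatStructure E L} {X : VField E L} {I : Set ℝ}
  {α : ℝ → Form1 E L} {S : ℝ → EndField E L} {β : Form1 E L} {P : EndField E L}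

theorem SmoothFormFamily.smoothForm (hI : IsOpen I) (h : SmoothFormFamily I α) {t : ℝ}
    (ht : t ∈ I) : SmoothForm (α t) := smoothForm_iff.2 fun x =>
  CovSmoothAt.comp_map (k := fun x : L => (t, x)) ((smoothFormFamily_iff hI).1 h t ht x)
    (contMDiffAt_const.prodMk contMDiffAt_id)

theorem SmoothEndFamily.smoothEnd (hI : IsOpen I) (h : SmoothEndFamily I S) {t : ℝ}
    (ht : t ∈ I) : SmoothEnd (S t) := smoothEnd_iff.2 fun x =>
  HomSmoothAt.comp_map (f := fun p : ℝ × L => p.2) (g := fun p : ℝ × L => p.2)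
    (A := fun p : ℝ × L => S p.1 p.2) (k := fun x : L => (t, x))
    ((smoothEndFamily_iff hI).1 h t ht x)
    (contMDiffAt_const.prodMk contMDiffAt_id)

theorem IsPairCurve.contDiffAt_form (hI : IsOpen I) (hc : IsPairCurve F X I α S) {t : ℝ}
    (ht : t ∈ I) (x₀ : L) :
    ContDiffAt ℝ ∞ (fun p : ℝ × E => fr x₀ (α p.1) p.2) (t, ctr x₀) :=
  ((smoothFormFamily_iff hI).1 hc.smooth_α t ht x₀).contDiffAt_family

theorem IsPairCurve.contDiffAt_endo (hI : IsOpen I) (hc : IsPairCurve F X I α S) {t : ℝ}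
    (ht : t ∈ I) (x₀ : L) :
    ContDiffAt ℝ ∞ (fun p : ℝ × E => er x₀ (S p.1) p.2) (t, ctr x₀) :=
  ((smoothEndFamily_iff hI).1 hc.smooth_S t ht x₀).contDiffAt_family

theorem HasTangent.eventually_hasDerivAt_form (hI : IsOpen I) (h0 : (0 : ℝ) ∈ I)
    (hc : IsPairCurve F X I α S) (ht : HasTangent α S β P) (x₀ : L) :
    ∀ᶠ z in 𝓝 (ctr (E := E) x₀), HasDerivAt (fun t => fr x₀ (α t) z) (fr x₀ β z) 0 := by
  have h1 : ContDiffAt ℝ 2 (fun p : ℝ × E => fr x₀ (α p.1) p.2) (0, ctr x₀) :=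
    (hc.contDiffAt_form hI h0 x₀).of_le two_le_infty
  have hc2 : Continuous fun y : E => ((0 : ℝ), y) := by fun_prop
  filter_upwards [hc2.continuousAt.eventually (h1.eventually (by simp))] with z hz
  refine hasDerivAt_clm_of_apply (f := fun p : ℝ × E => fr x₀ (α p.1) p.2) hz fun v => ?_
  refine hasDerivAt_of_tendsto_inv_smul ?_ ?_
  · simp [fr, hc.α_zero]
  · exact ht.form (cs x₀ z) (trs x₀ (cs x₀ z) v)

theorem HasTangent.eventually_hasDerivAt_endo (hI : IsOpen I) (h0 : (0 : ℝ) ∈ I)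
    (hc : IsPairCurve F X I α S) (ht : HasTangent α S β P) (x₀ : L) :
    ∀ᶠ z in 𝓝 (ctr (E := E) x₀), HasDerivAt (fun t => er x₀ (S t) z) (er x₀ P z) 0 := by
  have h1 : ContDiffAt ℝ 2 (fun p : ℝ × E => er x₀ (S p.1) p.2) (0, ctr x₀) :=
    (hc.contDiffAt_endo hI h0 x₀).of_le two_le_infty
  have hc2 : Continuous fun y : E => ((0 : ℝ), y) := by fun_prop
  filter_upwards [hc2.continuousAt.eventually (h1.eventually (by simp))] with z hz
  refine hasDerivAt_clm_of_apply (f := fun p : ℝ × E => er x₀ (S p.1) p.2) hz fun v => ?_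
  refine hasDerivAt_of_tendsto_inv_smul ?_ ?_
  · simp [er, hc.S_zero]
  · have h2 := ((tr x₀ (cs x₀ z)).continuous.tendsto _).comp
      (ht.endo (cs x₀ z) (trs x₀ (cs x₀ z) v))
    refine h2.congr fun t => ?_
    simp [er]

theorem HasTangent.hasDerivAt_form (hI : IsOpen I) (h0 : (0 : ℝ) ∈ I)
    (hc : IsPairCurve F X I α S) (ht : HasTangent α S β P) (x₀ : L) :
    HasDerivAt (fun t => fr x₀ (α t) (ctr x₀)) (fr x₀ β (ctr x₀)) 0 :=
  (ht.eventually_hasDerivAt_form hI h0 hc x₀).self_of_nhds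

theorem HasTangent.hasDerivAt_fderiv_form (hI : IsOpen I) (h0 : (0 : ℝ) ∈ I)
    (hc : IsPairCurve F X I α S) (ht : HasTangent α S β P) (x₀ : L) :
    HasDerivAt (fun t => fderiv ℝ (fr x₀ (α t)) (ctr x₀)) (fderiv ℝ (fr x₀ β) (ctr x₀)) 0 :=
  hasDerivAt_fderiv_of_contDiffAt (f := fun p : ℝ × E => fr x₀ (α p.1) p.2)
    ((hc.contDiffAt_form hI h0 x₀).of_le two_le_infty)
    (ht.eventually_hasDerivAt_form hI h0 hc x₀)

theorem HasTangent.hasDerivAt_endo (hI : IsOpen I) (h0 : (0 : ℝ) ∈ I)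
    (hc : IsPairCurve F X I α S) (ht : HasTangent α S β P) (x₀ : L) :
    HasDerivAt (fun t => er x₀ (S t) (ctr x₀)) (er x₀ P (ctr x₀)) 0 :=
  (ht.eventually_hasDerivAt_endo hI h0 hc x₀).self_of_nhds

end TimeDerivatives

/-! ### The linearised equation `δβ = 0`. -/

section FirstOrder

variable {E : Type*} [NormedAddCommGroup E] [NormedSpace ℝ E]
  {L : Type*} [TopologicalSpace L] [ChartedSpace E L] [IsManifold 𝓘(ℝ, E) ∞ L]

theorem smoothForm_add {α β : Form1 E L} (hα : SmoothForm α) (hβ : SmoothForm β) :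
    SmoothForm (α + β) :=
  smoothForm_iff.2 fun x => (hα.covSmoothAt x).add (hβ.covSmoothAt x)

/-- The exterior derivative of a 1-form in the chart at `x₀`, at the centre. -/
def dForm (x₀ : L) (α : Form1 E L) (v w : E) : ℝ :=
  fderiv ℝ (fr x₀ α) (ctr x₀) v w - fderiv ℝ (fr x₀ α) (ctr x₀) w v

/-- Extend `v`, `w` to fields tangent to the kernel: in `dη(V, W) = V η(W) - W η(V) - η([V, W])` the
first two terms vanish identically and the third by involutivity. -/
theorem dForm_eq_zero_of_ker (G : LeviFlatStructure E L) {η : Form1 E L} (hη : SmoothForm η)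
    (hker : ∀ x v, v ∈ G.ξ x ↔ η x v = 0) (x₀ : L) {v w : E}
    (hv : fr x₀ η (ctr x₀) v = 0) (hw : fr x₀ η (ctr x₀) w = 0) : dForm x₀ η v w = 0 := by
  rw [fr_ctr] at hv hw
  obtain ⟨V, hV, hVt, hVv⟩ := G.smooth_ξ x₀ v ((hker x₀ v).2 hv)
  obtain ⟨W, hW, hWt, hWw⟩ := G.smooth_ξ x₀ w ((hker x₀ w).2 hw)
  have h1 := extD_eq hη hV hW x₀
  have h2 : ev η V = 0 := funext fun x => (hker x _).1 (hVt x)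
  have h3 : ev η W = 0 := funext fun x => (hker x _).1 (hWt x)
  have h4 : ev η (br V W) x₀ = 0 := (hker x₀ _).1 (G.involutive V W hV hW hVt hWt x₀)
  have h5 : ∀ U : VField E L, der U (0 : L → ℝ) x₀ = 0 := by
    intro U
    rw [der_eq (f := (0 : L → ℝ)) mdifferentiableAt_const]
    simp
  rw [extD, h2, h3, h4, h5, h5, vr_ctr, vr_ctr, hVv, hWw] at h1
  simpa [dForm] using h1.symm

/-- Project `v` and `w` to the kernel along `ν` and expand; the term in `dη(ν, ν)` drops out. The
gain is an identity for arbitrary fixed vectors, which can be differentiated in `t` although the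
kernel moves. -/
theorem dForm_transverse (G : LeviFlatStructure E L) {η : Form1 E L} (hη : SmoothForm η)
    (hker : ∀ x v, v ∈ G.ξ x ↔ η x v = 0) (x₀ : L) {ν : E} (hν : fr x₀ η (ctr x₀) ν = 1)
    (v w : E) : dForm x₀ η v w - fr x₀ η (ctr x₀) v * dForm x₀ η ν w
      - fr x₀ η (ctr x₀) w * dForm x₀ η v ν = 0 := by
  have h := dForm_eq_zero_of_ker G hη hker x₀ (v := v - fr x₀ η (ctr x₀) v • ν)
    (w := w - fr x₀ η (ctr x₀) w • ν) (by simp [hν]) (by simp [hν])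
  simp only [dForm, map_sub, map_smul, sub_apply,
    smul_apply, smul_eq_mul] at h ⊢
  linarith

/-- Differentiate `dForm_transverse` for `γ + α_t` with `ν = X`. The result is `δβ = 0` once `dη(X,
·)` is recognised as `𝓛_X η` for `η = γ` and `η = β`, both constant on `X`. -/
theorem delta_eq_zero_of_deformation {F : LeviFlatStructure E L}
    {γ : Form1 E L} {X : VField E L} (hγX : IsDefiningCouple F.ξ γ X)
    {I : Set ℝ} (hI : IsOpen I) (h0 : (0 : ℝ) ∈ I) {D : ℝ → LeviFlatStructure E L}
    {α : ℝ → Form1 E L} {S : ℝ → EndField E L} (hD : IsDeformationGivenBy F γ X I D α S)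
    {β : Form1 E L} {P : EndField E L} (hβ : IsZ1 X β) (hαS : HasTangent α S β P)
    {V W : VField E L} (hV : SmoothVF V) (hW : SmoothVF W) (x₀ : L) :
    delta γ X β V W x₀ = 0 := by
  have hγ := hγX.smooth_γ
  set v := vr x₀ V (ctr x₀) with hv
  set w := vr x₀ W (ctr x₀) with hw
  set ν := vr x₀ X (ctr x₀) with hν
  have hγν : fr x₀ γ (ctr x₀) ν = 1 := by rw [hν, ← ev_eq_fr]; exact hγX.γ_X x₀
  have hβν : fr x₀ β (ctr x₀) ν = 0 := by rw [hν, ← ev_eq_fr]; exact hβ.ι_X x₀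
  have hsm : ∀ t ∈ I, SmoothForm (γ + α t) := fun t ht =>
    smoothForm_add hγ (hD.curve.smooth_α.smoothForm hI ht)
  have hfr : ∀ t, fr x₀ (γ + α t) = fun z => fr x₀ γ z + fr x₀ (α t) z := by
    intro t; funext z; ext u; simp [fr]
  have hdF : ∀ t ∈ I, fderiv ℝ (fr x₀ (γ + α t)) (ctr x₀)
      = fderiv ℝ (fr x₀ γ) (ctr x₀) + fderiv ℝ (fr x₀ (α t)) (ctr x₀) := by
    intro t ht
    rw [hfr, fderiv_fun_add (hγ.differentiableAt x₀)
      ((hD.curve.smooth_α.smoothForm hI ht).differentiableAt x₀)]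
  have hα0 : fr x₀ (α 0) = 0 := by
    funext z; ext u; simp [fr, hD.curve.α_zero]
  -- Since `α_t(X) = 0`, the vector `X` is normalised for every `γ + α_t`, so one `ν` serves all
  -- times.
  have hev : ∀ᶠ t in 𝓝 (0 : ℝ),
      dForm x₀ γ v w + dForm x₀ (α t) v w
        - (fr x₀ γ (ctr x₀) v + fr x₀ (α t) (ctr x₀) v) * (dForm x₀ γ ν w + dForm x₀ (α t) ν w)
        - (fr x₀ γ (ctr x₀) w + fr x₀ (α t) (ctr x₀) w) * (dForm x₀ γ v ν + dForm x₀ (α t) v ν)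
        = 0 := by
    filter_upwards [hI.mem_nhds h0] with t ht
    have h1 : fr x₀ (γ + α t) (ctr x₀) ν = 1 := by
      rw [hν, ← ev_eq_fr]
      simp [ev, hγX.γ_X, hD.curve.ι_X t ht]
    have h2 := dForm_transverse (D t) (hsm t ht) (hD.mem_iff t ht) x₀ h1 v w
    have h3 : ∀ a b, dForm x₀ (γ + α t) a b = dForm x₀ γ a b + dForm x₀ (α t) a b := by
      intro a b
      simp only [dForm, hdF t ht, add_apply]
      ring
    simp only [h3] at h2
    simpa only [hfr, add_apply] using h2
  have hd : ∀ a b, HasDerivAt (fun t => dForm x₀ (α t) a b) (dForm x₀ β a b) 0 := by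
    intro a b
    have h1 := hαS.hasDerivAt_fderiv_form hI h0 hD.curve x₀
    have h2 : ∀ a b : E, HasDerivAt (fun t => fderiv ℝ (fr x₀ (α t)) (ctr x₀) a b)
        (fderiv ℝ (fr x₀ β) (ctr x₀) a b) 0 := by
      intro a b
      simpa using (h1.clm_apply (hasDerivAt_const 0 a)).clm_apply (hasDerivAt_const 0 b)
    exact (h2 a b).sub (h2 b a)
  have hf : ∀ a, HasDerivAt (fun t => fr x₀ (α t) (ctr x₀) a) (fr x₀ β (ctr x₀) a) 0 := by
    intro a
    simpa using (hαS.hasDerivAt_form hI h0 hD.curve x₀).clm_apply (hasDerivAt_const 0 a)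
  have hder := ((((hd v w).const_add (dForm x₀ γ v w)).sub
    (((hf v).const_add (fr x₀ γ (ctr x₀) v)).mul ((hd ν w).const_add (dForm x₀ γ ν w)))).sub
    (((hf w).const_add (fr x₀ γ (ctr x₀) w)).mul ((hd v ν).const_add (dForm x₀ γ v ν))))
  have hz := hder.unique ((hasDerivAt_const (0 : ℝ) (0 : ℝ)).congr_of_eventuallyEq hev)
  have hd0 : ∀ a b, dForm x₀ (α 0) a b = 0 := by intro a b; simp [dForm, hα0]
  simp only [hd0, hα0, Pi.zero_apply, zero_apply, add_zero] at hz
  -- the Lie derivatives along `X`, in the chart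
  have hX := hγX.smooth_X
  have hlie : ∀ (η : Form1 E L), SmoothForm η → (∃ c : ℝ, ∀ x, η x (X x) = c) →
      ∀ U : VField E L, SmoothVF U → lieD X η U x₀ = dForm x₀ η ν (vr x₀ U (ctr x₀)) := by
    rintro η hη ⟨c, hc⟩ U hU
    have h1 : (fun z : E => ev η X (cs x₀ z)) = fun _ => c := funext fun z => hc _
    have h2 := fderiv_ev (hη.differentiableAt x₀) (hX.differentiableAt x₀) (vr x₀ U (ctr x₀))
    rw [h1] at h2
    simp only [fderiv_fun_const, Pi.zero_apply, zero_apply] at h2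
    rw [lieD_eq hη hU, dForm]
    linarith
  rw [delta, dglaBracket, extD_eq hβ.smooth hV hW, hlie γ hγ ⟨1, hγX.γ_X⟩ V hV,
    hlie γ hγ ⟨1, hγX.γ_X⟩ W hW, hlie β hβ.smooth ⟨0, hβ.ι_X⟩ V hV,
    hlie β hβ.smooth ⟨0, hβ.ι_X⟩ W hW, ev_eq_fr, ev_eq_fr, ev_eq_fr, ev_eq_fr]
  simp only [← hv, ← hw]
  have hanti : ∀ η : Form1 E L, ∀ a b, dForm x₀ η a b = - dForm x₀ η b a := by
    intro η a b; simp [dForm]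
  have e1 := hanti γ v ν
  have e2 := hanti β v ν
  change dForm x₀ β v w + _ = 0
  rw [e1, e2] at hz
  linarith

end FirstOrder

/-! ### Bracket rules and existence of enough smooth fields. -/

section Closure

variable {E : Type*} [NormedAddCommGroup E] [NormedSpace ℝ E]
  {L : Type*} [TopologicalSpace L] [ChartedSpace E L] [IsManifold 𝓘(ℝ, E) ∞ L]

theorem SmoothVF.smul {f : L → ℝ} {V : VField E L} (hf : ContMDiff 𝓘(ℝ, E) 𝓘(ℝ, ℝ) ∞ f)
    (hV : SmoothVF V) : SmoothVF (f • V) := ContMDiff.smul_section hf hV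

theorem SmoothVF.mdifferentiableAt {V : VField E L} (hV : SmoothVF V) (x : L) :
    MDifferentiableAt 𝓘(ℝ, E) (𝓘(ℝ, E).prod 𝓘(ℝ, E))
      (fun x => (Bundle.TotalSpace.mk' E x (V x) : TangentBundle 𝓘(ℝ, E) L)) x :=
  (hV x).mdifferentiableAt (by simp)

theorem br_swap (V W : VField E L) (x : L) : br V W x = -br W V x :=
  VectorField.mlieBracket_swap_apply

theorem br_sub_left [CompleteSpace E] {V V' : VField E L} (hV : SmoothVF V) (hV' : SmoothVF V')
    (W : VField E L) (x : L) : br (V - V') W x = br V W x - br V' W x := by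
  have h1 : br (V + (-1 : ℝ) • V') W x = br V W x + br ((-1 : ℝ) • V') W x :=
    VectorField.mlieBracket_add_left (hV.mdifferentiableAt x)
      (hV'.mdifferentiableAt x).smul_const_section
  have h2 : br ((-1 : ℝ) • V') W x = (-1 : ℝ) • br V' W x :=
    VectorField.mlieBracket_const_smul_left (hV'.mdifferentiableAt x)
  have h3 : V - V' = V + (-1 : ℝ) • V' := by module
  rw [h3, h1, h2]
  module

theorem br_neg_left [CompleteSpace E] {V : VField E L} (hV : SmoothVF V) (W : VField E L) (x : L) :
    br (-V) W x = -br V W x := by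
  have h2 : br ((-1 : ℝ) • V) W x = (-1 : ℝ) • br V W x :=
    VectorField.mlieBracket_const_smul_left (hV.mdifferentiableAt x)
  have h3 : -V = (-1 : ℝ) • V := by module
  rw [h3, h2]
  module

theorem br_neg_right [CompleteSpace E] {W : VField E L} (V : VField E L) (hW : SmoothVF W)
    (x : L) : br V (-W) x = -br V W x := by
  rw [br_swap, br_neg_left hW, neg_neg, br_swap V W, neg_neg]

theorem br_smul_left [CompleteSpace E] {f : L → ℝ} {V : VField E L}
    (hf : ContMDiff 𝓘(ℝ, E) 𝓘(ℝ, ℝ) ∞ f) (hV : SmoothVF V) (W : VField E L) (x : L) :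
    br (f • V) W x = -der W f x • V x + f x • br V W x :=
  VectorField.mlieBracket_smul_left (hf.mdifferentiableAt (by simp)) (hV.mdifferentiableAt x)

theorem smoothEnd_omega {X : VField E L} {α : Form1 E L} (hX : SmoothVF X) (hα : SmoothForm α) :
    SmoothEnd (omega X α) :=
  smoothEnd_iff.2 fun x => (HomSmoothAt.id continuousAt_id).sub
    (HomSmoothAt.smulRight (hα.covSmoothAt x) (hX.vecSmoothAt x))

theorem smoothEnd_onePlus {S : EndField E L} (hS : SmoothEnd S) : SmoothEnd (onePlus S) :=
  smoothEnd_iff.2 fun x => (HomSmoothAt.id continuousAt_id).add (hS.homSmoothAt x)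

/-- Every vector of the model space is the value, in the trivialization at `x₀`, of a smooth
vector field which is constant near `x₀`. -/
theorem exists_smoothVF_eventually_tr [FiniteDimensional ℝ E] [T2Space L] (x₀ : L) (e : E) :
    ∃ V : VField E L, SmoothVF V ∧ ∀ᶠ x in 𝓝 x₀, tr x₀ x (V x) = e := by
  obtain ⟨f⟩ : Nonempty (SmoothBumpFunction 𝓘(ℝ, E) x₀) := inferInstance
  refine ⟨fun x => f x • trs x₀ x e, ?_, ?_⟩
  · have h1 : ContMDiffOn 𝓘(ℝ, E) (𝓘(ℝ, E).prod 𝓘(ℝ, E)) ∞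
        (fun x => (Bundle.TotalSpace.mk' E x (trs x₀ x e) : TangentBundle 𝓘(ℝ, E) L))
        (chartAt E x₀).source := by
      have h2 := (Bundle.Trivialization.contMDiffOn_section_baseSet_iff (IB := 𝓘(ℝ, E)) (n := ∞)
        (s := fun x => trs x₀ x e) (trivializationAt E (TangentSpace 𝓘(ℝ, E)) x₀)).2
      refine h2 ?_
      refine (contMDiffOn_const (c := e)).congr fun x hx => ?_
      have h3 := (trivializationAt E (TangentSpace 𝓘(ℝ, E)) x₀).continuousLinearMapAt_apply_of_mem
        (R := ℝ) hx (trs x₀ x e)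
      exact h3.symm.trans (tr_trs hx e)
    exact ContMDiffOn.smul_section_of_tsupport (f.contMDiff.contMDiffOn)
      (chartAt E x₀).open_source f.tsupport_subset_chartAt_source h1
  · filter_upwards [f.eventuallyEq_one, (chartAt E x₀).open_source.mem_nhds
      (mem_chart_source E x₀)] with x hx hx'
    rw [map_smul, tr_trs hx', hx]
    simp

theorem exists_smoothVF_eq [FiniteDimensional ℝ E] [T2Space L] (x : L)
    (v : TangentSpace 𝓘(ℝ, E) x) : ∃ V : VField E L, SmoothVF V ∧ V x = v := by
  obtain ⟨V, hV, h⟩ := exists_smoothVF_eventually_tr (E := E) x v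
  refine ⟨V, hV, ?_⟩
  have := h.self_of_nhds
  rwa [tr_self] at this

/-- A field of endomorphisms mapping smooth fields to smooth fields is smooth. -/
theorem smoothEnd_of_app [FiniteDimensional ℝ E] [T2Space L] {S : EndField E L}
    (h : ∀ V : VField E L, SmoothVF V → SmoothVF (app S V)) : SmoothEnd S := by
  refine smoothEnd_iff.2 fun x₀ => ?_
  -- With fields `V_i` equal to the constant `b i` near `x₀`, the matrix of `S` there is the sum of
  -- the `b.coord i ⊗ S V_i`, and every `S V_i` is smooth.
  let b := Module.finBasis ℝ E
  choose V hV hVe using fun i => exists_smoothVF_eventually_tr (L := L) x₀ (b i)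
  let c : Fin (Module.finrank ℝ E) → E →L[ℝ] ℝ :=
    fun i => LinearMap.toContinuousLinearMap (b.coord i)
  have h1 : ContMDiffAt 𝓘(ℝ, E) 𝓘(ℝ, E →L[ℝ] E) ∞
      (fun x => ∑ i, ContinuousLinearMap.smulRightL ℝ E E (c i) (tr x₀ x (app S (V i) x))) x₀ := by
    refine ContMDiffAt.sum fun i _ => ?_
    exact (contMDiffAt_const (c := ContinuousLinearMap.smulRightL ℝ E E (c i))).clm_apply
      ((h _ (hV i)).vecSmoothAt x₀)
  refine h1.congr_of_eventuallyEq ?_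
  have h2 : ∀ᶠ x in 𝓝 x₀, ∀ i, tr x₀ x (V i x) = b i := eventually_all.2 hVe
  filter_upwards [h2, (chartAt E x₀).open_source.mem_nhds (mem_chart_source E x₀)] with x hx hxs
  ext e
  have h3 : ∀ i, V i x = trs x₀ x (b i) := fun i => by rw [← hx i, trs_tr hxs]
  have h4 : tr x₀ x (S x (trs x₀ x e))
      = ∑ i, b.repr e i • tr x₀ x (S x (trs x₀ x (b i))) := by
    rw [← congrArg (fun e' => tr x₀ x (S x (trs x₀ x e'))) (b.sum_repr e)]
    simp only [map_sum, map_smul]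
  simpa [app, h3, c] using h4

end Closure

/-! ### Extension of `J` to the whole tangent bundle, and `J_{α,S}` without inverses. -/

section ExtendedJ

variable {E : Type*} [NormedAddCommGroup E] [NormedSpace ℝ E]
  {L : Type*} [TopologicalSpace L] [ChartedSpace E L] [IsManifold 𝓘(ℝ, E) ∞ L]

/-- The extension of `J` by zero on `X`. -/
def extJ (F : LeviFlatStructure E L) (γ : Form1 E L) (X : VField E L) : EndField E L :=
  fun x => (F.J x) ∘L (omega X γ x)

variable {F : LeviFlatStructure E L} {γ : Form1 E L} {X : VField E L}
  (h : IsDefiningCouple F.ξ γ X)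

theorem omega_apply (α : Form1 E L) (x : L) (v : TangentSpace 𝓘(ℝ, E) x) :
    omega X α x v = v - α x v • X x := rfl

theorem omegaInv_apply (α : Form1 E L) (x : L) (v : TangentSpace 𝓘(ℝ, E) x) :
    omegaInv X α x v = v + α x v • X x := rfl

theorem onePlus_apply (S : EndField E L) (x : L) (v : TangentSpace 𝓘(ℝ, E) x) :
    onePlus S x v = v + S x v := rfl

include h

theorem IsDefiningCouple.omega_mem (x : L) (v : TangentSpace 𝓘(ℝ, E) x) :
    omega X γ x v ∈ F.ξ x := by
  rw [h.ker_γ, omega_apply, map_sub, map_smul, h.γ_X]; simp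

theorem IsDefiningCouple.omega_of_mem {x : L} {v : TangentSpace 𝓘(ℝ, E) x} (hv : v ∈ F.ξ x) :
    omega X γ x v = v := by
  rw [omega_apply, (h.ker_γ x v).1 hv]; simp

theorem IsDefiningCouple.omega_X (x : L) : omega X γ x (X x) = 0 := by
  rw [omega_apply, h.γ_X]; simp

theorem IsDefiningCouple.extJ_of_mem {x : L} {v : TangentSpace 𝓘(ℝ, E) x} (hv : v ∈ F.ξ x) :
    extJ F γ X x v = F.J x v := by
  rw [extJ, ContinuousLinearMap.comp_apply, h.omega_of_mem hv]

theorem IsDefiningCouple.extJ_mem (x : L) (v : TangentSpace 𝓘(ℝ, E) x) :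
    extJ F γ X x v ∈ F.ξ x := F.J_mem x _ (h.omega_mem x v)

theorem IsDefiningCouple.extJ_X (x : L) : extJ F γ X x (X x) = 0 := by
  rw [extJ, ContinuousLinearMap.comp_apply, h.omega_X, map_zero]

/-- `F.J` is arbitrary off `ξ` and so need not be smooth as a field on `TL`. After projection to
`ξ`, smoothness on test fields is exactly `smooth_J`. -/
theorem IsDefiningCouple.smoothEnd_extJ [FiniteDimensional ℝ E] [T2Space L] :
    SmoothEnd (extJ F γ X) := by
  refine smoothEnd_of_app fun V hV => ?_
  exact F.smooth_J _ ((smoothEnd_omega h.smooth_X h.smooth_γ).app hV) fun x => h.omega_mem x _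

theorem IsAntilinear.apply_mem {S : EndField E L} (hS : IsAntilinear F X S) (x : L)
    (v : TangentSpace 𝓘(ℝ, E) x) : S x v ∈ F.ξ x := by
  have h1 : S x v = S x (omega X γ x v) := by
    rw [omega_apply, map_sub, map_smul, hS.apply_X]; simp
  rw [h1]
  exact hS.mem x _ (h.omega_mem x v)

-- The intertwining `J_{α,S} ω_α (I + S) = ω_α (I + S) J`. It rests on `omegaInv` being inverse to
-- `omega`, which holds because `α(X) = 0`.
omit h in
theorem pairJ_apply {α : Form1 E L} {S : EndField E L} (hα : ∀ x, α x (X x) = 0) {x : L}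
    (hinv : (onePlus S x).IsInvertible)
    (v : TangentSpace 𝓘(ℝ, E) x) :
    pairJ F.J X α S x (omega X α x (onePlus S x v)) = omega X α x (onePlus S x (F.J x v)) := by
  have h1 : ∀ u, omegaInv X α x (omega X α x u) = u := by
    intro u
    rw [omegaInv_apply, omega_apply, map_sub, map_smul, hα]; simp
  obtain ⟨e, he⟩ := hinv
  simp only [pairJ, ContinuousLinearMap.comp_apply, h1]
  congr 3
  rw [← he, ContinuousLinearMap.inverse_equiv]
  exact e.symm_apply_apply v

/-- The relation between a vector of `ξ_α` and its image by `J_{α,S}`, without inverses. -/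
theorem pairJ_relation {α : Form1 E L} {S : EndField E L} (hα : ∀ x, α x (X x) = 0)
    (hS : IsAntilinear F X S) {x : L} (hinv : (onePlus S x).IsInvertible)
    {c : TangentSpace 𝓘(ℝ, E) x} (hc : (γ x + α x) c = 0) :
    omega X γ x c - S x (omega X γ x c) + extJ F γ X x (pairJ F.J X α S x c)
      + S x (extJ F γ X x (pairJ F.J X α S x c)) = 0 := by
  obtain ⟨e, he⟩ := id hinv
  have hαc : α x c = -γ x c := by
    have : γ x c + α x c = 0 := hc
    linarith
  set u := e.symm (omega X γ x c) with hu
  have hu1 : onePlus S x u = omega X γ x c := by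
    rw [← he]; exact e.apply_symm_apply _
  have hc1 : omega X α x (onePlus S x u) = c := by
    rw [hu1, omega_apply, omega_apply, map_sub, map_smul, hα, hαc]; simp
  have huγ : u ∈ F.ξ x := by
    rw [h.ker_γ]
    have h1 := (h.ker_γ x _).1 (h.omega_mem x c)
    rw [← hu1, onePlus_apply, map_add, (h.ker_γ x _).1 (hS.apply_mem h x u)] at h1
    simpa using h1
  have hJ := pairJ_apply (F := F) hα hinv u
  rw [hc1] at hJ
  have h2 : onePlus S x (F.J x u) ∈ F.ξ x :=
    (F.ξ x).add_mem (F.J_mem x u huγ) (hS.apply_mem h x _)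
  have h3 : extJ F γ X x (pairJ F.J X α S x c) = F.J x (onePlus S x (F.J x u)) := by
    rw [hJ, omega_apply, map_sub, map_smul, h.extJ_X, h.extJ_of_mem h2]; simp
  -- On `ξ`, `J S J = S`, because `S` anticommutes with `J` and `J² = -1`.
  have h4 : F.J x (onePlus S x (F.J x u)) = S x u - u := by
    rw [onePlus_apply, map_add, F.J_sq x u huγ, hS.anticomm x u huγ, map_neg,
      F.J_sq x _ (hS.apply_mem h x u)]
    abel
  -- What remains is `(I - S)(I + S)u = (I + S)(I - S)u`.
  rw [h3, h4, ← hu1, onePlus_apply, map_add, map_sub]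
  abel

end ExtendedJ

/-! ### The first derivative of the vanishing of the Nijenhuis tensor. -/

section SecondEquation

variable {E : Type*} [NormedAddCommGroup E] [NormedSpace ℝ E]
  {L : Type*} [TopologicalSpace L] [ChartedSpace E L] [IsManifold 𝓘(ℝ, E) ∞ L]

/-- The 1-jet at `x₀` of the family `V` of vector fields has derivative at `t = 0` the 1-jet
of `V'`. -/
structure HasJetDeriv (x₀ : L) (V : ℝ → VField E L) (V' : VField E L) : Prop where
  value : HasDerivAt (fun t => vr x₀ (V t) (ctr x₀)) (vr x₀ V' (ctr x₀)) 0
  fderiv : HasDerivAt (fun t => fderiv ℝ (vr x₀ (V t)) (ctr x₀)) (fderiv ℝ (vr x₀ V') (ctr x₀)) 0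

/-- The bracket at `x₀` is a bilinear expression in the 1-jets of the two fields, so the product
rule applies. -/
theorem HasJetDeriv.br {x₀ : L} {V W : ℝ → VField E L} {V' W' : VField E L}
    (hV : HasJetDeriv x₀ V V') (hW : HasJetDeriv x₀ W W') :
    HasDerivAt (fun t => vr x₀ (br (V t) (W t)) (ctr x₀))
      (vr x₀ (br V' (W 0)) (ctr x₀) + vr x₀ (br (V 0) W') (ctr x₀)) 0 := by
  simp only [br_eq]
  convert (hW.fderiv.clm_apply hV.value).fun_sub (hV.fderiv.clm_apply hW.value) using 1
  abel

/-- The vector field `ω_α (I + S) V`. -/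
def twist (X : VField E L) (α : Form1 E L) (S : EndField E L) (V : VField E L) : VField E L :=
  app (omega X α) (app (onePlus S) V)

/-- The derivative `P V - β(V) X` of `ω_α (I + S) V`. -/
def twistDeriv (X : VField E L) (β : Form1 E L) (P : EndField E L) (V : VField E L) :
    VField E L := app P V - ev β V • X

variable {F : LeviFlatStructure E L} {γ : Form1 E L} {X : VField E L} {I : Set ℝ}
  {α : ℝ → Form1 E L} {S : ℝ → EndField E L} {β : Form1 E L} {P : EndField E L}

theorem vr_twist {x₀ : L} {z : E} (hz : z ∈ (extChartAt 𝓘(ℝ, E) x₀).target)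
    (α : Form1 E L) (S : EndField E L) (V : VField E L) :
    vr x₀ (twist X α S V) z = vr x₀ V z + er x₀ S z (vr x₀ V z)
      - fr x₀ α z (vr x₀ V z + er x₀ S z (vr x₀ V z)) • vr x₀ X z := by
  simp [twist, vr, er, fr, app, omega_apply, onePlus_apply, trs_tr (cs_mem hz)]

theorem vr_twistDeriv {x₀ : L} {z : E} (hz : z ∈ (extChartAt 𝓘(ℝ, E) x₀).target)
    (β : Form1 E L) (P : EndField E L) (V : VField E L) :
    vr x₀ (twistDeriv X β P V) z = er x₀ P z (vr x₀ V z)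
      - fr x₀ β z (vr x₀ V z) • vr x₀ X z := by
  simp [twistDeriv, vr, er, fr, app, ev, trs_tr (cs_mem hz)]

theorem IsPairCurve.twist_zero (hc : IsPairCurve F X I α S) (V : VField E L) :
    twist X (α 0) (S 0) V = V := by
  funext x
  simp [twist, app, omega_apply, onePlus_apply, hc.α_zero, hc.S_zero]

/-- The `t`-derivative is computed at all points near the centre; the interchange of derivatives
then gives the first-order part of the jet. The quadratic term `α_t(S_t V)` contributes nothing at
`t = 0`. -/
theorem hasJetDeriv_twist (hX : SmoothVF X) (hI : IsOpen I) (h0 : (0 : ℝ) ∈ I)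
    (hc : IsPairCurve F X I α S) (ht : HasTangent α S β P) {V : VField E L} (hV : SmoothVF V)
    (x₀ : L) : HasJetDeriv x₀ (fun t => twist X (α t) (S t) V) (twistDeriv X β P V) := by
  have hev : ∀ᶠ z in 𝓝 (ctr (E := E) x₀),
      HasDerivAt (fun t => vr x₀ (twist X (α t) (S t) V) z) (vr x₀ (twistDeriv X β P V) z) 0 := by
    filter_upwards [ht.eventually_hasDerivAt_form hI h0 hc x₀,
      ht.eventually_hasDerivAt_endo hI h0 hc x₀, target_mem_nhds x₀] with z h1 h2 hz
    simp only [vr_twist hz, vr_twistDeriv hz]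
    have h3 : HasDerivAt (fun t => er x₀ (S t) z (vr x₀ V z)) (er x₀ P z (vr x₀ V z)) 0 := by
      simpa using h2.clm_apply (hasDerivAt_const 0 (vr x₀ V z))
    have h4 := h3.const_add (vr x₀ V z)
    have h5 := h4.fun_sub ((h1.clm_apply h4).smul_const (vr x₀ X z))
    have h6 : fr x₀ (α 0) z = 0 := by ext; simp [fr, hc.α_zero]
    have h7 : er x₀ (S 0) z = 0 := by ext; simp [er, hc.S_zero]
    simpa only [h6, h7, map_add, zero_apply, add_zero, zero_add, map_zero] using h5
  have hsm : ContDiffAt ℝ 2 (fun p : ℝ × E => vr x₀ (twist X (α p.1) (S p.1) V) p.2)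
      (0, ctr x₀) := by
    have hv : ContDiffAt ℝ 2 (fun p : ℝ × E => vr x₀ V p.2) ((0 : ℝ), ctr x₀) :=
      ((hV.vecSmoothAt x₀).contDiffAt.of_le two_le_infty).comp ((0 : ℝ), ctr (E := E) x₀)
        contDiffAt_snd
    have hx : ContDiffAt ℝ 2 (fun p : ℝ × E => vr x₀ X p.2) ((0 : ℝ), ctr x₀) :=
      ((hX.vecSmoothAt x₀).contDiffAt.of_le two_le_infty).comp ((0 : ℝ), ctr (E := E) x₀)
        contDiffAt_snd
    have ha := (hc.contDiffAt_form hI h0 x₀).of_le two_le_infty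
    have hs := (hc.contDiffAt_endo hI h0 x₀).of_le two_le_infty
    have h1 := hv.add (hs.clm_apply hv)
    refine (h1.sub ((ha.clm_apply h1).smul hx)).congr_of_eventuallyEq ?_
    have hc2 : Continuous fun p : ℝ × E => p.2 := by fun_prop
    filter_upwards [hc2.continuousAt.eventually (target_mem_nhds (E := E) x₀)] with p hp
    exact vr_twist hp _ _ _
  exact ⟨hev.self_of_nhds, hasDerivAt_fderiv_of_contDiffAt
    (f := fun p : ℝ × E => vr x₀ (twist X (α p.1) (S p.1) V) p.2) hsm hev⟩

/-- Because `s 0 = 0`, in each product `s(a)` only `s'` applied to the value at `0` survives. This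
is used for both the Nijenhuis equation and the gauge relation. -/
theorem deriv_of_relation {G : Type*} [NormedAddCommGroup G] [NormedSpace ℝ G]
    {s : ℝ → G →L[ℝ] G} {s' : G →L[ℝ] G} {a b : ℝ → G} {a' b' : G} (hs0 : s 0 = 0)
    (hs : HasDerivAt s s' 0) (ha : HasDerivAt a a' 0) (hb : HasDerivAt b b' 0)
    (hrel : ∀ᶠ t in 𝓝 0, a t - s t (a t) + b t + s t (b t) = 0) :
    a' - s' (a 0) + b' + s' (b 0) = 0 := by
  have h1 := ((ha.fun_sub (hs.clm_apply ha)).fun_add hb).fun_add (hs.clm_apply hb)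
  have h2 := h1.unique ((hasDerivAt_const (0 : ℝ) (0 : G)).congr_of_eventuallyEq hrel)
  simpa only [hs0, zero_apply, add_zero] using h2

/-- The derivative at the origin of the equation `N_{J_t} = 0`. -/
theorem nijenhuis_deriv [FiniteDimensional ℝ E] [T2Space L]
    (hγX : IsDefiningCouple F.ξ γ X) (hI : IsOpen I) (h0 : (0 : ℝ) ∈ I)
    {D : ℝ → LeviFlatStructure E L} (hD : IsDeformationGivenBy F γ X I D α S)
    (hαS : HasTangent α S β P)
    {V W : VField E L} (hV : SmoothVF V) (hW : SmoothVF W) (hVt : TangentTo F.ξ V)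
    (hWt : TangentTo F.ξ W) (x₀ : L) :
    omega X γ x₀ (br (twistDeriv X β P (app F.J V)) W x₀
        + br (app F.J V) (twistDeriv X β P W) x₀
        + (br (twistDeriv X β P V) (app F.J W) x₀
        + br V (twistDeriv X β P (app F.J W)) x₀))
      - P x₀ (omega X γ x₀ (br (app F.J V) W x₀ + br V (app F.J W) x₀))
      + extJ F γ X x₀ (br (twistDeriv X β P (app F.J V)) (app F.J W) x₀
        + br (app F.J V) (twistDeriv X β P (app F.J W)) x₀
        - (br (twistDeriv X β P V) W x₀ + br V (twistDeriv X β P W) x₀))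
      + P x₀ (extJ F γ X x₀ (br (app F.J V) (app F.J W) x₀ - br V W x₀)) = 0 := by
  have hJV := F.smooth_J V hV hVt
  have hJW := F.smooth_J W hW hWt
  have hX := hγX.smooth_X
  have hc := hD.curve
  let T : ℝ → VField E L → VField E L := fun t U => twist X (α t) (S t) U
  -- Since `J_t T_t U = T_t (J U)`, the equation `N_{J_t}(T_t V, T_t W) = 0` reads `B_t = J_t C_t`.
  let C : ℝ → VField E L := fun t => br (T t (app F.J V)) (T t W) + br (T t V) (T t (app F.J W))
  let B : ℝ → VField E L := fun t => br (T t (app F.J V)) (T t (app F.J W)) - br (T t V) (T t W)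
  have hTs : ∀ t ∈ I, ∀ U, SmoothVF U → SmoothVF (T t U) := fun t ht U hU =>
    (smoothEnd_omega hX (hc.smooth_α.smoothForm hI ht)).app
      ((smoothEnd_onePlus (hc.smooth_S.smoothEnd hI ht)).app hU)
  have hTt : ∀ t ∈ I, ∀ U, TangentTo F.ξ U → TangentTo (D t).ξ (T t U) := by
    intro t ht U hU x
    rw [hD.mem_iff t ht]
    have h1 : γ x (onePlus (S t) x (U x)) = 0 := (hγX.ker_γ x _).1
      ((F.ξ x).add_mem (hU x) ((hc.antilinear t ht).mem x _ (hU x)))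
    change γ x (omega X (α t) x (onePlus (S t) x (U x)))
      + α t x (omega X (α t) x (onePlus (S t) x (U x))) = 0
    rw [omega_apply, map_sub, map_sub, map_smul, map_smul, hγX.γ_X, hc.ι_X t ht, h1]
    simp
  have hJT : ∀ t ∈ I, ∀ U, TangentTo F.ξ U → app (D t).J (T t U) = T t (app F.J U) := by
    intro t ht U hU
    funext x
    change (D t).J x (T t U x) = _
    rw [hD.J_eq t ht x _ (hTt t ht U hU x)]
    exact pairJ_apply (hc.ι_X t ht) (hD.invertible t ht x) (U x)
  -- `pairJ_relation` removes `J_t`; among the operators that remain only `S_t` depends on `t`.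
  have hrel : ∀ t ∈ I, omega X γ x₀ (C t x₀) - S t x₀ (omega X γ x₀ (C t x₀))
      + extJ F γ X x₀ (B t x₀) + S t x₀ (extJ F γ X x₀ (B t x₀)) = 0 := by
    intro t ht
    have hCm : C t x₀ ∈ (D t).ξ x₀ := by
      refine ((D t).ξ x₀).add_mem ?_ ?_
      · exact (D t).involutive _ _ (hTs t ht _ hJV) (hTs t ht _ hW)
          (hTt t ht _ fun x => F.J_mem x _ (hVt x)) (hTt t ht _ hWt) x₀
      · exact (D t).involutive _ _ (hTs t ht _ hV) (hTs t ht _ hJW)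
          (hTt t ht _ hVt) (hTt t ht _ fun x => F.J_mem x _ (hWt x)) x₀
    have hN := (D t).integrable_J _ _ (hTs t ht V hV) (hTs t ht W hW) (hTt t ht V hVt)
      (hTt t ht W hWt) x₀
    rw [nijenhuis, hJT t ht V hVt, hJT t ht W hWt] at hN
    have hBC : B t x₀ = pairJ F.J X (α t) (S t) x₀ (C t x₀) := by
      rw [← hD.J_eq t ht x₀ _ hCm]
      change br (T t (app F.J V)) (T t (app F.J W)) x₀ - br (T t V) (T t W) x₀
        = (D t).J x₀ (br (T t (app F.J V)) (T t W) x₀ + br (T t V) (T t (app F.J W)) x₀)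
      rw [map_add, ← sub_eq_zero, ← hN]
      abel
    rw [hBC]
    exact pairJ_relation hγX (hc.ι_X t ht) (hc.antilinear t ht) (hD.invertible t ht x₀)
      ((hD.mem_iff t ht x₀ _).1 hCm)
  -- differentiate in the chart
  have hj : ∀ U, SmoothVF U → HasJetDeriv x₀ (fun t => T t U) (twistDeriv X β P U) :=
    fun U hU => hasJetDeriv_twist hX hI h0 hc hαS hU x₀
  have hT0 : ∀ U, T 0 U = U := fun U => hc.twist_zero U
  have hCd := ((hj _ hJV).br (hj _ hW)).fun_add ((hj _ hV).br (hj _ hJW))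
  have hBd := ((hj _ hJV).br (hj _ hJW)).fun_sub ((hj _ hV).br (hj _ hW))
  have hS0 : er x₀ (S 0) (ctr x₀) = 0 := by ext; simp [er, hc.S_zero]
  have hpC := (er x₀ (omega X γ) (ctr x₀)).hasFDerivAt.comp_hasDerivAt (0 : ℝ) hCd
  have hjB := (er x₀ (extJ F γ X) (ctr x₀)).hasFDerivAt.comp_hasDerivAt (0 : ℝ) hBd
  have hz := deriv_of_relation hS0 (hαS.hasDerivAt_endo hI h0 hc x₀) hpC hjB (by
    filter_upwards [hI.mem_nhds h0] with t ht
    have := hrel t ht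
    simp only [Function.comp_apply, er_ctr_eq, vr_ctr]
    exact this)
  simp only [Function.comp_apply, hT0, er_ctr_eq, vr_ctr] at hz
  exact hz

end SecondEquation

/-! ### The linearised equation for `∂̄P`. -/

section DbarEquation

/-- The `a`'s are the brackets of `V`, `JV` with `PW`, `JPW`, and the `b`'s those of `W`, `JW` with
`PV`, `JPV`; the scalars are the values of `β` on `V`, `JV`, `W`, `JW`. A quarter of `j` applied to
the differentiated relation gives the formula, corrected by a quarter of the integrability of `J` on
`(V, PW)` and on `(W, PV)`. -/
theorem dbar_algebra {G : Type*} [AddCommGroup G] [Module ℝ G] (j : G →ₗ[ℝ] G)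
    {a₁ a₂ a₃ a₄ b₁ b₂ b₃ b₄ tV tW tJV tJW p p' : G} {c c' d d' : ℝ}
    (hja : j (j a₁) = -a₁) (hja' : j (j a₃) = -a₃)
    (hjb : j (j b₁) = -b₁) (hjb' : j (j b₃) = -b₃)
    (hV : j (j tV) = -tV) (hW : j (j tW) = -tW) (hJV : j (j tJV) = -tJV) (hJW : j (j tJW) = -tJW)
    (hp : p' = -j p)
    (hN : a₃ - a₁ - j a₂ - j a₄ = 0) (hN' : b₃ - b₁ - j b₂ - j b₄ = 0)
    (hrel : (b₄ + c' • tW + (a₂ - d • tJV) + (-b₂ + c • tJW + (-a₄ - d' • tV))) - p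
      + j (b₃ + c' • tJW + (-a₃ - d' • tJV) - (-b₁ + c • tW + (a₁ - d • tV))) + -p = 0) :
    ((1 / 2 : ℝ) • (a₁ + j a₂) + (1 / 4 : ℝ) • (0 : G))
      - ((1 / 2 : ℝ) • (b₁ + j b₂) + (1 / 4 : ℝ) • (0 : G)) + (1 / 2 : ℝ) • p'
    = -((1 / 2 : ℝ) • (c • ((1 / 2 : ℝ) • (tW + j tJW)) + c' • j ((1 / 2 : ℝ) • (tW + j tJW)))
      - (1 / 2 : ℝ) • (d • ((1 / 2 : ℝ) • (tV + j tJV)) + d' • j ((1 / 2 : ℝ) • (tV + j tJV)))) := by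
  have h := congrArg j hrel
  simp only [map_add, map_sub, map_smul, map_neg, map_zero, hja, hja', hjb, hjb', hV, hW, hJV,
    hJW] at h ⊢
  rw [hp]
  linear_combination (norm := module) (1 / 4 : ℝ) • h - (1 / 4 : ℝ) • hN + (1 / 4 : ℝ) • hN'

variable {E : Type*} [NormedAddCommGroup E] [NormedSpace ℝ E]
  {L : Type*} [TopologicalSpace L] [ChartedSpace E L] [IsManifold 𝓘(ℝ, E) ∞ L]
variable {F : LeviFlatStructure E L} {γ : Form1 E L} {X : VField E L} {I : Set ℝ}
  {α : ℝ → Form1 E L} {S : ℝ → EndField E L} {β : Form1 E L} {P : EndField E L}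

theorem IsForm01.smoothVF_app (hP : IsForm01 F X P) {V : VField E L} (hV : SmoothVF V) :
    SmoothVF (app P V) := hP.smooth.app hV

theorem IsForm01.tangentTo_app (hP : IsForm01 F X P) {V : VField E L} (hV : TangentTo F.ξ V) :
    TangentTo F.ξ (app P V) := fun x => hP.antilinear.mem x _ (hV x)

theorem IsForm01.app_J (hP : IsForm01 F X P) {V : VField E L} (hV : TangentTo F.ξ V) :
    app P (app F.J V) = -app F.J (app P V) :=
  funext fun x => hP.antilinear.anticomm x _ (hV x)

/-- Expanding `[PU - β(U)X, W]`, the derivative of `β(U)` multiplies `X` and is killed by the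
projection; the rest of the `X` part is `β(U)` times the projection of `[W, X]`, the source of `H`
in the final equation. -/
theorem omega_br_twistDeriv [CompleteSpace E] (hγX : IsDefiningCouple F.ξ γ X) (hβ : IsZ1 X β)
    (hP : IsForm01 F X P) {U W : VField E L} (hU : SmoothVF U) (hW : SmoothVF W)
    (hUt : TangentTo F.ξ U) (hWt : TangentTo F.ξ W) (x : L) :
    omega X γ x (br (twistDeriv X β P U) W x)
      = br (app P U) W x + ev β U x • TForm γ X X W x := by
  have hX := hγX.smooth_X
  have hf := contMDiff_ev hβ.smooth hU
  rw [twistDeriv, br_sub_left (hP.smoothVF_app hU) (SmoothVF.smul hf hX), br_smul_left hf hX,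
    br_swap X W, map_sub, map_add, map_smul, map_smul, hγX.omega_X,
    hγX.omega_of_mem (F.involutive _ _ (hP.smoothVF_app hU) hW (hP.tangentTo_app hUt) hWt x),
    map_neg]
  change _ = _ + ev β U x • omega X γ x (br W X x)
  module

theorem omega_br_twistDeriv_right [CompleteSpace E] (hγX : IsDefiningCouple F.ξ γ X)
    (hβ : IsZ1 X β)
    (hP : IsForm01 F X P) {U W : VField E L} (hU : SmoothVF U) (hW : SmoothVF W)
    (hUt : TangentTo F.ξ U) (hWt : TangentTo F.ξ W) (x : L) :
    omega X γ x (br W (twistDeriv X β P U) x)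
      = br W (app P U) x - ev β U x • TForm γ X X W x := by
  rw [br_swap, map_neg, omega_br_twistDeriv hγX hβ hP hU hW hUt hWt, br_swap (app P U) W]
  module

theorem linearizedEq_of_deformation [FiniteDimensional ℝ E] [T2Space L]
    (hγX : IsDefiningCouple F.ξ γ X) (hI : IsOpen I) (h0 : (0 : ℝ) ∈ I)
    {D : ℝ → LeviFlatStructure E L} (hD : IsDeformationGivenBy F γ X I D α S)
    (hβ : IsZ1 X β) (hP : IsForm01 F X P) (hαS : HasTangent α S β P) :
    LinearizedEq F γ X β P := by
  have := FiniteDimensional.complete ℝ E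
  refine ⟨fun V W hV hW x => delta_eq_zero_of_deformation hγX hI h0 hD hβ hαS hV hW x,
    fun V W hV hW hVt hWt x => ?_⟩
  have hJV := F.smooth_J V hV hVt
  have hJW := F.smooth_J W hW hWt
  have hJVt : TangentTo F.ξ (app F.J V) := fun x => F.J_mem x _ (hVt x)
  have hJWt : TangentTo F.ξ (app F.J W) := fun x => F.J_mem x _ (hWt x)
  have hPV := hP.smoothVF_app hV
  have hPW := hP.smoothVF_app hW
  have hPVt := hP.tangentTo_app hVt
  have hPWt := hP.tangentTo_app hWt
  have hJPV := F.smooth_J _ hPV hPVt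
  have hJPW := F.smooth_J _ hPW hPWt
  have hJPVt : TangentTo F.ξ (app F.J (app P V)) := fun x => F.J_mem x _ (hPVt x)
  have hJPWt : TangentTo F.ξ (app F.J (app P W)) := fun x => F.J_mem x _ (hPWt x)
  have hrel := nijenhuis_deriv hγX hI h0 hD hαS hV hW hVt hWt x
  have hc0 : br (app F.J V) W x + br V (app F.J W) x ∈ F.ξ x :=
    (F.ξ x).add_mem (F.involutive _ _ hJV hW hJVt hWt x) (F.involutive _ _ hV hJW hVt hJWt x)
  -- Integrability at `t = 0`. It makes the two terms in the differentiated relation that contain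
  -- `P` outside the brackets equal, each being `-P c0`.
  have hb0 : br (app F.J V) (app F.J W) x - br V W x
      = F.J x (br (app F.J V) W x + br V (app F.J W) x) := by
    have h := F.integrable_J V W hV hW hVt hWt x
    rw [nijenhuis] at h
    rw [map_add, ← sub_eq_zero, ← h]
    abel
  set c0 := br (app F.J V) W x + br V (app F.J W) x with hc0def
  have hPb : P x (extJ F γ X x (br (app F.J V) (app F.J W) x - br V W x)) = -P x c0 := by
    rw [hb0, hγX.extJ_of_mem (F.J_mem x _ hc0), F.J_sq x _ hc0, map_neg]
  rw [hPb, hγX.omega_of_mem hc0] at hrel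
  have hext : ∀ v, extJ F γ X x v = F.J x (omega X γ x v) := fun v => rfl
  rw [hext] at hrel
  simp only [map_add (omega X γ x), map_sub (omega X γ x),
    omega_br_twistDeriv hγX hβ hP hJV hW hJVt hWt, omega_br_twistDeriv hγX hβ hP hV hJW hVt hJWt,
    omega_br_twistDeriv hγX hβ hP hJV hJW hJVt hJWt, omega_br_twistDeriv hγX hβ hP hV hW hVt hWt,
    omega_br_twistDeriv_right hγX hβ hP hW hJV hWt hJVt,
    omega_br_twistDeriv_right hγX hβ hP hJW hV hJWt hVt,
    omega_br_twistDeriv_right hγX hβ hP hJW hJV hJWt hJVt,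
    omega_br_twistDeriv_right hγX hβ hP hW hV hWt hVt, hP.app_J hVt, hP.app_J hWt,
    br_neg_left hJPV, br_neg_right _ hJPW] at hrel
  rw [← br_swap W (app F.J (app P V)), ← br_swap (app F.J W) (app F.J (app P V)),
    br_swap (app P V) (app F.J W), br_swap (app P V) W] at hrel
  have hN := F.integrable_J V (app P W) hV hPW hVt hPWt x
  have hN' := F.integrable_J W (app P V) hW hPV hWt hPVt x
  have hjj : ∀ {A B : VField E L}, SmoothVF A → SmoothVF B → TangentTo F.ξ A → TangentTo F.ξ B →
      F.J x (F.J x (br A B x)) = -br A B x := fun hA hB hAt hBt =>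
    F.J_sq x _ (F.involutive _ _ hA hB hAt hBt x)
  have hjT : ∀ A : VField E L, F.J x (F.J x (TForm γ X X A x)) = -TForm γ X X A x := fun A =>
    F.J_sq x _ (hγX.omega_mem x _)
  have hp : P x (br (app F.J V) (app F.J W) x - br V W x) = -F.J x (P x c0) := by
    rw [hb0, hP.antilinear.anticomm x _ hc0]
  have hfin := dbar_algebra (F.J x).toLinearMap (hjj hV hPW hVt hPWt)
    (hjj hJV hJPW hJVt hJPWt) (hjj hW hPV hWt hPVt) (hjj hJW hJPV hJWt hJPVt)
    (hjT V) (hjT W) (hjT (app F.J V)) (hjT (app F.J W)) hp hN hN' hrel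
  have hlhs : dbar F.J P V W x =
      ((1 / 2 : ℝ) • (br V (app P W) x + F.J x (br (app F.J V) (app P W) x))
      + (1 / 4 : ℝ) • (0 : TangentSpace 𝓘(ℝ, E) x))
      - ((1 / 2 : ℝ) • (br W (app P V) x + F.J x (br (app F.J W) (app P V) x))
      + (1 / 4 : ℝ) • (0 : TangentSpace 𝓘(ℝ, E) x))
      + (1 / 2 : ℝ) • P x (br (app F.J V) (app F.J W) x - br V W x) := by
    rw [dbar, dbarVF, dbarVF, hN, hN', ← neg_sub (br (app F.J V) (app F.J W) x), map_neg]
    module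
  rw [hlhs]
  exact hfin

end DbarEquation

/-! ### Velocities of families of maps and their expression in charts. -/

section Velocity

variable {E : Type*} [NormedAddCommGroup E] [NormedSpace ℝ E]
  {L : Type*} [TopologicalSpace L] [ChartedSpace E L] [IsManifold 𝓘(ℝ, E) ∞ L]

/-- `Y` is the velocity at time `0` of the family `Φ` of maps, expressed in the charts of `L`. -/
def HasVelocity (Φ : ℝ → L → L) (Y : VField E L) : Prop :=
  ∀ x₀ x : L, x ∈ (chartAt E x₀).source →
    HasDerivAt (fun t => extChartAt 𝓘(ℝ, E) x₀ (Φ t x)) (tr x₀ x (Y x)) 0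

/-- A family of maps in the chart at `x₀`. -/
def mr (x₀ : L) (Φ : ℝ → L → L) (t : ℝ) (z : E) : E := extChartAt 𝓘(ℝ, E) x₀ (Φ t (cs x₀ z))

theorem HasVelocity.hasDerivAt_mr {Φ : ℝ → L → L} {Y : VField E L} (h : HasVelocity Φ Y)
    {x₀ : L} {z : E} (hz : z ∈ (extChartAt 𝓘(ℝ, E) x₀).target) :
    HasDerivAt (fun t => mr x₀ Φ t z) (vr x₀ Y z) 0 := h x₀ _ (cs_mem hz)

theorem hasDerivAt_extChartAt {c : ℝ → L} {x₀ x : L} (hc : c 0 = x)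
    (hd : MDifferentiableAt 𝓘(ℝ, ℝ) 𝓘(ℝ, E) c 0) (hx : x ∈ (chartAt E x₀).source) :
    HasDerivAt (fun t => extChartAt 𝓘(ℝ, E) x₀ (c t))
      (tr x₀ x (mfderiv 𝓘(ℝ, ℝ) 𝓘(ℝ, E) c 0 (1 : ℝ) : E)) 0 := by
  subst hc
  have h1 : MDifferentiableAt 𝓘(ℝ, E) 𝓘(ℝ, E) (extChartAt 𝓘(ℝ, E) x₀) (c 0) :=
    mdifferentiableAt_extChartAt hx
  let T : ℝ →L[ℝ] E := (tr x₀ (c 0)) ∘L (mfderiv 𝓘(ℝ, ℝ) 𝓘(ℝ, E) c 0)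
  have h2 : HasMFDerivAt 𝓘(ℝ, ℝ) 𝓘(ℝ, E) (extChartAt 𝓘(ℝ, E) x₀ ∘ c) 0 T := by
    have h := h1.hasMFDerivAt.comp (0 : ℝ) hd.hasMFDerivAt
    rw [← tr_eq_mfderiv hx] at h
    exact h
  have h3 : HasFDerivAt (extChartAt 𝓘(ℝ, E) x₀ ∘ c) T 0 := hasMFDerivAt_iff_hasFDerivAt.1 h2
  exact h3.hasDerivAt

theorem contDiffAt_mr {Φ : ℝ → L → L} {t : ℝ} {x₀ : L}
    (hΦ : ContMDiffAt (𝓘(ℝ, ℝ).prod 𝓘(ℝ, E)) 𝓘(ℝ, E) ∞ (fun p : ℝ × L => Φ p.1 p.2) (t, x₀))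
    (ht : Φ t x₀ ∈ (chartAt E x₀).source) :
    ContDiffAt ℝ ∞ (fun p : ℝ × E => mr x₀ Φ p.1 p.2) (t, ctr x₀) := by
  have h1 := ContMDiffAt.comp_of_eq hΦ (contMDiffAt_prod_cs t x₀) (by simp [cs_ctr])
  have h2 : ContMDiffAt 𝓘(ℝ, E) 𝓘(ℝ, E) ∞ (extChartAt 𝓘(ℝ, E) x₀) (Φ t x₀) :=
    contMDiffAt_extChartAt' ht
  exact (ContMDiffAt.comp_of_eq h2 h1 (by simp [cs_ctr])).contDiffAt

theorem contMDiff_apply_family {Φ : ℝ → L → L} {t : ℝ} {x₀ : L}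
    (hΦ : ContMDiffAt (𝓘(ℝ, ℝ).prod 𝓘(ℝ, E)) 𝓘(ℝ, E) ∞ (fun p : ℝ × L => Φ p.1 p.2) (t, x₀)) :
    ContMDiffAt 𝓘(ℝ, ℝ) 𝓘(ℝ, E) ∞ (fun t => Φ t x₀) t :=
  ContMDiffAt.comp_of_eq hΦ (contMDiffAt_id.prodMk contMDiffAt_const) rfl

theorem mr_zero {Φ : ℝ → L → L} (h0 : ∀ x, Φ 0 x = x) {x₀ : L} {z : E}
    (hz : z ∈ (extChartAt 𝓘(ℝ, E) x₀).target) : mr x₀ Φ 0 z = z := by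
  rw [mr, h0]; exact (extChartAt 𝓘(ℝ, E) x₀).right_inv hz

theorem eventually_mem_source {Φ : ℝ → L → L} (h0 : ∀ x, Φ 0 x = x) {x₀ : L}
    (hΦ : ContMDiffAt (𝓘(ℝ, ℝ).prod 𝓘(ℝ, E)) 𝓘(ℝ, E) ∞ (fun p : ℝ × L => Φ p.1 p.2) (0, x₀)) :
    ∀ᶠ t in 𝓝 (0 : ℝ), Φ t x₀ ∈ (chartAt E x₀).source := by
  refine (contMDiff_apply_family hΦ).continuousAt.eventually ?_
  simp only [h0]
  exact (chartAt E x₀).open_source.mem_nhds (mem_chart_source E x₀)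

theorem cs_mr_ctr {Φ : ℝ → L → L} {x₀ : L} {t : ℝ} (h : Φ t x₀ ∈ (chartAt E x₀).source) :
    cs x₀ (mr (E := E) x₀ Φ t (ctr x₀)) = Φ t x₀ := by
  rw [mr, cs_ctr]
  exact (extChartAt 𝓘(ℝ, E) x₀).left_inv (by rwa [extChartAt_source])

/-- The inverse chart has identity differential at the centre, so no correction appears on the
source side; the moved point only has to remain in the chart. -/
theorem tr_mfderiv {Φ : ℝ → L → L} {x₀ : L} {t : ℝ} (h : Φ t x₀ ∈ (chartAt E x₀).source)
    (hd : MDifferentiableAt 𝓘(ℝ, E) 𝓘(ℝ, E) (Φ t) x₀) (v : E) :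
    tr x₀ (Φ t x₀) (mfderiv 𝓘(ℝ, E) 𝓘(ℝ, E) (Φ t) x₀ v)
      = fderiv ℝ (mr x₀ Φ t) (ctr x₀) v := by
  have h0 : HasMFDerivAt 𝓘(ℝ, E) 𝓘(ℝ, E) (cs x₀) (ctr (E := E) x₀)
      (ContinuousLinearMap.id ℝ E) := by
    have h1 := ((contMDiffAt_cs_ctr (E := E) x₀).mdifferentiableAt (by simp)).hasMFDerivAt
    have h2 : mfderiv 𝓘(ℝ, E) 𝓘(ℝ, E) (cs x₀) (ctr (E := E) x₀)
        = ContinuousLinearMap.id ℝ E := by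
      have := mfderivWithin_range_extChartAt_symm (I := 𝓘(ℝ, E)) (x := x₀)
      rw [modelWithCornersSelf_coe, range_id, mfderivWithin_univ] at this
      exact this
    rw [h2] at h1
    exact h1
  let T : E →L[ℝ] E := (tr x₀ (Φ t x₀)) ∘L (mfderiv 𝓘(ℝ, E) 𝓘(ℝ, E) (Φ t) x₀)
  have h1 : HasMFDerivAt 𝓘(ℝ, E) 𝓘(ℝ, E) (extChartAt 𝓘(ℝ, E) x₀ ∘ Φ t) x₀ T := by
    have h := (mdifferentiableAt_extChartAt h).hasMFDerivAt.comp x₀ hd.hasMFDerivAt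
    rw [← tr_eq_mfderiv (by assumption)] at h
    exact h
  have h2 : HasMFDerivAt 𝓘(ℝ, E) 𝓘(ℝ, E) (extChartAt 𝓘(ℝ, E) x₀ ∘ Φ t)
      (cs x₀ (ctr (E := E) x₀)) T := by
    rw [cs_ctr]; exact h1
  have h3 : HasFDerivAt (mr x₀ Φ t) T (ctr (E := E) x₀) :=
    hasMFDerivAt_iff_hasFDerivAt.1 (h2.comp (ctr (E := E) x₀) h0)
  exact (DFunLike.congr_fun h3.fderiv v).symm

theorem HasVelocity.hasDerivAt_fderiv_mr {Φ : ℝ → L → L} {Y : VField E L} (h : HasVelocity Φ Y)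
    (h0 : ∀ x, Φ 0 x = x) {x₀ : L}
    (hΦ : ContMDiffAt (𝓘(ℝ, ℝ).prod 𝓘(ℝ, E)) 𝓘(ℝ, E) ∞ (fun p : ℝ × L => Φ p.1 p.2) (0, x₀)) :
    HasDerivAt (fun t => fderiv ℝ (mr x₀ Φ t) (ctr x₀)) (fderiv ℝ (vr x₀ Y) (ctr x₀)) 0 := by
  refine hasDerivAt_fderiv_of_contDiffAt (f := fun p : ℝ × E => mr x₀ Φ p.1 p.2)
    ((contDiffAt_mr hΦ ?_).of_le two_le_infty) ?_
  · rw [h0]; exact mem_chart_source E x₀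
  · filter_upwards [target_mem_nhds x₀] with z hz
    exact h.hasDerivAt_mr hz

theorem fderiv_mr_zero {Φ : ℝ → L → L} (h0 : ∀ x, Φ 0 x = x) (x₀ : L) :
    fderiv ℝ (mr x₀ Φ 0) (ctr (E := E) x₀) = ContinuousLinearMap.id ℝ E := by
  have h1 : mr x₀ Φ 0 =ᶠ[𝓝 (ctr (E := E) x₀)] id := by
    filter_upwards [target_mem_nhds x₀] with z hz
    exact mr_zero h0 hz
  rw [h1.fderiv_eq, fderiv_id]

/-- The derivative of a form or a field of endomorphisms, vanishing at time `0`, along a moving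
point. -/
theorem hasDerivAt_along {G : Type*} [NormedAddCommGroup G] [NormedSpace ℝ G] {f : ℝ × E → G}
    {z : ℝ → E} {z₀ z' : E} {g : G} (hz₀ : z 0 = z₀) (hf : DifferentiableAt ℝ f (0, z₀))
    (hz : HasDerivAt z z' 0)
    (hg : HasDerivAt (fun t => f (t, z₀)) g 0) (h0 : ∀ᶠ y in 𝓝 z₀, f (0, y) = 0) :
    HasDerivAt (fun t => f (t, z t)) g 0 := by
  subst hz₀
  have h1 : HasDerivAt (fun t : ℝ => (t, z t)) ((1 : ℝ), z') 0 := (hasDerivAt_id 0).prodMk hz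
  have h2 := hf.hasFDerivAt.comp_hasDerivAt (0 : ℝ) h1
  have h3 : HasDerivAt (fun t : ℝ => (t, z 0)) ((1 : ℝ), (0 : E)) 0 :=
    (hasDerivAt_id 0).prodMk (hasDerivAt_const 0 _)
  have h4 := (hf.hasFDerivAt.comp_hasDerivAt (0 : ℝ) h3).unique hg
  have h5 : HasFDerivAt (fun y : E => ((0 : ℝ), y)) (ContinuousLinearMap.inr ℝ ℝ E) (z 0) := by
    simpa using! (hasFDerivAt_prodMk_right (𝕜 := ℝ) (0 : ℝ) (z 0))
  have h6 := (hf.hasFDerivAt.comp (z 0) h5).unique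
    ((hasFDerivAt_const (0 : G) (z 0)).congr_of_eventuallyEq h0)
  -- `f (0, ·)` vanishes near `z 0`, so the motion of the point does not contribute to first order.
  have h7 : fderiv ℝ f (0, z 0) (0, z') = 0 := DFunLike.congr_fun h6 z'
  have h8 : fderiv ℝ f (0, z 0) (1, z') = g := by
    rw [← h4, ← add_zero (fderiv ℝ f (0, z 0) (1, 0)), ← h7, ← map_add]
    simp
  rw [← h8]
  exact h2

/-- The field is the derivative of each orbit at `0`. In the chart at `x₀` it is the partial
`t`-derivative of the jointly smooth representative, hence smooth. -/
theorem exists_hasVelocity {Φ : ℝ → L → L} (h0 : ∀ x, Φ 0 x = x)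
    (hΦ : ∀ x, ContMDiffAt (𝓘(ℝ, ℝ).prod 𝓘(ℝ, E)) 𝓘(ℝ, E) ∞ (fun p : ℝ × L => Φ p.1 p.2) (0, x)) :
    ∃ Y : VField E L, SmoothVF Y ∧ HasVelocity Φ Y := by
  have hv : HasVelocity Φ
      (fun x => (mfderiv 𝓘(ℝ, ℝ) 𝓘(ℝ, E) (fun t => Φ t x) 0 (1 : ℝ) : E)) := fun x₀ x hx =>
    hasDerivAt_extChartAt (h0 x)
      ((contMDiff_apply_family (hΦ x)).mdifferentiableAt (by simp)) hx
  refine ⟨_, smoothVF_iff.2 fun x₀ => ?_, hv⟩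
  have hs : ContDiffAt ℝ ∞ (fun p : ℝ × E => mr x₀ Φ p.1 p.2) (0, ctr x₀) :=
    contDiffAt_mr (hΦ x₀) (by rw [h0]; exact mem_chart_source E x₀)
  have h1 : ContDiffAt ℝ ∞ (fun z : E => fderiv ℝ (fun p : ℝ × E => mr x₀ Φ p.1 p.2) (0, z) (1, 0))
      (ctr x₀) := by
    have h2 : ContDiffAt ℝ ∞ (fderiv ℝ (fun p : ℝ × E => mr x₀ Φ p.1 p.2)) (0, ctr x₀) :=
      hs.fderiv_right (by simp)
    have h3 : ContDiffAt ℝ ∞ (fun z : E => ((0 : ℝ), z)) (ctr x₀) :=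
      contDiffAt_const.prodMk contDiffAt_id
    exact (h2.comp (ctr (E := E) x₀) h3).clm_apply contDiffAt_const
  have h4 : ContMDiffAt 𝓘(ℝ, E) 𝓘(ℝ, E) ∞ (extChartAt 𝓘(ℝ, E) x₀) x₀ := contMDiffAt_extChartAt
  refine (ContMDiffAt.comp_of_eq h1.contMDiffAt h4 rfl).congr_of_eventuallyEq ?_
  have hc2 : ContinuousAt (fun x : L => ((0 : ℝ), extChartAt 𝓘(ℝ, E) x₀ x)) x₀ :=
    continuousAt_const.prodMk h4.continuousAt
  have hd : ∀ᶠ p in 𝓝 ((0 : ℝ), ctr (E := E) x₀), DifferentiableAt ℝ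
      (fun p : ℝ × E => mr x₀ Φ p.1 p.2) p :=
    ((hs.of_le two_le_infty).eventually (by simp)).mono fun p hp => hp.differentiableAt (by simp)
  filter_upwards [hc2.eventually hd, (chartAt E x₀).open_source.mem_nhds (mem_chart_source E x₀)]
    with x hx hxs
  have h5 := hv x₀ x hxs
  have h6 : HasDerivAt (fun t : ℝ => (t, extChartAt 𝓘(ℝ, E) x₀ x)) ((1 : ℝ), (0 : E)) 0 :=
    (hasDerivAt_id 0).prodMk (hasDerivAt_const 0 _)
  refine h5.unique ((hx.hasFDerivAt.comp_hasDerivAt (0 : ℝ) h6).congr_of_eventuallyEq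
    (Eventually.of_forall fun t => ?_))
  have h7 : cs x₀ (extChartAt 𝓘(ℝ, E) x₀ x) = x :=
    (extChartAt 𝓘(ℝ, E) x₀).left_inv (by rwa [extChartAt_source])
  change _ = mr x₀ Φ t (extChartAt 𝓘(ℝ, E) x₀ x)
  rw [mr, h7]

end Velocity

/-! ### Necessity: the derivative of the gauge relation. -/

section GaugeDerivative

variable {E : Type*} [NormedAddCommGroup E] [NormedSpace ℝ E]
  {L : Type*} [TopologicalSpace L] [ChartedSpace E L] [IsManifold 𝓘(ℝ, E) ∞ L]

theorem mfderiv_symm_mfderiv (Φ : L ≃ₘ^∞⟮𝓘(ℝ, E), 𝓘(ℝ, E)⟯ L) (x : L) (v : E) :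
    (mfderiv 𝓘(ℝ, E) 𝓘(ℝ, E) Φ.symm (Φ x) (mfderiv 𝓘(ℝ, E) 𝓘(ℝ, E) Φ x v : E) : E) = v := by
  have h1 := (Φ.symm.contMDiff.mdifferentiableAt (x := Φ x) (by simp)).hasMFDerivAt.comp x
    (Φ.contMDiff.mdifferentiableAt (x := x) (by simp)).hasMFDerivAt
  have h2 : (Φ.symm ∘ Φ : L → L) = id := funext fun y => Φ.symm_apply_apply y
  have h3 : (mfderiv 𝓘(ℝ, E) 𝓘(ℝ, E) (Φ.symm ∘ Φ) x : E →L[ℝ] E) = ContinuousLinearMap.id ℝ E := by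
    rw [h2]; exact mfderiv_id
  have h4 := h1.mfderiv
  exact (DFunLike.congr_fun h4 v).symm.trans (DFunLike.congr_fun h3 v)

theorem pullback_symm_mfderiv (Φ : L ≃ₘ^∞⟮𝓘(ℝ, E), 𝓘(ℝ, E)⟯ L) (η : Form1 E L) (x : L) (v : E) :
    pullback Φ.symm η (Φ x) (mfderiv 𝓘(ℝ, E) 𝓘(ℝ, E) Φ x v) = η x v := by
  have h : ∀ (x' : L) (u : E), x' = x → u = v → (η x' : E →L[ℝ] ℝ) u = (η x : E →L[ℝ] ℝ) v := by
    rintro x' u rfl rfl; rfl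
  exact h _ _ (Φ.symm_apply_apply x) (mfderiv_symm_mfderiv Φ x v)

variable {F : LeviFlatStructure E L} {γ : Form1 E L} {X : VField E L}

theorem GaugeRel.form_mfderiv {Φ : L ≃ₘ^∞⟮𝓘(ℝ, E), 𝓘(ℝ, E)⟯ L} {α α' : Form1 E L}
    {S S' : EndField E L} (h : GaugeRel F γ X Φ α S α' S') (x : L) (v : E) :
    (γ (Φ x) + α' (Φ x)) (mfderiv 𝓘(ℝ, E) 𝓘(ℝ, E) Φ x v)
      = (pullback Φ.symm (γ + α) (Φ x) (X (Φ x)))⁻¹ * (γ x + α x) v := by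
  rw [h.form_eq, add_sub_cancel]
  exact congrArg _ (pullback_symm_mfderiv Φ (γ + α) x v)

/-- The normalising factor is recovered by evaluating on `X`, where `γ + α` equals `1`. Only `Φ` and
its differential remain, so the identity can be differentiated directly. -/
theorem GaugeRel.form_relation (hγX : IsDefiningCouple F.ξ γ X)
    {Φ : L ≃ₘ^∞⟮𝓘(ℝ, E), 𝓘(ℝ, E)⟯ L} {α α' : Form1 E L}
    {S S' : EndField E L} (h : GaugeRel F γ X Φ α S α' S') {x : L} (hα : α x (X x) = 0) (v : E) :
    (γ (Φ x) + α' (Φ x)) (mfderiv 𝓘(ℝ, E) 𝓘(ℝ, E) Φ x v)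
      = (γ (Φ x) + α' (Φ x)) (mfderiv 𝓘(ℝ, E) 𝓘(ℝ, E) Φ x (X x)) * (γ x + α x) v := by
  have h1 : (γ x + α x) (X x) = 1 := by rw [add_apply, hγX.γ_X, hα, add_zero]
  rw [h.form_mfderiv x v, h.form_mfderiv x (X x), h1, mul_one]

/-- `Φ` sends `ω_α(I + S)w` into the kernel of `γ + α'`, and `J_{α',S'}` sends its image to that of
`ω_α(I + S)Jw`; `pairJ_relation` at `Φ x` then applies. -/
theorem GaugeRel.endo_relation (hγX : IsDefiningCouple F.ξ γ X)
    {Φ : L ≃ₘ^∞⟮𝓘(ℝ, E), 𝓘(ℝ, E)⟯ L} {α α' : Form1 E L}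
    {S S' : EndField E L} (h : GaugeRel F γ X Φ α S α' S') (hα : ∀ x, α x (X x) = 0)
    (hS : IsAntilinear F X S)
    (hα' : ∀ x, α' x (X x) = 0) (hS' : IsAntilinear F X S') {x : L} {w : TangentSpace 𝓘(ℝ, E) x}
    (hw : w ∈ F.ξ x) (a b : TangentSpace 𝓘(ℝ, E) (Φ x))
    (ha : a = mfderiv 𝓘(ℝ, E) 𝓘(ℝ, E) Φ x (omega X α x (onePlus S x w)))
    (hb : b = mfderiv 𝓘(ℝ, E) 𝓘(ℝ, E) Φ x (omega X α x (onePlus S x (F.J x w)))) :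
    omega X γ (Φ x) a - S' (Φ x) (omega X γ (Φ x) a) + extJ F γ X (Φ x) b
      + S' (Φ x) (extJ F γ X (Φ x) b) = 0 := by
  have h1 : γ x (onePlus S x w) = 0 := (hγX.ker_γ x _).1
      ((F.ξ x).add_mem hw (hS.mem x _ hw))
  have h2 : (γ x + α x) (omega X α x (onePlus S x w)) = 0 := by
    rw [add_apply, omega_apply, map_sub, map_sub, map_smul, map_smul, hγX.γ_X, hα, h1]
    simp
  have h3 : (γ (Φ x) + α' (Φ x)) a = 0 := by
    rw [ha]
    exact (h.form_mfderiv x _).trans (by rw [h2, mul_zero])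
  have h4 := pairJ_relation hγX hα' hS' (h.invertible' (Φ x)) h3
  have h5 : pairJ F.J X α' S' (Φ x) a = b := by
    rw [ha, h.J_eq x _ h2, pairJ_apply hα (h.invertible x), hb]
  rwa [h5] at h4

theorem fr_mr {Φ : ℝ → L → L} {x₀ : L} {t : ℝ} (h : Φ t x₀ ∈ (chartAt E x₀).source)
    (hd : MDifferentiableAt 𝓘(ℝ, E) 𝓘(ℝ, E) (Φ t) x₀) (η : Form1 E L) (v : E) :
    fr x₀ η (mr x₀ Φ t (ctr x₀)) (fderiv ℝ (mr x₀ Φ t) (ctr x₀) v)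
      = η (Φ t x₀) (mfderiv 𝓘(ℝ, E) 𝓘(ℝ, E) (Φ t) x₀ v) := by
  rw [← tr_mfderiv h hd v, fr, cs_mr_ctr h, ContinuousLinearMap.comp_apply, trs_tr h]

theorem er_tr {x₀ y : L} (h : y ∈ (chartAt E x₀).source) {z : E} (hz : cs x₀ z = y)
    (S : EndField E L) (v : TangentSpace 𝓘(ℝ, E) y) :
    er x₀ S z (tr x₀ y v) = tr x₀ y (S y v) := by
  subst hz
  simp [er, trs_tr h]

variable {I : Set ℝ} {α α' : ℝ → Form1 E L} {S S' : ℝ → EndField E L} {β β' : Form1 E L}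
  {P P' : EndField E L} {Φ : ℝ → (L ≃ₘ^∞⟮𝓘(ℝ, E), 𝓘(ℝ, E)⟯ L)} {Y : VField E L}

theorem IsPairCurve.fr_zero (hc : IsPairCurve F X I α S) (x₀ : L) (z : E) :
    fr x₀ (α 0) z = 0 := by ext; simp [fr, hc.α_zero]

theorem IsPairCurve.er_zero (hc : IsPairCurve F X I α S) (x₀ : L) (z : E) :
    er x₀ (S 0) z = 0 := by ext; simp [er, hc.S_zero]

/-- Differentiating `GaugeRel.form_relation` yields `𝓛_Y γ + β' = (𝓛_Y γ)(X) γ + β`, using `β'(X) =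
0`. Integrability of `ξ` turns the difference `β - β'` into `δ ι_Y γ`. -/
theorem differ_form (hγX : IsDefiningCouple F.ξ γ X) (hI : IsOpen I) (h0 : (0 : ℝ) ∈ I)
    (hc : IsPairCurve F X I α S) (hc' : IsPairCurve F X I α' S') (ht : HasTangent α S β P)
    (ht' : HasTangent α' S' β' P') (hβ' : ∀ x, β' x (X x) = 0)
    (hΦ : ∀ x, ContMDiffAt (𝓘(ℝ, ℝ).prod 𝓘(ℝ, E)) 𝓘(ℝ, E) ∞ (fun p : ℝ × L => Φ p.1 p.2) (0, x))
    (hΦ0 : ∀ x, Φ 0 x = x) (hY : SmoothVF Y) (hv : HasVelocity (fun t => Φ t) Y)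
    (hG : ∀ t ∈ I, GaugeRel F γ X (Φ t) (α t) (S t) (α' t) (S' t))
    {V : VField E L} (hV : SmoothVF V) (x₀ : L) :
    β x₀ (V x₀) - β' x₀ (V x₀) = deltaFun γ X (ev γ Y) V x₀ := by
  have hγ := hγX.smooth_γ
  have hX := hγX.smooth_X
  let Ψ : ℝ → L → L := fun t => Φ t
  let z : ℝ → E := fun t => mr x₀ Ψ t (ctr x₀)
  let A : ℝ → E →L[ℝ] E := fun t => fderiv ℝ (mr x₀ Ψ t) (ctr x₀)
  set y := vr x₀ Y (ctr x₀) with hy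
  have hz0 : z 0 = ctr x₀ := mr_zero hΦ0 (ctr_mem_target x₀)
  have hz : HasDerivAt z y 0 := hv.hasDerivAt_mr (ctr_mem_target x₀)
  have hA0 : A 0 = ContinuousLinearMap.id ℝ E := fderiv_mr_zero hΦ0 x₀
  have hA : HasDerivAt A (fderiv ℝ (vr x₀ Y) (ctr x₀)) 0 := hv.hasDerivAt_fderiv_mr hΦ0 (hΦ x₀)
  have hg : HasDerivAt (fun t => fr x₀ γ (z t)) (fderiv ℝ (fr x₀ γ) (ctr x₀) y) 0 :=
    HasFDerivAt.comp_hasDerivAt_of_eq (0 : ℝ) (hγ.differentiableAt x₀).hasFDerivAt hz hz0.symm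
  have ha' : HasDerivAt (fun t => fr x₀ (α' t) (z t)) (fr x₀ β' (ctr x₀)) 0 := by
    exact hasDerivAt_along (f := fun p : ℝ × E => fr x₀ (α' p.1) p.2) hz0
      ((hc'.contDiffAt_form hI h0 x₀).differentiableAt (by simp)) hz
      (ht'.hasDerivAt_form hI h0 hc' x₀) (Eventually.of_forall fun y => hc'.fr_zero x₀ y)
  have hk : HasDerivAt (fun t => fr x₀ γ (z t) + fr x₀ (α' t) (z t))
      (fderiv ℝ (fr x₀ γ) (ctr x₀) y + fr x₀ β' (ctr x₀)) 0 := hg.fun_add ha'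
  have hlhs : ∀ u : E, HasDerivAt (fun t => (fr x₀ γ (z t) + fr x₀ (α' t) (z t)) (A t u))
      ((fderiv ℝ (fr x₀ γ) (ctr x₀) y + fr x₀ β' (ctr x₀)) u
        + fr x₀ γ (ctr x₀) (fderiv ℝ (vr x₀ Y) (ctr x₀) u)) 0 := by
    intro u
    have h1 := hk.clm_apply (hA.clm_apply (hasDerivAt_const (0 : ℝ) u))
    simpa only [hA0, hz0, hc'.fr_zero, add_zero, map_zero, zero_apply,
      ContinuousLinearMap.id_apply] using h1
  set v := vr x₀ V (ctr x₀) with hvd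
  set e := vr x₀ X (ctr x₀) with he
  have hr : HasDerivAt (fun t => fr x₀ γ (ctr x₀) v + fr x₀ (α t) (ctr x₀) v)
      (fr x₀ β (ctr x₀) v) 0 := by
    have h1 := (ht.hasDerivAt_form hI h0 hc x₀).clm_apply (hasDerivAt_const (0 : ℝ) v)
    simpa using h1.const_add (fr x₀ γ (ctr x₀) v)
  have hrhs := (hlhs e).fun_mul hr
  have hev : (fun t => (fr x₀ γ (z t) + fr x₀ (α' t) (z t)) (A t v))
      =ᶠ[𝓝 0] fun t => (fr x₀ γ (z t) + fr x₀ (α' t) (z t)) (A t e)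
        * (fr x₀ γ (ctr x₀) v + fr x₀ (α t) (ctr x₀) v) := by
    filter_upwards [hI.mem_nhds h0, eventually_mem_source (Φ := Ψ) hΦ0 (hΦ x₀)] with t htI hts
    have hd : MDifferentiableAt 𝓘(ℝ, E) 𝓘(ℝ, E) (Ψ t) x₀ :=
      (Φ t).contMDiff.mdifferentiableAt (by simp)
    simp only [add_apply, z, A, fr_mr hts hd, fr_ctr]
    have h1 := (hG t htI).form_relation hγX (x := x₀) (hc.ι_X t htI x₀) v
    rw [he, vr_ctr]
    exact h1
  have hfin := (hlhs v).unique (hrhs.congr_of_eventuallyEq hev)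
  have hγe : fr x₀ γ (ctr x₀) e = 1 := by
    rw [he, fr_apply_vr (ctr_mem_target x₀), cs_ctr]; exact hγX.γ_X x₀
  have hβe : fr x₀ β' (ctr x₀) e = 0 := by rw [he, fr_ctr, vr_ctr]; exact hβ' x₀
  simp only [hA0, hz0, hc'.fr_zero, hc.fr_zero, add_zero, zero_apply, add_apply,
      ContinuousLinearMap.id_apply, hγe, hβe] at hfin
  -- This expresses `dγ(Y, V)` through `dγ(X, V)` and `dγ(Y, X)`, replacing the Lie derivative along
  -- `Y` by the one along `X`.
  have htrans := dForm_transverse F hγ hγX.ker_γ x₀ hγe y v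
  have hconst : fderiv ℝ (fr x₀ γ) (ctr x₀) v e
      + fr x₀ γ (ctr x₀) (fderiv ℝ (vr x₀ X) (ctr x₀) v) = 0 := by
    have h1 := der_ev hγ hX V (x₀ := x₀)
    have h2 : ev γ X = fun _ => (1 : ℝ) := funext fun x => hγX.γ_X x
    rw [h2] at h1
    rw [← hvd, ← he] at h1
    rw [← h1]
    simp [der]
    rfl
  have hβv : β x₀ (V x₀) - β' x₀ (V x₀) = fr x₀ β (ctr x₀) v - fr x₀ β' (ctr x₀) v := by
    rw [fr_ctr, fr_ctr, hvd, vr_ctr]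
  rw [hβv, deltaFun, der_ev hγ hY, der_ev hγ hY, lieD_eq hγ hV, ev_eq_fr γ Y, ev_eq_fr γ V]
  simp only [← hvd, ← he, ← hy]
  unfold dForm at htrans
  linear_combination -hfin + htrans - (fr x₀ γ (ctr x₀) y) * hconst

/-- Here `p`, `j`, `s` stand for `π`, `J`, `P'`, and `d - e`, `d' - e'` are the brackets `[V, Y]`,
`[JV, Y]` in the chart. The derivatives `u`, `u'` of `π` and `J` along `Y` are eliminated by those
of `πV = V` and `J(JV) = -V`. The term `PV` occurs twice, because `J P J = P` on `ξ`. -/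
theorem endo_algebra {G : Type*} [AddCommGroup G] [Module ℝ G] (p j s : G →ₗ[ℝ] G)
    {u u' w w' d d' e e' q q' X : G} {c c' : ℝ}
    (hrel : (u + p (d + (q - c • X))) - s (p w) + (u' + j (d' + (q' - c' • X))) + s (j w') = 0)
    (hp : e = u + p e) (hj : -e = u' + j e') (hw : p w = w) (hq : p q = q) (hX : p X = 0)
    (hq' : j q' = q) (hX' : j X = 0) (hw' : j w' = -w) :
    q - s w = -((1 / 2 : ℝ) • (p (d - e) + j (d' - e'))) := by
  simp only [map_add, map_sub, map_smul, hw, hq, hX, hq', hX', hw', map_neg] at hrel ⊢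
  linear_combination (norm := module) (1 / 2 : ℝ) • hrel + (1 / 2 : ℝ) • hp + (1 / 2 : ℝ) • hj

/-- Differentiate `GaugeRel.endo_relation` along the moving point. The extended operators `π` and
`J` are needed here, because their derivatives off `ξ` enter. -/
theorem differ_endo (hγX : IsDefiningCouple F.ξ γ X) [FiniteDimensional ℝ E] [T2Space L]
    (hI : IsOpen I) (h0 : (0 : ℝ) ∈ I)
    (hc : IsPairCurve F X I α S) (hc' : IsPairCurve F X I α' S') (ht : HasTangent α S β P)
    (ht' : HasTangent α' S' β' P') (hP : IsForm01 F X P)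
    (hΦ : ∀ x, ContMDiffAt (𝓘(ℝ, ℝ).prod 𝓘(ℝ, E)) 𝓘(ℝ, E) ∞ (fun p : ℝ × L => Φ p.1 p.2) (0, x))
    (hΦ0 : ∀ x, Φ 0 x = x) (hv : HasVelocity (fun t => Φ t) Y)
    (hG : ∀ t ∈ I, GaugeRel F γ X (Φ t) (α t) (S t) (α' t) (S' t))
    {V : VField E L} (hV : SmoothVF V) (hVt : TangentTo F.ξ V) (x₀ : L) :
    P x₀ (V x₀) - P' x₀ (V x₀) = -HForm F.J γ X Y V x₀ := by
  have hJV := F.smooth_J V hV hVt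
  have hπs := smoothEnd_omega hγX.smooth_X hγX.smooth_γ
  have hJs := hγX.smoothEnd_extJ
  let Ψ : ℝ → L → L := fun t => Φ t
  let z : ℝ → E := fun t => mr x₀ Ψ t (ctr x₀)
  let A : ℝ → E →L[ℝ] E := fun t => fderiv ℝ (mr x₀ Ψ t) (ctr x₀)
  set y := vr x₀ Y (ctr x₀) with hy
  have hz0 : z 0 = ctr x₀ := mr_zero hΦ0 (ctr_mem_target x₀)
  have hz : HasDerivAt z y 0 := hv.hasDerivAt_mr (ctr_mem_target x₀)
  have hA0 : A 0 = ContinuousLinearMap.id ℝ E := fderiv_mr_zero hΦ0 x₀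
  have hA : HasDerivAt A (fderiv ℝ (vr x₀ Y) (ctr x₀)) 0 := hv.hasDerivAt_fderiv_mr hΦ0 (hΦ x₀)
  have hend : ∀ {T : EndField E L}, SmoothEnd T →
      HasDerivAt (fun t => er x₀ T (z t)) (fderiv ℝ (er x₀ T) (ctr x₀) y) 0 := fun hT =>
    HasFDerivAt.comp_hasDerivAt_of_eq (0 : ℝ) (hT.differentiableAt x₀).hasFDerivAt hz hz0.symm
  have hs' : HasDerivAt (fun t => er x₀ (S' t) (z t)) (er x₀ P' (ctr x₀)) 0 :=
    hasDerivAt_along (f := fun p : ℝ × E => er x₀ (S' p.1) p.2) hz0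
      ((hc'.contDiffAt_endo hI h0 x₀).differentiableAt (by simp)) hz
      (ht'.hasDerivAt_endo hI h0 hc' x₀) (Eventually.of_forall fun y => hc'.er_zero x₀ y)
  have hT0 : ∀ U, twist X (α 0) (S 0) U = U := fun U => hc.twist_zero U
  -- derivative of an endomorphism applied to a transported vector
  have hcur : ∀ {T : EndField E L} {U : VField E L}, SmoothEnd T → SmoothVF U →
      HasDerivAt (fun t => er x₀ T (z t) (A t (vr x₀ (twist X (α t) (S t) U) (ctr x₀))))
        (fderiv ℝ (er x₀ T) (ctr x₀) y (vr x₀ U (ctr x₀))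
          + er x₀ T (ctr x₀) (fderiv ℝ (vr x₀ Y) (ctr x₀) (vr x₀ U (ctr x₀))
            + vr x₀ (twistDeriv X β P U) (ctr x₀))) 0 := by
    intro T U hT hU
    have h1 := (hend hT).clm_apply
      (hA.clm_apply (hasJetDeriv_twist hγX.smooth_X hI h0 hc ht hU x₀).value)
    simpa only [hA0, hz0, hT0, ContinuousLinearMap.id_apply] using h1
  have hrel := deriv_of_relation (s := fun t => er x₀ (S' t) (z t)) (hc'.er_zero x₀ _) hs'
    (hcur hπs hV) (hcur hJs hJV) (by
      filter_upwards [hI.mem_nhds h0, eventually_mem_source (Φ := Ψ) hΦ0 (hΦ x₀)] with t htI hts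
      have hd : MDifferentiableAt 𝓘(ℝ, E) 𝓘(ℝ, E) (Ψ t) x₀ :=
        (Φ t).contMDiff.mdifferentiableAt (by simp)
      have hcs : cs x₀ (z t) = Ψ t x₀ := cs_mr_ctr hts
      have hAt : ∀ U : VField E L, A t (vr x₀ U (ctr x₀))
          = tr x₀ (Ψ t x₀) (mfderiv 𝓘(ℝ, E) 𝓘(ℝ, E) (Ψ t) x₀ (U x₀)) := by
        intro U
        rw [vr_ctr]
        exact (tr_mfderiv hts hd _).symm
      simp only [hAt, er_tr hts hcs, ← map_sub, ← map_add]
      exact (congrArg (tr x₀ (Ψ t x₀)) ((hG t htI).endo_relation hγX (hc.ι_X t htI)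
        (hc.antilinear t htI) (hc'.ι_X t htI) (hc'.antilinear t htI) (hVt x₀) _ _ rfl rfl)).trans
        (map_zero _))
  simp only [hA0, hz0, hT0, ContinuousLinearMap.id_apply] at hrel
  -- first-order identities for `π V = V` and `-J (J V) = V`
  have hpi : fderiv ℝ (vr x₀ V) (ctr x₀) y
      = fderiv ℝ (er x₀ (omega X γ)) (ctr x₀) y (vr x₀ V (ctr x₀))
      + er x₀ (omega X γ) (ctr x₀) (fderiv ℝ (vr x₀ V) (ctr x₀) y) := by
    have h1 : app (omega X γ) V = V := funext fun x => hγX.omega_of_mem (hVt x)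
    have h2 := fderiv_app (hπs.differentiableAt x₀) (hV.differentiableAt x₀) y
    rwa [h1] at h2
  have hjj : -fderiv ℝ (vr x₀ V) (ctr x₀) y
      = fderiv ℝ (er x₀ (extJ F γ X)) (ctr x₀) y (vr x₀ (app F.J V) (ctr x₀))
      + er x₀ (extJ F γ X) (ctr x₀) (fderiv ℝ (vr x₀ (app F.J V)) (ctr x₀) y) := by
    have h1 : vr x₀ (app (extJ F γ X) (app F.J V)) = fun z => -vr x₀ V z := by
      funext z
      have : app (extJ F γ X) (app F.J V) (cs x₀ z) = -V (cs x₀ z) :=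
        (hγX.extJ_of_mem (F.J_mem _ _ (hVt _))).trans (F.J_sq _ _ (hVt _))
      rw [vr, this, map_neg, vr]
    have h2 := fderiv_app (hJs.differentiableAt x₀) (hJV.differentiableAt x₀) y
    rw [h1, fderiv_fun_neg] at h2
    exact h2
  have hb1 := br_eq V Y x₀
  have hb2 := br_eq (app F.J V) Y x₀
  rw [vr_ctr] at hb1 hb2
  have hH : HForm F.J γ X Y V x₀ = (1 / 2 : ℝ) • (omega X γ x₀ (br V Y x₀)
      + extJ F γ X x₀ (br (app F.J V) Y x₀)) := rfl
  rw [hH, hb1, hb2]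
  have hw : omega X γ x₀ (V x₀) = V x₀ := hγX.omega_of_mem (hVt x₀)
  have hPV : omega X γ x₀ (P x₀ (V x₀)) = P x₀ (V x₀) :=
    hγX.omega_of_mem (hP.antilinear.apply_mem hγX x₀ _)
  have hPJ : extJ F γ X x₀ (P x₀ (F.J x₀ (V x₀))) = P x₀ (V x₀) := by
    rw [hγX.extJ_of_mem (hP.antilinear.apply_mem hγX x₀ _), hP.antilinear.anticomm x₀ _ (hVt x₀),
      map_neg, F.J_sq x₀ _ (hP.antilinear.apply_mem hγX x₀ _), neg_neg]
  have hJJ : extJ F γ X x₀ (F.J x₀ (V x₀)) = -V x₀ :=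
    (hγX.extJ_of_mem (F.J_mem _ _ (hVt _))).trans (F.J_sq _ _ (hVt _))
  have htd : ∀ U : VField E L, twistDeriv X β P U x₀ = P x₀ (U x₀) - β x₀ (U x₀) • X x₀ :=
    fun U => rfl
  have happ : app F.J V x₀ = F.J x₀ (V x₀) := rfl
  have hyY : y = Y x₀ := vr_ctr x₀ Y
  simp only [er_ctr_eq, vr_ctr, htd, happ, hyY] at hrel hpi hjj ⊢
  exact endo_algebra (omega X γ x₀).toLinearMap (extJ F γ X x₀).toLinearMap (P' x₀).toLinearMap
    hrel hpi hjj hw hPV (hγX.omega_X x₀) hPJ (hγX.extJ_X x₀) hJJ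

end GaugeDerivative

/-! ### Linear and antilinear parts of a map between fibres, and the quotient `Q N⁻¹`. -/

section Transport

variable {E : Type*} [NormedAddCommGroup E] [NormedSpace ℝ E]
  {L : Type*} [TopologicalSpace L] [ChartedSpace E L] [IsManifold 𝓘(ℝ, E) ∞ L]

variable (F : LeviFlatStructure E L) (γ : Form1 E L) (X : VField E L)

/-- The map `π A ω_α (I + S) π` from `T_x L` to `T_y L`, where `A : T_x L → T_y L` and `π` is the
projection onto `ξ` along `X`. -/
def transport (α : Form1 E L) (S : EndField E L) {x y : L}
    (A : TangentSpace 𝓘(ℝ, E) x →L[ℝ] TangentSpace 𝓘(ℝ, E) y) :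
    TangentSpace 𝓘(ℝ, E) x →L[ℝ] TangentSpace 𝓘(ℝ, E) y :=
  omega X γ y ∘L A ∘L omega X α x ∘L onePlus S x ∘L omega X γ x

/-- The `J`-antilinear part of a linear map. -/
def antiPart {x y : L} (A : TangentSpace 𝓘(ℝ, E) x →L[ℝ] TangentSpace 𝓘(ℝ, E) y) :
    TangentSpace 𝓘(ℝ, E) x →L[ℝ] TangentSpace 𝓘(ℝ, E) y :=
  (1 / 2 : ℝ) • (A + extJ F γ X y ∘L A ∘L extJ F γ X x)

/-- The `J`-linear part of a linear map. -/
def linPart {x y : L} (A : TangentSpace 𝓘(ℝ, E) x →L[ℝ] TangentSpace 𝓘(ℝ, E) y) :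
    TangentSpace 𝓘(ℝ, E) x →L[ℝ] TangentSpace 𝓘(ℝ, E) y :=
  (1 / 2 : ℝ) • (A - extJ F γ X y ∘L A ∘L extJ F γ X x)

/-- The extension of a map from `ξ` to `ξ` mapping `X` to `X`. -/
def addNormal {x y : L} (A : TangentSpace 𝓘(ℝ, E) x →L[ℝ] TangentSpace 𝓘(ℝ, E) y) :
    TangentSpace 𝓘(ℝ, E) x →L[ℝ] TangentSpace 𝓘(ℝ, E) y :=
  A + (γ x).smulRight (X y)

variable {F γ X}

theorem addNormal_apply {x y : L} (A : TangentSpace 𝓘(ℝ, E) x →L[ℝ] TangentSpace 𝓘(ℝ, E) y)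
    (v : TangentSpace 𝓘(ℝ, E) x) : addNormal γ X A v = A v + γ x v • X y := rfl

theorem linPart_apply {x y : L} (A : TangentSpace 𝓘(ℝ, E) x →L[ℝ] TangentSpace 𝓘(ℝ, E) y)
    (v : TangentSpace 𝓘(ℝ, E) x) :
    linPart F γ X A v = (1 / 2 : ℝ) • (A v - extJ F γ X y (A (extJ F γ X x v))) := rfl

theorem antiPart_apply {x y : L} (A : TangentSpace 𝓘(ℝ, E) x →L[ℝ] TangentSpace 𝓘(ℝ, E) y)
    (v : TangentSpace 𝓘(ℝ, E) x) :
    antiPart F γ X A v = (1 / 2 : ℝ) • (A v + extJ F γ X y (A (extJ F γ X x v))) := rfl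

theorem linPart_add_antiPart {x y : L}
    (A : TangentSpace 𝓘(ℝ, E) x →L[ℝ] TangentSpace 𝓘(ℝ, E) y) (v : TangentSpace 𝓘(ℝ, E) x) :
    linPart F γ X A v + antiPart F γ X A v = A v := by
  rw [linPart_apply, antiPart_apply]; module

variable (h : IsDefiningCouple F.ξ γ X)
include h

theorem IsDefiningCouple.omega_extJ (x : L) (v : TangentSpace 𝓘(ℝ, E) x) :
    omega X γ x (extJ F γ X x v) = extJ F γ X x v := h.omega_of_mem (h.extJ_mem x v)

theorem IsDefiningCouple.extJ_extJ (x : L) (v : TangentSpace 𝓘(ℝ, E) x) :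
    extJ F γ X x (extJ F γ X x v) = -omega X γ x v := by
  rw [h.extJ_of_mem (h.extJ_mem x v)]
  exact F.J_sq x _ (h.omega_mem x v)

theorem IsDefiningCouple.γ_extJ (x : L) (v : TangentSpace 𝓘(ℝ, E) x) :
    γ x (extJ F γ X x v) = 0 := (h.ker_γ x _).1 (h.extJ_mem x v)

theorem IsDefiningCouple.γ_omega (x : L) (v : TangentSpace 𝓘(ℝ, E) x) :
    γ x (omega X γ x v) = 0 := (h.ker_γ x _).1 (h.omega_mem x v)

/-- Maps of the form `π A π`. -/
structure IsTransverse (X : VField E L) (ξ : Distribution E L) {x y : L}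
    (A : TangentSpace 𝓘(ℝ, E) x →L[ℝ] TangentSpace 𝓘(ℝ, E) y) : Prop where
  apply_X : A (X x) = 0
  mem : ∀ v, A v ∈ ξ y

theorem isTransverse_transport (α : Form1 E L) (S : EndField E L) {x y : L}
    (A : TangentSpace 𝓘(ℝ, E) x →L[ℝ] TangentSpace 𝓘(ℝ, E) y) :
    IsTransverse X F.ξ (transport γ X α S A) :=
  ⟨by simp only [transport, ContinuousLinearMap.comp_apply, h.omega_X, map_zero],
    fun v => h.omega_mem y _⟩

variable {x y : L} {A : TangentSpace 𝓘(ℝ, E) x →L[ℝ] TangentSpace 𝓘(ℝ, E) y}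
  (hA : IsTransverse X F.ξ A)
include hA

omit h in
theorem IsTransverse.apply_omega (v : TangentSpace 𝓘(ℝ, E) x) : A (omega X γ x v) = A v := by
  rw [omega_apply, map_sub, map_smul, hA.apply_X]; simp

theorem IsTransverse.linPart : IsTransverse X F.ξ (linPart F γ X A) := by
  refine ⟨?_, fun v => ?_⟩
  · rw [linPart_apply, h.extJ_X, hA.apply_X, map_zero, map_zero]; simp
  · exact (F.ξ y).smul_mem _ ((F.ξ y).sub_mem (hA.mem _) (h.extJ_mem y _))

theorem IsTransverse.antiPart : IsTransverse X F.ξ (antiPart F γ X A) := by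
  refine ⟨?_, fun v => ?_⟩
  · rw [antiPart_apply, h.extJ_X, hA.apply_X, map_zero, map_zero]; simp
  · exact (F.ξ y).smul_mem _ ((F.ξ y).add_mem (hA.mem _) (h.extJ_mem y _))

theorem IsTransverse.linPart_extJ (v : TangentSpace 𝓘(ℝ, E) x) :
    LeviFlat.linPart F γ X A (extJ F γ X x v) = extJ F γ X y (LeviFlat.linPart F γ X A v) := by
  rw [linPart_apply, linPart_apply, h.extJ_extJ, map_neg, hA.apply_omega, map_smul, map_sub,
    h.extJ_extJ, h.omega_of_mem (hA.mem _), map_neg]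
  module

theorem IsTransverse.antiPart_extJ (v : TangentSpace 𝓘(ℝ, E) x) :
    LeviFlat.antiPart F γ X A (extJ F γ X x v) = -extJ F γ X y (LeviFlat.antiPart F γ X A v) := by
  rw [antiPart_apply, antiPart_apply, h.extJ_extJ, map_neg, hA.apply_omega, map_smul, map_add,
    h.extJ_extJ, h.omega_of_mem (hA.mem _), map_neg]
  module

theorem IsTransverse.addNormal_X : addNormal γ X A (X x) = X y := by
  rw [addNormal_apply, hA.apply_X, h.γ_X]; simp

theorem IsTransverse.addNormal_linPart_extJ (v : TangentSpace 𝓘(ℝ, E) x) :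
    addNormal γ X (LeviFlat.linPart F γ X A) (extJ F γ X x v)
      = extJ F γ X y (addNormal γ X (LeviFlat.linPart F γ X A) v) := by
  rw [addNormal_apply, addNormal_apply, hA.linPart_extJ h, h.γ_extJ, map_add, map_smul, h.extJ_X]
  simp

/-- The field `Q N⁻¹` at the point `y`. -/
def quotEnd (F : LeviFlatStructure E L) (γ : Form1 E L) (X : VField E L) {x y : L}
    (A : TangentSpace 𝓘(ℝ, E) x →L[ℝ] TangentSpace 𝓘(ℝ, E) y) :
    TangentSpace 𝓘(ℝ, E) y →L[ℝ] TangentSpace 𝓘(ℝ, E) y :=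
  LeviFlat.antiPart F γ X A ∘L (addNormal γ X (LeviFlat.linPart F γ X A)).inverse

variable (hN : (addNormal γ X (LeviFlat.linPart F γ X A)).IsInvertible)
include hN

theorem IsTransverse.quotEnd_X : quotEnd F γ X A (X y) = 0 := by
  rw [quotEnd, ContinuousLinearMap.comp_apply,
    hN.inverse_apply_eq.2 ((hA.linPart h).addNormal_X h).symm, (hA.antiPart h).apply_X]

omit hN in
theorem IsTransverse.quotEnd_mem (v : TangentSpace 𝓘(ℝ, E) y) : quotEnd F γ X A v ∈ F.ξ y :=
  (hA.antiPart h).mem _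

/-- `N` commutes with `J` and `Q` anticommutes with it, so `Q N⁻¹` anticommutes. -/
theorem IsTransverse.quotEnd_anticomm {v : TangentSpace 𝓘(ℝ, E) y} (hv : v ∈ F.ξ y) :
    quotEnd F γ X A (F.J y v) = -F.J y (quotEnd F γ X A v) := by
  obtain ⟨w, rfl⟩ := hN.surjective v
  have h1 := hN.inverse_apply_self w
  have h2 := hN.inverse_apply_self (extJ F γ X x w)
  rw [hA.addNormal_linPart_extJ h, h.extJ_of_mem hv] at h2
  rw [quotEnd, ContinuousLinearMap.comp_apply, ContinuousLinearMap.comp_apply, h1, h2,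
    hA.antiPart_extJ h, h.extJ_of_mem ((hA.antiPart h).mem _)]

theorem IsTransverse.id_add_quotEnd (v : TangentSpace 𝓘(ℝ, E) x) :
    addNormal γ X (LeviFlat.linPart F γ X A) v
      + quotEnd F γ X A (addNormal γ X (LeviFlat.linPart F γ X A) v) = addNormal γ X A v := by
  rw [quotEnd, ContinuousLinearMap.comp_apply, hN.inverse_apply_self, addNormal_apply,
    addNormal_apply, ← linPart_add_antiPart A v]
  abel

/-- If `M` denotes the map `A` completed by `X ↦ X`, then `M = N + Q`, so `I + Q N⁻¹ = M N⁻¹`. -/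
theorem IsTransverse.id_add_quotEnd_isInvertible (hM : (addNormal γ X A).IsInvertible) :
    (ContinuousLinearMap.id ℝ _ + quotEnd F γ X A).IsInvertible := by
  have h1 : ContinuousLinearMap.id ℝ _ + quotEnd F γ X A
      = addNormal γ X A ∘L (addNormal γ X (LeviFlat.linPart F γ X A)).inverse := by
    ext v
    obtain ⟨w, rfl⟩ := hN.surjective v
    rw [ContinuousLinearMap.comp_apply, hN.inverse_apply_self, ← hA.id_add_quotEnd h hN w]
    rfl
  rw [h1]
  exact hM.comp hN.inverse

end Transport

/-! ### The push-forward of a pair at one point. -/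

section PointwiseGauge

variable {E : Type*} [NormedAddCommGroup E] [NormedSpace ℝ E]
  {L : Type*} [TopologicalSpace L] [ChartedSpace E L] [IsManifold 𝓘(ℝ, E) ∞ L]
variable {F : LeviFlatStructure E L} {γ : Form1 E L} {X : VField E L}
  (h : IsDefiningCouple F.ξ γ X) {α α' : Form1 E L} {S S' : EndField E L}
  (hα : ∀ x, α x (X x) = 0) (hS : IsAntilinear F X S)
include h hα

/-- Vectors in the kernel of `γ + α` are determined by their projection to `ξ`. -/
theorem omega_omega_of_mem_ker {x : L} {c : TangentSpace 𝓘(ℝ, E) x} (hc : (γ x + α x) c = 0) :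
    omega X α x (omega X γ x c) = c := by
  have hαc : α x c = -γ x c := by
    have : γ x c + α x c = 0 := hc
    linarith
  rw [omega_apply, omega_apply, map_sub, map_smul, hα, hαc]; simp

include hS

/-- The vector is `w = (I + S)⁻¹ πc`; it lies in `ξ` because both `πc` and `S w` do. -/
theorem exists_eq_omega_onePlus {x : L} (hinv : (onePlus S x).IsInvertible)
    {c : TangentSpace 𝓘(ℝ, E) x} (hc : (γ x + α x) c = 0) :
    ∃ w ∈ F.ξ x, omega X α x (onePlus S x w) = c := by
  obtain ⟨w, hw⟩ := hinv.surjective (omega X γ x c)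
  refine ⟨w, ?_, by rw [hw, omega_omega_of_mem_ker h hα hc]⟩
  rw [h.ker_γ]
  have h1 := h.γ_omega x c
  rw [← hw, onePlus_apply, map_add, (h.ker_γ x _).1 (hS.apply_mem h x w)] at h1
  simpa using h1

theorem ker_omega_onePlus {x : L} {w : TangentSpace 𝓘(ℝ, E) x} (hw : w ∈ F.ξ x) :
    (γ x + α x) (omega X α x (onePlus S x w)) = 0 := by
  have h1 : γ x (onePlus S x w) = 0 := (h.ker_γ x _).1
      ((F.ξ x).add_mem hw (hS.mem x _ hw))
  rw [add_apply, omega_apply, map_sub, map_sub, map_smul, map_smul, h.γ_X, hα, h1]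
  simp

variable {x y : L} (B : TangentSpace 𝓘(ℝ, E) y →L[ℝ] TangentSpace 𝓘(ℝ, E) x)
  (hB : B.IsInvertible) (hinv : (onePlus S x).IsInvertible)
  (hM : (addNormal γ X (transport γ X α S B.inverse)).IsInvertible)
include hB hinv hM

/-- If `B X` lay in `ξ_α`, it would be `ω_α(I + S)w` with `w ∈ ξ`. Transporting back gives `πX = 0`,
so `w = 0` by invertibility, hence `X = 0`, contrary to `γ(X) = 1`. -/
theorem apply_normal_ne_zero : (γ x + α x) (B (X y)) ≠ 0 := by
  intro h0
  obtain ⟨w, hw, hwc⟩ := exists_eq_omega_onePlus h hα hS hinv h0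
  have h1 : addNormal γ X (transport γ X α S B.inverse) w = 0 := by
    rw [addNormal_apply, (h.ker_γ x w).1 hw, zero_smul, add_zero]
    simp only [transport, ContinuousLinearMap.comp_apply]
    rw [h.omega_of_mem hw, hwc, hB.inverse_apply_self, h.omega_X]
  have h2 : w = 0 := hM.injective (h1.trans (map_zero _).symm)
  rw [h2, map_zero, map_zero] at hwc
  have h3 : X y = 0 := hB.injective (hwc.symm.trans (map_zero _).symm)
  have h4 := h.γ_X y
  rw [h3, map_zero] at h4
  exact zero_ne_one h4

variable (hN : (addNormal γ X (linPart F γ X (transport γ X α S B.inverse))).IsInvertible)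
  (hα' : ∀ x, α' x (X x) = 0)
  (hαy : α' y = ((γ x + α x) (B (X y)))⁻¹ • ((γ x + α x) ∘L B) - γ y)
  (hSy : S' y = quotEnd F γ X (transport γ X α S B.inverse))
include hN hα' hαy hSy

-- On `ξ` the map `B⁻¹` carries the frame `ω_α(I + S)` to `ω_{α'}(I + S')N`. As `N` commutes with
-- `J`, it disappears from the conjugated complex structure.
omit hB hinv in
theorem pairJ_transport (hB : B.IsInvertible) (hinv : (onePlus S x).IsInvertible)
    {c : TangentSpace 𝓘(ℝ, E) x} (hc : (γ x + α x) c = 0) :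
    pairJ F.J X α' S' y (B.inverse c) = B.inverse (pairJ F.J X α S x c) := by
  have hT := isTransverse_transport h α S B.inverse
  have hS'inv : (onePlus S' y).IsInvertible := by
    rw [onePlus, hSy]
    exact hT.id_add_quotEnd_isInvertible h hN hM
  set N := addNormal γ X (linPart F γ X (transport γ X α S B.inverse)) with hNdef
  -- Both sides lie in `ker (γ + α')`, so it is enough to compare projections to `ξ`, which is the
  -- decomposition `(I + Q N⁻¹)N = N + Q`.
  have key : ∀ w ∈ F.ξ x, B.inverse (omega X α x (onePlus S x w))
      = omega X α' y (onePlus S' y (N w)) := by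
    intro w hw
    set d := B.inverse (omega X α x (onePlus S x w)) with hd
    have hdker : (γ y + α' y) d = 0 := by
      rw [hαy, add_sub_cancel, smul_apply, ContinuousLinearMap.comp_apply, hd,
        hB.self_apply_inverse, ker_omega_onePlus h hα hS hw, smul_zero]
    rw [← omega_omega_of_mem_ker h hα' hdker, onePlus_apply, hSy, hT.id_add_quotEnd h hN,
      addNormal_apply, (h.ker_γ x w).1 hw, zero_smul, add_zero]
    simp only [transport, ContinuousLinearMap.comp_apply]
    rw [h.omega_of_mem hw]
  obtain ⟨w, hw, rfl⟩ := exists_eq_omega_onePlus h hα hS hinv hc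
  have hNw : N w ∈ F.ξ y := by
    rw [hNdef, addNormal_apply, (h.ker_γ x w).1 hw, zero_smul, add_zero]
    exact (hT.linPart h).mem w
  rw [key w hw, pairJ_apply hα' hS'inv, pairJ_apply hα hinv, key _ (F.J_mem x w hw),
    ← h.extJ_of_mem hNw, ← hT.addNormal_linPart_extJ h, h.extJ_of_mem hw]

end PointwiseGauge

/-! ### The action of a diffeomorphism on admissible pairs. -/

section GaugeAction

variable {E : Type*} [NormedAddCommGroup E] [NormedSpace ℝ E]
  {L : Type*} [TopologicalSpace L] [ChartedSpace E L] [IsManifold 𝓘(ℝ, E) ∞ L]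

variable (F : LeviFlatStructure E L) (γ : Form1 E L) (X : VField E L)

/-- The push-forward of the structure defined by `(α, S)` by a map with inverse derivative `B`
at `y` is in the domain of the parametrization by pairs. -/
structure Admissible (α : Form1 E L) (S : EndField E L) {x y : L}
    (B : TangentSpace 𝓘(ℝ, E) y →L[ℝ] TangentSpace 𝓘(ℝ, E) x) : Prop where
  inv : (addNormal γ X (transport γ X α S B.inverse)).IsInvertible
  lin : (addNormal γ X (linPart F γ X (transport γ X α S B.inverse))).IsInvertible

/-- The first component of the image of `(α, S)` by a diffeomorphism with inverse `Θ`. -/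
def gaugeForm (α : Form1 E L) (Θ : L → L) : Form1 E L := fun y =>
  (pullback Θ (γ + α) y (X y))⁻¹ • pullback Θ (γ + α) y - γ y

/-- The second component of the image of `(α, S)` by a diffeomorphism with inverse `Θ`. -/
def gaugeEnd (α : Form1 E L) (S : EndField E L) (Θ : L → L) : EndField E L := fun y =>
  quotEnd F γ X (transport γ X α S (mfderiv 𝓘(ℝ, E) 𝓘(ℝ, E) Θ y).inverse)

variable {F γ X} {α : Form1 E L} {S : EndField E L}

theorem Admissible.congr {Θ Θ' : L → L} {y : L} (h : Θ =ᶠ[𝓝 y] Θ')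
    (hΘ : Admissible F γ X α S (mfderiv 𝓘(ℝ, E) 𝓘(ℝ, E) Θ y)) :
    Admissible F γ X α S (mfderiv 𝓘(ℝ, E) 𝓘(ℝ, E) Θ' y) := by
  have key : ∀ (x x' : L) (B B' : E →L[ℝ] E), x = x' → B = B' →
      Admissible F γ X α S (x := x) (y := y) B → Admissible F γ X α S (x := x') (y := y) B' := by
    rintro x x' B B' rfl rfl h; exact h
  exact key _ _ _ _ h.self_of_nhds h.mfderiv_eq hΘ

theorem mfderiv_diffeomorph_isInvertible (Φ : L ≃ₘ^∞⟮𝓘(ℝ, E), 𝓘(ℝ, E)⟯ L) (x : L) :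
    (mfderiv 𝓘(ℝ, E) 𝓘(ℝ, E) Φ x).IsInvertible :=
  ⟨Φ.mfderivToContinuousLinearEquiv (by simp) x, rfl⟩

theorem gaugeForm_X (h : IsDefiningCouple F.ξ γ X) {Θ : L → L} {y : L}
    (h0 : pullback Θ (γ + α) y (X y) ≠ 0) : gaugeForm γ X α Θ y (X y) = 0 := by
  rw [gaugeForm, sub_apply, smul_apply, h.γ_X, smul_eq_mul, inv_mul_cancel₀ h0, sub_self]

theorem pullback_ne_zero (h : IsDefiningCouple F.ξ γ X) (hα : ∀ x, α x (X x) = 0)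
    (hS : IsAntilinear F X S) (hinv : ∀ x, (onePlus S x).IsInvertible)
    {Θ : L → L} {y : L} (hΘ : (mfderiv 𝓘(ℝ, E) 𝓘(ℝ, E) Θ y).IsInvertible)
    (had : Admissible F γ X α S (mfderiv 𝓘(ℝ, E) 𝓘(ℝ, E) Θ y)) :
    pullback Θ (γ + α) y (X y) ≠ 0 :=
  apply_normal_ne_zero h hα hS _ hΘ (hinv _) had.inv

theorem isAntilinear_gaugeEnd (h : IsDefiningCouple F.ξ γ X) {Θ : L → L}
    (had : ∀ y, Admissible F γ X α S (mfderiv 𝓘(ℝ, E) 𝓘(ℝ, E) Θ y)) :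
    IsAntilinear F X (gaugeEnd F γ X α S Θ) := by
  refine ⟨fun y => ?_, fun y v _ => ?_, fun y v hv => ?_⟩
  · exact (isTransverse_transport h α S _).quotEnd_X h (had y).lin
  · exact (isTransverse_transport h α S _).quotEnd_mem h v
  · exact (isTransverse_transport h α S _).quotEnd_anticomm h (had y).lin hv

theorem gaugeRel_of_admissible (h : IsDefiningCouple F.ξ γ X) (hα : ∀ x, α x (X x) = 0)
    (hS : IsAntilinear F X S) (hinv : ∀ x, (onePlus S x).IsInvertible)
    (Φ : L ≃ₘ^∞⟮𝓘(ℝ, E), 𝓘(ℝ, E)⟯ L)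
    (had : ∀ y, Admissible F γ X α S (mfderiv 𝓘(ℝ, E) 𝓘(ℝ, E) Φ.symm y)) :
    GaugeRel F γ X Φ α S (gaugeForm γ X α Φ.symm) (gaugeEnd F γ X α S Φ.symm) := by
  have hne := fun y => pullback_ne_zero h hα hS hinv (mfderiv_diffeomorph_isInvertible Φ.symm y)
    (had y)
  refine ⟨hne, fun y => rfl, hinv, fun y =>
    (isTransverse_transport h α S _).id_add_quotEnd_isInvertible h (had y).lin (had y).inv,
    fun x c hc => ?_⟩
  -- The differential of `Φ⁻¹` lands in the fibre at `Φ⁻¹(Φ x)`; the base point is made a variable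
  -- before being identified with `x`.
  have key : ∀ (x' : L) (B : TangentSpace 𝓘(ℝ, E) (Φ x) →L[ℝ] TangentSpace 𝓘(ℝ, E) x')
      (α' : Form1 E L) (S' : EndField E L), x' = x → B.IsInvertible →
      (∀ v : E, (B (mfderiv 𝓘(ℝ, E) 𝓘(ℝ, E) Φ x v : E) : E) = v) →
      (∀ c', (γ x' + α x') c' = 0 → pairJ F.J X α' S' (Φ x) (B.inverse c')
        = B.inverse (pairJ F.J X α S x' c')) →
      pairJ F.J X α' S' (Φ x) (mfderiv 𝓘(ℝ, E) 𝓘(ℝ, E) Φ x c)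
        = mfderiv 𝓘(ℝ, E) 𝓘(ℝ, E) Φ x (pairJ F.J X α S x c) := by
    rintro x' B α' S' rfl hB hBv hp
    have h1 : ∀ v, mfderiv 𝓘(ℝ, E) 𝓘(ℝ, E) Φ x' v = B.inverse v := fun v =>
      (hB.inverse_apply_eq.2 (hBv v).symm).symm
    rw [h1, h1]
    exact hp c hc
  exact key _ (mfderiv 𝓘(ℝ, E) 𝓘(ℝ, E) Φ.symm (Φ x)) _ _ (Φ.symm_apply_apply x)
    (mfderiv_diffeomorph_isInvertible Φ.symm _) (fun v => mfderiv_symm_mfderiv Φ x v)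
    fun c' hc' => pairJ_transport h hα hS _ (had (Φ x)).inv (had (Φ x)).lin
      (fun y => gaugeForm_X h (hne y)) rfl rfl (mfderiv_diffeomorph_isInvertible Φ.symm _)
      (hinv _) hc'

theorem pullback_id (η : Form1 E L) : pullback id η = η := by
  funext y
  ext v
  have : (mfderiv 𝓘(ℝ, E) 𝓘(ℝ, E) (id : L → L) y) v = v := by rw [mfderiv_id]; rfl
  exact congrArg (η y) this

theorem gaugeForm_id (h : IsDefiningCouple F.ξ γ X) : gaugeForm γ X 0 id = 0 := by
  funext y
  rw [gaugeForm, pullback_id, add_zero, h.γ_X, inv_one, one_smul, sub_self]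
  rfl

theorem isAntilinear_zero : IsAntilinear F X (0 : EndField E L) :=
  ⟨fun _ => rfl, fun x _ _ => (F.ξ x).zero_mem, fun x v _ => by simp⟩

theorem IsAntilinear.apply_omega (hS : IsAntilinear F X S) (x : L) (v : TangentSpace 𝓘(ℝ, E) x) :
    S x (omega X γ x v) = S x v := by
  rw [omega_apply, map_sub, map_smul, hS.apply_X, smul_zero, sub_zero]

theorem transport_id (h : IsDefiningCouple F.ξ γ X) (hS : IsAntilinear F X S) {x : L}
    {B : TangentSpace 𝓘(ℝ, E) x →L[ℝ] TangentSpace 𝓘(ℝ, E) x}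
    (hB : B = ContinuousLinearMap.id ℝ _) :
    transport γ X α S B.inverse = omega X γ x + S x := by
  subst hB
  ext v
  have h1 : ∀ u, omega X γ x (omega X α x u) = omega X γ x u := fun u => by
    rw [omega_apply (α := α), map_sub, map_smul, h.omega_X, smul_zero, sub_zero]
  simp only [transport, ContinuousLinearMap.inverse_id, ContinuousLinearMap.comp_apply,
    ContinuousLinearMap.id_apply, h1, onePlus_apply, map_add, h.omega_of_mem (h.omega_mem x _),
    hS.apply_omega, h.omega_of_mem (hS.apply_mem h x _), add_apply]

/-- `J π J = -π` and `J S J = S`. Thus `π` and `S` are the linear and antilinear parts of `π + S`,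
the transport map of the identity. -/
theorem extJ_omega_add_extJ (h : IsDefiningCouple F.ξ γ X) (hS : IsAntilinear F X S) (x : L)
    (v : TangentSpace 𝓘(ℝ, E) x) :
    extJ F γ X x ((omega X γ x + S x) (extJ F γ X x v)) = S x v - omega X γ x v := by
  have h1 : S x (extJ F γ X x v) = -extJ F γ X x (S x v) := by
    rw [h.extJ_of_mem (hS.apply_mem h x v), ← hS.apply_omega (γ := γ) x v]
    exact hS.anticomm x _ (h.omega_mem x v)
  rw [add_apply, h.omega_extJ, h1, map_add, map_neg, h.extJ_extJ, h.extJ_extJ,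
    h.omega_of_mem (hS.apply_mem h x _)]
  abel

theorem antiPart_omega_add (h : IsDefiningCouple F.ξ γ X) (hS : IsAntilinear F X S) (x : L) :
    antiPart F γ X (omega X γ x + S x) = S x := by
  ext v
  rw [antiPart_apply, extJ_omega_add_extJ h hS, add_apply]
  module

theorem linPart_omega_add (h : IsDefiningCouple F.ξ γ X) (hS : IsAntilinear F X S) (x : L) :
    linPart F γ X (omega X γ x + S x) = omega X γ x := by
  ext v
  rw [linPart_apply, extJ_omega_add_extJ h hS, add_apply]
  module

theorem addNormal_omega_add (x : L) :
    addNormal γ X (omega X γ x + S x) = onePlus S x := by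
  ext v
  rw [addNormal_apply, onePlus_apply, add_apply, omega_apply]
  module

theorem addNormal_omega (x : L) :
    addNormal γ X (omega X γ x) = ContinuousLinearMap.id ℝ _ := by
  ext v
  rw [addNormal_apply, omega_apply]
  simp

theorem isInvertible_id (x : L) :
    (ContinuousLinearMap.id ℝ (TangentSpace 𝓘(ℝ, E) x)).IsInvertible :=
  ⟨ContinuousLinearEquiv.refl ℝ _, rfl⟩

theorem gaugeEnd_id (h : IsDefiningCouple F.ξ γ X) (hS : S = 0) (y : L) :
    gaugeEnd F γ X α S id y = 0 := by
  subst hS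
  have h1 := transport_id (x := y) (α := α) h (isAntilinear_zero (F := F))
    (B := mfderiv 𝓘(ℝ, E) 𝓘(ℝ, E) (id : L → L) y) mfderiv_id
  have h2 : gaugeEnd F γ X α 0 id y = quotEnd F γ X (omega X γ y + (0 : EndField E L) y) :=
    congrArg _ h1
  rw [h2, quotEnd, antiPart_omega_add h isAntilinear_zero]
  exact ContinuousLinearMap.zero_comp _

/-- For the identity map the two operators required to be invertible are `I + S` and `I`. This
starts the construction of isotopies. -/
theorem admissible_id (h : IsDefiningCouple F.ξ γ X) (hS : IsAntilinear F X S)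
    (hinv : ∀ x, (onePlus S x).IsInvertible) (y : L) :
    Admissible F γ X α S (mfderiv 𝓘(ℝ, E) 𝓘(ℝ, E) (id : L → L) y) := by
  have h1 := transport_id (x := y) (α := α) h hS
    (B := mfderiv 𝓘(ℝ, E) 𝓘(ℝ, E) (id : L → L) y) mfderiv_id
  have h2 : Admissible F γ X α S (x := y) (mfderiv 𝓘(ℝ, E) 𝓘(ℝ, E) (id : L → L) y) := by
    constructor
    · rw [h1, addNormal_omega_add]; exact hinv y
    · rw [h1, linPart_omega_add h hS, addNormal_omega]; exact isInvertible_id y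
  exact h2

end GaugeAction

/-! ### Smooth dependence on parameters, and openness of admissibility. -/

section GaugeSmooth

variable {E : Type*} [NormedAddCommGroup E] [NormedSpace ℝ E] [FiniteDimensional ℝ E]
  {L : Type*} [TopologicalSpace L] [T2Space L] [ChartedSpace E L] [IsManifold 𝓘(ℝ, E) ∞ L]

theorem smooth_transport_parts {EN : Type*} [NormedAddCommGroup EN] [NormedSpace ℝ EN]
    {HN : Type*} [TopologicalSpace HN] {N : Type*} [TopologicalSpace N] [ChartedSpace HN N]
    {IN : ModelWithCorners ℝ EN HN}
    {F : LeviFlatStructure E L} {γ : Form1 E L} {X : VField E L}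
    (h : IsDefiningCouple F.ξ γ X) {f g : N → L} {p₀ : N}
    {A : (p : N) → TangentSpace 𝓘(ℝ, E) (f p) →L[ℝ] TangentSpace 𝓘(ℝ, E) (g p)}
    (hA : HomSmoothAt IN f g A p₀) (hf : ContMDiffAt IN 𝓘(ℝ, E) ∞ f p₀)
    (hg : ContMDiffAt IN 𝓘(ℝ, E) ∞ g p₀) :
    HomSmoothAt IN f g (fun p => addNormal γ X (A p)) p₀ ∧
    HomSmoothAt IN f g (fun p => linPart F γ X (A p)) p₀ ∧
    HomSmoothAt IN f g (fun p => antiPart F γ X (A p)) p₀ := by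
  have hJ := h.smoothEnd_extJ
  have hJA : HomSmoothAt IN f g (fun p => extJ F γ X (g p) ∘L A p ∘L extJ F γ X (f p)) p₀ :=
    HomSmoothAt.comp
      (HomSmoothAt.comp_map (A := extJ F γ X) (f := fun x => x) (g := fun x => x)
        (hJ.homSmoothAt (g p₀)) hg)
      (hA.comp (HomSmoothAt.comp_map (A := extJ F γ X) (f := fun x => x) (g := fun x => x)
        (hJ.homSmoothAt (f p₀)) hf) hf.continuousAt) hg.continuousAt
  refine ⟨hA.add (HomSmoothAt.smulRight ?_ ?_), (hA.sub hJA).const_smul _,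
    (hA.add hJA).const_smul _⟩
  · exact CovSmoothAt.comp_map (η := γ) (g := fun x => x) (h.smooth_γ.covSmoothAt (f p₀)) hf
  · exact VecSmoothAt.comp_map (V := X) (g := fun x => x) (h.smooth_X.vecSmoothAt (g p₀)) hg

variable {F : LeviFlatStructure E L} {γ : Form1 E L} {X : VField E L}
  (h : IsDefiningCouple F.ξ γ X) {I : Set ℝ} (hI : IsOpen I)
  {α : ℝ → Form1 E L} {S : ℝ → EndField E L} (hc : IsPairCurve F X I α S)
  {EN : Type*} [NormedAddCommGroup EN] [NormedSpace ℝ EN] {HN : Type*} [TopologicalSpace HN]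
  {N : Type*} [TopologicalSpace N] [ChartedSpace HN N] {IN : ModelWithCorners ℝ EN HN}
  [IsManifold IN ∞ N]
  {p₀ : N} {τ : N → ℝ} {y : N → L} {Θ : N → L → L}
  (hτ : ContMDiffAt IN 𝓘(ℝ, ℝ) ∞ τ p₀) (hτI : τ p₀ ∈ I) (hy : ContMDiffAt IN 𝓘(ℝ, E) ∞ y p₀)
  (hΘ : ContMDiffAt (IN.prod 𝓘(ℝ, E)) 𝓘(ℝ, E) ∞ (Function.uncurry Θ) (p₀, y p₀))

include hΘ hy in
theorem contMDiffAt_apply_param : ContMDiffAt IN 𝓘(ℝ, E) ∞ (fun p => Θ p (y p)) p₀ :=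
  ContMDiffAt.comp_of_eq hΘ (contMDiffAt_id.prodMk hy) rfl

include h hI hc hτ hτI hy hΘ

theorem covSmoothAt_form_param : CovSmoothAt IN (fun p => Θ p (y p))
    (fun p => γ (Θ p (y p)) + α (τ p) (Θ p (y p))) p₀ := by
  have hf := contMDiffAt_apply_param hy hΘ
  refine CovSmoothAt.add ?_ ?_
  · exact CovSmoothAt.comp_map (η := γ) (g := fun x => x) (h.smooth_γ.covSmoothAt _) hf
  · exact CovSmoothAt.comp_map (η := fun q : ℝ × L => α q.1 q.2) (g := fun q : ℝ × L => q.2)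
      (k := fun p => (τ p, Θ p (y p))) ((smoothFormFamily_iff hI).1 hc.smooth_α _ hτI _)
      (hτ.prodMk hf)

theorem covSmoothAt_pullback_param : CovSmoothAt IN y
    (fun p => pullback (Θ p) (γ + α (τ p)) (y p)) p₀ :=
  (covSmoothAt_form_param h hI hc hτ hτI hy hΘ).comp (HomSmoothAt.mfderiv hΘ hy)
    (contMDiffAt_apply_param hy hΘ).continuousAt

theorem covSmoothAt_gaugeForm_param
    (hne : pullback (Θ p₀) (γ + α (τ p₀)) (y p₀) (X (y p₀)) ≠ 0) :
    CovSmoothAt IN y (fun p => gaugeForm γ X (α (τ p)) (Θ p) (y p)) p₀ := by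
  have h1 := covSmoothAt_pullback_param h hI hc hτ hτI hy hΘ
  have h2 : VecSmoothAt IN y (fun p => X (y p)) p₀ :=
    VecSmoothAt.comp_map (V := X) (g := fun x => x) (h.smooth_X.vecSmoothAt (y p₀)) hy
  have h3 := (h1.apply h2 hy.continuousAt).inv₀ hne
  exact (h1.smul h3).sub
    (CovSmoothAt.comp_map (η := γ) (g := fun x => x) (h.smooth_γ.covSmoothAt _) hy)

variable (hinv : (mfderiv 𝓘(ℝ, E) 𝓘(ℝ, E) (Θ p₀) (y p₀)).IsInvertible)
include hinv

theorem homSmoothAt_transport_param : HomSmoothAt IN (fun p => Θ p (y p)) y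
    (fun p => transport γ X (α (τ p)) (S (τ p))
      (mfderiv 𝓘(ℝ, E) 𝓘(ℝ, E) (Θ p) (y p)).inverse) p₀ := by
  have := FiniteDimensional.complete ℝ E
  have hf := contMDiffAt_apply_param hy hΘ
  have hB := (HomSmoothAt.mfderiv hΘ hy).inverse hy.continuousAt hf.continuousAt hinv
  have hπ := smoothEnd_omega h.smooth_X h.smooth_γ
  have hXf : VecSmoothAt IN (fun p => Θ p (y p)) (fun p => X (Θ p (y p))) p₀ :=
    VecSmoothAt.comp_map (V := X) (g := fun x => x) (h.smooth_X.vecSmoothAt _) hf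
  have hα : CovSmoothAt IN (fun p => Θ p (y p)) (fun p => α (τ p) (Θ p (y p))) p₀ :=
    CovSmoothAt.comp_map (η := fun q : ℝ × L => α q.1 q.2) (g := fun q : ℝ × L => q.2)
      (k := fun p => (τ p, Θ p (y p))) ((smoothFormFamily_iff hI).1 hc.smooth_α _ hτI _)
      (hτ.prodMk hf)
  have hS : HomSmoothAt IN (fun p => Θ p (y p)) (fun p => Θ p (y p))
      (fun p => S (τ p) (Θ p (y p))) p₀ :=
    HomSmoothAt.comp_map (A := fun q : ℝ × L => S q.1 q.2) (f := fun q : ℝ × L => q.2)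
      (g := fun q : ℝ × L => q.2)
      (k := fun p => (τ p, Θ p (y p))) ((smoothEndFamily_iff hI).1 hc.smooth_S _ hτI _)
      (hτ.prodMk hf)
  have hid := HomSmoothAt.id (IN := IN) (E := E) hf.continuousAt
  have h1 : HomSmoothAt IN (fun p => Θ p (y p)) (fun p => Θ p (y p))
      (fun p => omega X γ (Θ p (y p))) p₀ :=
    HomSmoothAt.comp_map (A := omega X γ) (f := fun x => x) (g := fun x => x)
        (hπ.homSmoothAt _) hf
  have h2 : HomSmoothAt IN (fun p => Θ p (y p)) (fun p => Θ p (y p))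
      (fun p => onePlus (S (τ p)) (Θ p (y p))) p₀ := hid.add hS
  have h3 : HomSmoothAt IN (fun p => Θ p (y p)) (fun p => Θ p (y p))
      (fun p => omega X (α (τ p)) (Θ p (y p))) p₀ := hid.sub (HomSmoothAt.smulRight hα hXf)
  have h4 : HomSmoothAt IN y y (fun p => omega X γ (y p)) p₀ :=
    HomSmoothAt.comp_map (A := omega X γ) (f := fun x => x) (g := fun x => x)
        (hπ.homSmoothAt _) hy
  exact h4.comp (hB.comp (h3.comp (h2.comp h1 hf.continuousAt) hf.continuousAt) hf.continuousAt)
    hy.continuousAt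

/-- Both operators depend smoothly on the parameters and invertibility is open. The parameter
manifold is left general because it is `ℝ × L` for a curve of pairs, and `ℝ × (ℝ × L)` when a second
time variable is added. -/
theorem eventually_admissible_param
    (had : Admissible F γ X (α (τ p₀)) (S (τ p₀)) (mfderiv 𝓘(ℝ, E) 𝓘(ℝ, E) (Θ p₀) (y p₀))) :
    ∀ᶠ p in 𝓝 p₀, Admissible F γ X (α (τ p)) (S (τ p))
      (mfderiv 𝓘(ℝ, E) 𝓘(ℝ, E) (Θ p) (y p)) := by
  have := FiniteDimensional.complete ℝ E
  have hf := contMDiffAt_apply_param hy hΘ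
  have hT := homSmoothAt_transport_param h hI hc hτ hτI hy hΘ hinv
  have h1 := (smooth_transport_parts h hT hf hy).1
  have h2 := (smooth_transport_parts h (smooth_transport_parts h hT hf hy).2.1 hf hy).1
  filter_upwards [h1.eventually_isInvertible hf.continuousAt hy.continuousAt had.inv,
    h2.eventually_isInvertible hf.continuousAt hy.continuousAt had.lin] with p hp1 hp2
  exact ⟨hp1, hp2⟩

theorem homSmoothAt_gaugeEnd_param
    (had : Admissible F γ X (α (τ p₀)) (S (τ p₀)) (mfderiv 𝓘(ℝ, E) 𝓘(ℝ, E) (Θ p₀) (y p₀))) :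
    HomSmoothAt IN y y (fun p => gaugeEnd F γ X (α (τ p)) (S (τ p)) (Θ p) (y p)) p₀ := by
  have := FiniteDimensional.complete ℝ E
  have hf := contMDiffAt_apply_param hy hΘ
  have hT := homSmoothAt_transport_param h hI hc hτ hτI hy hΘ hinv
  have h1 := (smooth_transport_parts h hT hf hy).2.2
  have h2 := (smooth_transport_parts h (smooth_transport_parts h hT hf hy).2.1 hf hy).1
  exact h1.comp (h2.inverse hf.continuousAt hy.continuousAt had.lin) hf.continuousAt

end GaugeSmooth

/-! ### Tangent vectors of moved curves. -/

section Isotopies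

variable {E : Type*} [NormedAddCommGroup E] [NormedSpace ℝ E]
  {L : Type*} [TopologicalSpace L] [ChartedSpace E L] [IsManifold 𝓘(ℝ, E) ∞ L]

/-- Smooth families `(Φ_t)_{t ∈ J}` of diffeomorphisms, with smooth inverse and `Φ_0 = id`. -/
structure IsIsotopy (J : Set ℝ) (Φ : ℝ → (L ≃ₘ^∞⟮𝓘(ℝ, E), 𝓘(ℝ, E)⟯ L)) : Prop where
  smooth : ∀ t ∈ J, ∀ x, ContMDiffAt (𝓘(ℝ, ℝ).prod 𝓘(ℝ, E)) 𝓘(ℝ, E) ∞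
    (fun p : ℝ × L => Φ p.1 p.2) (t, x)
  smooth_symm : ∀ t ∈ J, ∀ x, ContMDiffAt (𝓘(ℝ, ℝ).prod 𝓘(ℝ, E)) 𝓘(ℝ, E) ∞
    (fun p : ℝ × L => (Φ p.1).symm p.2) (t, x)
  zero : ∀ x, Φ 0 x = x

theorem IsIsotopy.symm_zero {J : Set ℝ} {Φ : ℝ → (L ≃ₘ^∞⟮𝓘(ℝ, E), 𝓘(ℝ, E)⟯ L)}
    (h : IsIsotopy J Φ) : ⇑(Φ 0).symm = id := by
  funext x
  conv_lhs => rw [← h.zero x]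
  exact (Φ 0).symm_apply_apply x

theorem IsIsotopy.smooth_symm_param {J : Set ℝ} {Φ : ℝ → (L ≃ₘ^∞⟮𝓘(ℝ, E), 𝓘(ℝ, E)⟯ L)}
    (h : IsIsotopy J Φ) {t : ℝ} (ht : t ∈ J) (x y : L) :
    ContMDiffAt ((𝓘(ℝ, ℝ).prod 𝓘(ℝ, E)).prod 𝓘(ℝ, E)) 𝓘(ℝ, E) ∞
      (Function.uncurry fun (p : ℝ × L) => (Φ p.1).symm) ((t, x), y) :=
  ContMDiffAt.comp_of_eq (f := fun q : (ℝ × L) × L => (q.1.1, q.2)) (h.smooth_symm t ht y)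
    ((contMDiff_fst.fst.prodMk contMDiff_snd).contMDiffAt) rfl

variable {F : LeviFlatStructure E L} {γ : Form1 E L} {X : VField E L} {I J : Set ℝ}
  {α : ℝ → Form1 E L} {S : ℝ → EndField E L} {β β' : Form1 E L} {P P' : EndField E L}
  {Φ : ℝ → (L ≃ₘ^∞⟮𝓘(ℝ, E), 𝓘(ℝ, E)⟯ L)} {Y : VField E L}

theorem IsPairCurve.mono (hc : IsPairCurve F X I α S) (hJ : J ⊆ I) : IsPairCurve F X J α S where
  smooth_α := ContMDiffOn.mono hc.smooth_α (prod_mono_left hJ)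
  smooth_S := ContMDiffOn.mono hc.smooth_S (prod_mono_left hJ)
  ι_X t ht := hc.ι_X t (hJ ht)
  antilinear t ht := hc.antilinear t (hJ ht)
  α_zero := hc.α_zero
  S_zero := hc.S_zero

variable [FiniteDimensional ℝ E] [T2Space L]

theorem isPairCurve_gauge (h : IsDefiningCouple F.ξ γ X) (hJ : IsOpen J)
    (hc : IsPairCurve F X J α S) (hinv : ∀ t ∈ J, ∀ x, (onePlus (S t) x).IsInvertible)
    (hΦ : IsIsotopy J Φ) (had : ∀ t ∈ J, ∀ y, Admissible F γ X (α t) (S t)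
      (mfderiv 𝓘(ℝ, E) 𝓘(ℝ, E) (Φ t).symm y)) :
    IsPairCurve F X J (fun t => gaugeForm γ X (α t) (Φ t).symm)
      (fun t => gaugeEnd F γ X (α t) (S t) (Φ t).symm) := by
  have hne := fun t ht y => pullback_ne_zero h (hc.ι_X t ht) (hc.antilinear t ht) (hinv t ht)
    (mfderiv_diffeomorph_isInvertible (Φ t).symm y) (had t ht y)
  have hα0 : α 0 = 0 := funext hc.α_zero
  have hS0 : S 0 = 0 := funext hc.S_zero
  refine ⟨(smoothFormFamily_iff hJ).2 fun t ht x => ?_, (smoothEndFamily_iff hJ).2 fun t ht x => ?_,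
    fun t ht y => gaugeForm_X h (hne t ht y), fun t ht => isAntilinear_gaugeEnd h (had t ht),
    fun x => ?_, fun x => ?_⟩
  · exact covSmoothAt_gaugeForm_param h hJ hc (p₀ := (t, x)) (τ := fun p : ℝ × L => p.1)
      (y := fun p : ℝ × L => p.2) (Θ := fun p : ℝ × L => (Φ p.1).symm) contMDiffAt_fst ht
      contMDiffAt_snd (hΦ.smooth_symm_param ht x x) (hne t ht x)
  · exact homSmoothAt_gaugeEnd_param h hJ hc (p₀ := (t, x)) (τ := fun p : ℝ × L => p.1)
      (y := fun p : ℝ × L => p.2) (Θ := fun p : ℝ × L => (Φ p.1).symm) contMDiffAt_fst ht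
      contMDiffAt_snd (hΦ.smooth_symm_param ht x x)
      (mfderiv_diffeomorph_isInvertible (Φ t).symm x) (had t ht x)
  · simp only [hΦ.symm_zero, hα0]
    rw [gaugeForm_id h]; rfl
  · simp only [hΦ.symm_zero]
    exact gaugeEnd_id h hS0 x

/-- Every smooth curve of pairs has a tangent vector at the origin. -/
theorem IsPairCurve.exists_hasTangent (hJ : IsOpen J) (h0 : (0 : ℝ) ∈ J)
    (hc : IsPairCurve F X J α S) : ∃ β P, HasTangent α S β P := by
  have hc1 : ∀ x : L, DifferentiableAt ℝ (fun t : ℝ => (t, ctr (E := E) x)) 0 :=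
    fun x => by fun_prop
  have h1 : ∀ x, DifferentiableAt ℝ (fun t => fr x (α t) (ctr x)) 0 := fun x =>
    ((hc.contDiffAt_form hJ h0 x).differentiableAt (by simp)).comp
      (f := fun t : ℝ => (t, ctr (E := E) x)) (0 : ℝ) (hc1 x)
  have h2 : ∀ x, DifferentiableAt ℝ (fun t => er x (S t) (ctr x)) 0 := fun x =>
    ((hc.contDiffAt_endo hJ h0 x).differentiableAt (by simp)).comp
      (f := fun t : ℝ => (t, ctr (E := E) x)) (0 : ℝ) (hc1 x)
  have h3 : ∀ (x : L) (v : E), Tendsto (fun t : ℝ => t⁻¹ • fr x (α t) (ctr x) v) (𝓝[≠] 0)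
      (𝓝 (deriv (fun t => fr x (α t) (ctr x)) 0 v)) := by
    intro x v
    refine tendsto_inv_smul_of_hasDerivAt (by simp [hc.fr_zero]) ?_
    have h3 := (h1 x).hasDerivAt.clm_apply (hasDerivAt_const (0 : ℝ) v)
    simpa only [map_zero, add_zero] using h3
  have h4 : ∀ (x : L) (v : E), Tendsto (fun t : ℝ => t⁻¹ • er x (S t) (ctr x) v) (𝓝[≠] 0)
      (𝓝 (deriv (fun t => er x (S t) (ctr x)) 0 v)) := by
    intro x v
    refine tendsto_inv_smul_of_hasDerivAt (by simp [hc.er_zero]) ?_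
    have h3 := (h2 x).hasDerivAt.clm_apply (hasDerivAt_const (0 : ℝ) v)
    simpa only [map_zero, add_zero] using h3
  simp only [fr_ctr] at h3
  simp only [er_ctr] at h4
  let b : L → E →L[ℝ] ℝ := fun x => deriv (fun t => fr x (α t) (ctr x)) 0
  let p : L → E →L[ℝ] E := fun x => deriv (fun t => er x (S t) (ctr x)) 0
  exact ⟨b, p, h3, h4⟩

theorem HasTangent.form_X (hJ : J ∈ 𝓝 (0 : ℝ)) (hc : IsPairCurve F X J α S)
    (ht : HasTangent α S β P) (x : L) : β x (X x) = 0 := by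
  refine tendsto_nhds_unique (ht.form x (X x)) (tendsto_const_nhds.congr' ?_)
  filter_upwards [mem_nhdsWithin_of_mem_nhds hJ] with t ht'
  rw [hc.ι_X t ht', smul_zero]

theorem HasTangent.endo_X (hJ : J ∈ 𝓝 (0 : ℝ)) (hc : IsPairCurve F X J α S)
    (ht : HasTangent α S β P) (x : L) : P x (X x) = 0 := by
  refine tendsto_nhds_unique (X := E) (ht.endo x (X x)) (tendsto_const_nhds.congr' ?_)
  filter_upwards [mem_nhdsWithin_of_mem_nhds hJ] with t ht'
  rw [(hc.antilinear t ht').apply_X, smul_zero]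

theorem differByField_of_gauge (hγX : IsDefiningCouple F.ξ γ X) (hJ : IsOpen J)
    (h0 : (0 : ℝ) ∈ J) {α' : ℝ → Form1 E L} {S' : ℝ → EndField E L}
    (hc : IsPairCurve F X J α S) (hc' : IsPairCurve F X J α' S') (ht : HasTangent α S β P)
    (ht' : HasTangent α' S' β' P') (hP : IsForm01 F X P)
    (hΦ : ∀ x, ContMDiffAt (𝓘(ℝ, ℝ).prod 𝓘(ℝ, E)) 𝓘(ℝ, E) ∞ (fun p : ℝ × L => Φ p.1 p.2) (0, x))
    (hΦ0 : ∀ x, Φ 0 x = x) (hY : SmoothVF Y) (hv : HasVelocity (fun t => Φ t) Y)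
    (hG : ∀ t ∈ J, GaugeRel F γ X (Φ t) (α t) (S t) (α' t) (S' t)) :
    DifferByField F γ X β P β' P' Y :=
  ⟨fun _ hV x => differ_form hγX hJ h0 hc hc' ht ht' (ht'.form_X (hJ.mem_nhds h0) hc') hΦ hΦ0 hY hv
      hG hV x,
    fun _ hV hVt x => differ_endo hγX hJ h0 hc hc' ht ht' hP hΦ hΦ0 hv hG hV hVt x⟩

/-- Smooth fields pass through every vector, so `Y` fixes `β'` everywhere and `P'` on `ξ`; vanishing
on `X` fixes the rest of `P'`. -/
theorem DifferByField.unique (hγX : IsDefiningCouple F.ξ γ X) {β'' : Form1 E L}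
    {P'' : EndField E L} (h : DifferByField F γ X β P β' P' Y)
    (h' : DifferByField F γ X β P β'' P'' Y) (hX : ∀ x, P' x (X x) = 0)
    (hX' : ∀ x, P'' x (X x) = 0) : β'' = β' ∧ P'' = P' := by
  constructor
  · funext x
    ext v
    obtain ⟨V, hV, rfl⟩ := exists_smoothVF_eq x v
    have := (h.form V hV x).trans (h'.form V hV x).symm
    linarith
  · funext x
    have h1 : ∀ v ∈ F.ξ x, P'' x v = P' x v := by
      intro v hv
      obtain ⟨V, hV, hVt, rfl⟩ := F.smooth_ξ x v hv
      have := (h.endo V hV hVt x).trans (h'.endo V hV hVt x).symm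
      exact (sub_right_inj.1 this).symm
    ext v
    have h2 : v = omega X γ x v + γ x v • X x := by rw [omega_apply]; abel
    rw [h2, map_add, map_add, map_smul, map_smul, hX, hX', h1 _ (hγX.omega_mem x v)]

/-- The moved curve has some tangent vector by smoothness. The necessity half relates it to `(β, P)`
through the same `Y`, and uniqueness identifies it with `(β', P')`. -/
theorem movesTo_of_isotopy (hγX : IsDefiningCouple F.ξ γ X) {ε : ℝ} (hε : 0 < ε)
    (hεI : Ioo (-ε) ε ⊆ I) (hc : IsPairCurve F X I α S)
    (hinv : ∀ t ∈ I, ∀ x, (onePlus (S t) x).IsInvertible) (ht : HasTangent α S β P)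
    (hP : IsForm01 F X P) (hP' : IsForm01 F X P') (hY : SmoothVF Y)
    (hd : DifferByField F γ X β P β' P' Y)
    (hΦ : IsIsotopy (Ioo (-ε) ε) Φ) (hv : HasVelocity (fun t => Φ t) Y)
    (had : ∀ t ∈ Ioo (-ε) ε, ∀ y, Admissible F γ X (α t) (S t)
      (mfderiv 𝓘(ℝ, E) 𝓘(ℝ, E) (Φ t).symm y)) :
    MovesTo F γ X I α S β' P' := by
  have h0 : (0 : ℝ) ∈ Ioo (-ε) ε := ⟨neg_lt_zero.2 hε, hε⟩
  have hcε := hc.mono hεI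
  have hc' := isPairCurve_gauge hγX isOpen_Ioo hcε (fun t ht => hinv t (hεI ht)) hΦ had
  have hG : ∀ t ∈ Ioo (-ε) ε, GaugeRel F γ X (Φ t) (α t) (S t)
      (gaugeForm γ X (α t) (Φ t).symm) (gaugeEnd F γ X (α t) (S t) (Φ t).symm) := fun t ht =>
    gaugeRel_of_admissible hγX (hcε.ι_X t ht) (hcε.antilinear t ht) (hinv t (hεI ht)) (Φ t)
      (had t ht)
  obtain ⟨β'', P'', ht''⟩ := hc'.exists_hasTangent isOpen_Ioo h0
  have hd' := differByField_of_gauge hγX isOpen_Ioo h0 hcε hc' ht ht'' hP (hΦ.smooth 0 h0)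
    hΦ.zero hY hv hG
  obtain ⟨rfl, rfl⟩ := hd.unique hγX hd' hP'.antilinear.apply_X
    (ht''.endo_X (isOpen_Ioo.mem_nhds h0) hc')
  exact ⟨ε, hε, hεI, Φ, (contMDiffOn_prod_univ_iff isOpen_Ioo).2 hΦ.smooth, hΦ.zero, _, _, hc',
    hG, ht''⟩

theorem MovesTo.exists_differByField (hγX : IsDefiningCouple F.ξ γ X)
    (hc : IsPairCurve F X I α S) (ht : HasTangent α S β P) (hP : IsForm01 F X P)
    (hm : MovesTo F γ X I α S β' P') :
    ∃ Y : VField E L, SmoothVF Y ∧ DifferByField F γ X β P β' P' Y := by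
  obtain ⟨ε, hε, hεI, Φ, hΦ, hΦ0, α', S', hc', hG, ht'⟩ := hm
  have h0 : (0 : ℝ) ∈ Ioo (-ε) ε := ⟨neg_lt_zero.2 hε, hε⟩
  have hs := (contMDiffOn_prod_univ_iff isOpen_Ioo).1 hΦ 0 h0
  obtain ⟨Y, hY, hv⟩ := exists_hasVelocity (Φ := fun t => Φ t) hΦ0 hs
  exact ⟨Y, hY, differByField_of_gauge hγX isOpen_Ioo h0 (hc.mono hεI) hc' ht ht' hP hs hΦ0 hY hv
    hG⟩

end Isotopies

/-! ### Perturbations of the identity in the model space. -/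

section EuclideanFlow

variable {E : Type*} [NormedAddCommGroup E] [NormedSpace ℝ E] [FiniteDimensional ℝ E]

/-- Small perturbations of the identity by a compactly supported map. -/
theorem exists_perturbation {v : E → E} (hv : ContDiff ℝ ∞ v) (hs : HasCompactSupport v) :
    ∃ r : ℝ, 0 < r ∧ ∀ s : ℝ, |s| < r → Function.Bijective (fun z => z + s • v z) ∧
      ∀ z, Function.Injective (ContinuousLinearMap.id ℝ E + s • fderiv ℝ v z) := by
  have := FiniteDimensional.complete ℝ E
  obtain ⟨C, hC⟩ := hv.lipschitzWith_of_hasCompactSupport hs (by simp)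
  -- With `C` a Lipschitz constant of `v`, this radius makes `s • v` a strict contraction; the `1`
  -- covers `C = 0`.
  refine ⟨1 / (C + 1), by positivity, fun s hs' => ?_⟩
  have hsC : |s| * C < 1 := by
    rw [lt_div_iff₀ (by positivity)] at hs'
    nlinarith [abs_nonneg s, C.2]
  have hlt : ∀ z z', ‖s • v z - s • v z'‖ ≤ |s| * C * ‖z - z'‖ := by
    intro z z'
    rw [← smul_sub, norm_smul, Real.norm_eq_abs, mul_assoc]
    gcongr
    simpa [dist_eq_norm] using hC.dist_le_mul z z'
  refine ⟨⟨fun z z' hzz => ?_, fun w => ?_⟩, fun z => ?_⟩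
  · have h1 := hlt z z'
    have h2 : z - z' = -(s • v z - s • v z') := by
      have : z + s • v z = z' + s • v z' := hzz
      rw [neg_sub, sub_eq_sub_iff_add_eq_add, this, add_comm]
    by_contra hne
    have h3 : 0 < ‖z - z'‖ := norm_pos_iff.2 (sub_ne_zero.2 hne)
    have h4 : ‖z - z'‖ ≤ |s| * C * ‖z - z'‖ := by
      conv_lhs => rw [h2, norm_neg]
      exact h1
    nlinarith
  -- A preimage of `w` is a fixed point of `z ↦ w - s • v z`.
  · have hcon : ContractingWith (⟨|s| * C, by positivity⟩ : NNReal) fun z => w - s • v z := by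
      refine ⟨by exact_mod_cast hsC, LipschitzWith.of_dist_le_mul fun z z' => ?_⟩
      rw [dist_eq_norm, dist_eq_norm, sub_sub_sub_cancel_left, norm_sub_rev]
      exact hlt z z'
    have h1 := hcon.fixedPoint_isFixedPt
    refine ⟨hcon.fixedPoint, ?_⟩
    have h2 : w - s • v hcon.fixedPoint = hcon.fixedPoint := h1
    change hcon.fixedPoint + s • v hcon.fixedPoint = w
    nth_rewrite 1 [← h2]
    abel
  · rw [injective_iff_map_eq_zero]
    intro u hu
    have h1 : u = -(s • fderiv ℝ v z u) := by
      have : u + s • fderiv ℝ v z u = 0 := hu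
      exact eq_neg_of_add_eq_zero_left this
    have h2 : ‖fderiv ℝ v z u‖ ≤ C * ‖u‖ :=
      (fderiv ℝ v z).le_of_opNorm_le (norm_fderiv_le_of_lipschitz ℝ hC) u
    by_contra hne
    have h3 : 0 < ‖u‖ := norm_pos_iff.2 hne
    have h4 : ‖u‖ ≤ |s| * (C * ‖u‖) := by
      conv_lhs => rw [h1, norm_neg, norm_smul, Real.norm_eq_abs]
      gcongr
    nlinarith

/-- A fibrewise inverse of a smooth family of maps with invertible derivative is smooth. -/
theorem contDiffAt_fibrewise_inverse {f g : ℝ → E → E}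
    (hf : ContDiff ℝ ∞ fun p : ℝ × E => f p.1 p.2) {s₀ : ℝ} {w₀ : E}
    (hg : ∀ᶠ s in 𝓝 s₀, ∀ z, g s (f s z) = z) (hg' : f s₀ (g s₀ w₀) = w₀)
    (hinj : Function.Injective (fderiv ℝ (f s₀) (g s₀ w₀))) :
    ContDiffAt ℝ ∞ (fun p : ℝ × E => g p.1 p.2) (s₀, w₀) := by
  have := FiniteDimensional.complete ℝ E
  set z₀ := g s₀ w₀ with hz₀
  -- Keeping `s` as a coordinate lets the inverse function theorem give smoothness in `s` and `z`
  -- jointly; injectivity of the derivative suffices in finite dimension.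
  let G : ℝ × E → ℝ × E := fun p => (p.1, f p.1 p.2)
  have hG : ContDiff ℝ ∞ G := contDiff_fst.prodMk hf
  have hGd : DifferentiableAt ℝ G (s₀, z₀) := hG.contDiffAt.differentiableAt (by simp)
  have hfd : DifferentiableAt ℝ (fun p : ℝ × E => f p.1 p.2) (s₀, z₀) :=
    hf.contDiffAt.differentiableAt (by simp)
  have hGf : fderiv ℝ G (s₀, z₀) = (ContinuousLinearMap.fst ℝ ℝ E).prod
      (fderiv ℝ (fun p : ℝ × E => f p.1 p.2) (s₀, z₀)) :=
    (hasFDerivAt_fst.prodMk hfd.hasFDerivAt).fderiv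
  have hfz : ∀ u, fderiv ℝ (fun p : ℝ × E => f p.1 p.2) (s₀, z₀) (0, u)
      = fderiv ℝ (f s₀) z₀ u := by
    intro u
    have h2 : HasFDerivAt (fun y : E => (s₀, y)) (ContinuousLinearMap.inr ℝ ℝ E) z₀ := by
      simpa using! (hasFDerivAt_prodMk_right (𝕜 := ℝ) s₀ z₀)
    have h3 := (hfd.hasFDerivAt.comp z₀ h2).fderiv
    exact (DFunLike.congr_fun h3 u).symm
  have hGi : Function.Injective (fderiv ℝ G (s₀, z₀)) := by
    rw [injective_iff_map_eq_zero]
    rintro ⟨s, u⟩ hu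
    rw [hGf] at hu
    have h1 : s = 0 := congrArg Prod.fst hu
    subst h1
    have h2 : fderiv ℝ (fun p : ℝ × E => f p.1 p.2) (s₀, z₀) (0, u) = 0 := congrArg Prod.snd hu
    rw [hfz] at h2
    rw [hinj (h2.trans (map_zero _).symm)]
    rfl
  let e : (ℝ × E) ≃L[ℝ] (ℝ × E) := (LinearEquiv.ofInjectiveEndo
    (fderiv ℝ G (s₀, z₀)).toLinearMap hGi).toContinuousLinearEquiv
  have he : HasFDerivAt G (e : (ℝ × E) →L[ℝ] (ℝ × E)) (s₀, z₀) := by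
    have h1 : (e : (ℝ × E) →L[ℝ] (ℝ × E)) = fderiv ℝ G (s₀, z₀) := by ext p <;> rfl
    rw [h1]
    exact hGd.hasFDerivAt
  have hG₀ : G (s₀, z₀) = (s₀, w₀) := by simp only [G, hg']
  have h1 := hG.contDiffAt.to_localInverse he (by simp)
  have h2 : ∀ᶠ y in 𝓝 (G (s₀, z₀)), G (hG.contDiffAt.localInverse he (by simp) y) = y :=
    (hG.contDiffAt.hasStrictFDerivAt' he (by simp)).eventually_right_inverse
  rw [hG₀] at h1 h2
  refine (contDiff_snd.contDiffAt.comp _ h1).congr_of_eventuallyEq ?_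
  have hc : ContinuousAt (fun p : ℝ × E => p.1) (s₀, w₀) := continuousAt_fst
  filter_upwards [h2, hc.eventually hg] with p hp hgp
  set q := hG.contDiffAt.localInverse he (by simp) p with hq
  have h5 := Prod.ext_iff.1 hp
  have h3 : q.1 = p.1 := h5.1
  have h4 : f q.1 q.2 = p.2 := h5.2
  change g p.1 p.2 = q.2
  rw [← h4, h3, hgp]

end EuclideanFlow

/-! ### Extending maps of a chart by the identity. -/

section Lift

variable {E : Type*} [NormedAddCommGroup E] [NormedSpace ℝ E]
  {L : Type*} [TopologicalSpace L] [ChartedSpace E L]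

open Classical in
/-- The map of `L` given by `f` in the chart at `x₀` and by the identity elsewhere. -/
def liftChart (x₀ : L) (f : E → E) (x : L) : L :=
  if x ∈ (chartAt E x₀).source then cs x₀ (f (extChartAt 𝓘(ℝ, E) x₀ x)) else x

theorem liftChart_of_mem {x₀ x : L} (f : E → E) (hx : x ∈ (chartAt E x₀).source) :
    liftChart x₀ f x = cs x₀ (f (extChartAt 𝓘(ℝ, E) x₀ x)) := if_pos hx

theorem ext_mem_target {x₀ x : L} (hx : x ∈ (chartAt E x₀).source) :
    extChartAt 𝓘(ℝ, E) x₀ x ∈ (extChartAt 𝓘(ℝ, E) x₀).target :=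
  (extChartAt 𝓘(ℝ, E) x₀).map_source (by rwa [extChartAt_source])

theorem cs_ext {x₀ x : L} (hx : x ∈ (chartAt E x₀).source) :
    cs x₀ (extChartAt 𝓘(ℝ, E) x₀ x) = x :=
  (extChartAt 𝓘(ℝ, E) x₀).left_inv (by rwa [extChartAt_source])

theorem ext_cs {x₀ : L} {z : E} (hz : z ∈ (extChartAt 𝓘(ℝ, E) x₀).target) :
    extChartAt 𝓘(ℝ, E) x₀ (cs x₀ z) = z := (extChartAt 𝓘(ℝ, E) x₀).right_inv hz

theorem cs_mem_source {x₀ : L} {z : E} (hz : z ∈ (extChartAt 𝓘(ℝ, E) x₀).target) :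
    cs x₀ z ∈ (chartAt E x₀).source := by
  have := (extChartAt 𝓘(ℝ, E) x₀).map_target hz
  rwa [extChartAt_source] at this

theorem liftChart_leftInverse {x₀ : L} {f g : E → E}
    (hf : ∀ z ∈ (extChartAt 𝓘(ℝ, E) x₀).target, f z ∈ (extChartAt 𝓘(ℝ, E) x₀).target)
    (hgf : ∀ z, g (f z) = z) (x : L) : liftChart x₀ g (liftChart x₀ f x) = x := by
  by_cases hx : x ∈ (chartAt E x₀).source
  · have h1 := hf _ (ext_mem_target hx)
    rw [liftChart_of_mem f hx, liftChart_of_mem g (cs_mem_source h1), ext_cs h1, hgf, cs_ext hx]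
  · have h1 : ∀ f : E → E, liftChart x₀ f x = x := fun f => if_neg hx
    rw [h1 f, h1 g]

theorem liftChart_eq_self {x₀ x : L} {f : E → E} {K : Set L}
    (hf : ∀ z ∈ (extChartAt 𝓘(ℝ, E) x₀).target, cs x₀ z ∉ K → f z = z) (hx : x ∉ K) :
    liftChart x₀ f x = x := by
  by_cases hxs : x ∈ (chartAt E x₀).source
  · rw [liftChart_of_mem f hxs, hf _ (ext_mem_target hxs) (by rwa [cs_ext hxs]), cs_ext hxs]
  · exact if_neg hxs

/-- Inside the chart the coordinate formula is smooth. A point outside it has a neighbourhood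
missing the closed set `K`, on which the map is the identity for all nearby times. -/
theorem contMDiffAt_liftChart [IsManifold 𝓘(ℝ, E) ∞ L] {x₀ : L} {f : ℝ → E → E} {K : Set L}
    (hK : IsClosed K)
    (hKs : K ⊆ (chartAt E x₀).source) {s : ℝ} {x : L}
    (hid : ∀ᶠ s in 𝓝 s, ∀ z ∈ (extChartAt 𝓘(ℝ, E) x₀).target, cs x₀ z ∉ K → f s z = z)
    (hf : ContDiffAt ℝ ∞ (fun p : ℝ × E => f p.1 p.2) (s, extChartAt 𝓘(ℝ, E) x₀ x))
    (hft : ∀ z ∈ (extChartAt 𝓘(ℝ, E) x₀).target, f s z ∈ (extChartAt 𝓘(ℝ, E) x₀).target) :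
    ContMDiffAt (𝓘(ℝ, ℝ).prod 𝓘(ℝ, E)) 𝓘(ℝ, E) ∞
      (fun p : ℝ × L => liftChart x₀ (f p.1) p.2) (s, x) := by
  have hc : ContinuousAt (fun p : ℝ × L => p.2) (s, x) := continuousAt_snd
  have hc1 : ContinuousAt (fun p : ℝ × L => p.1) (s, x) := continuousAt_fst
  by_cases hx : x ∈ (chartAt E x₀).source
  · have h1 : ContMDiffAt 𝓘(ℝ, E) 𝓘(ℝ, E) ∞ (extChartAt 𝓘(ℝ, E) x₀) x :=
      contMDiffAt_extChartAt' hx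
    have h2 : ContMDiffAt (𝓘(ℝ, ℝ).prod 𝓘(ℝ, E)) 𝓘(ℝ, ℝ × E) ∞
        (fun p : ℝ × L => (p.1, extChartAt 𝓘(ℝ, E) x₀ p.2)) (s, x) :=
      contMDiffAt_fst.prodMk_space
        (ContMDiffAt.comp_of_eq h1 contMDiffAt_snd rfl)
    have h3 := ContMDiffAt.comp_of_eq hf.contMDiffAt h2 rfl
    have h4 := contMDiffAt_cs (hft _ (ext_mem_target hx))
    refine (ContMDiffAt.comp_of_eq h4 h3 rfl).congr_of_eventuallyEq ?_
    filter_upwards [hc.eventually ((chartAt E x₀).open_source.mem_nhds hx)] with p hp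
    exact liftChart_of_mem _ hp
  · refine contMDiffAt_snd.congr_of_eventuallyEq ?_
    filter_upwards [hc.eventually (hK.isOpen_compl.mem_nhds fun h => hx (hKs h)),
      hc1.eventually hid] with p hp hp'
    exact liftChart_eq_self hp' hp

end Lift

/-! ### Diffeomorphisms generated by a field supported in a chart. -/

section LocalFlow

variable {E : Type*} [NormedAddCommGroup E] [NormedSpace ℝ E] [FiniteDimensional ℝ E]
  {L : Type*} [TopologicalSpace L] [T2Space L] [ChartedSpace E L] [IsManifold 𝓘(ℝ, E) ∞ L]

open Classical in
/-- A vector field supported in the chart at `x₀`, as a function on the model space. -/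
def vrExt (x₀ : L) (Z : VField E L) (z : E) : E :=
  if z ∈ (extChartAt 𝓘(ℝ, E) x₀).target then vr x₀ Z z else 0

theorem vrExt_of_mem {x₀ : L} (Z : VField E L) {z : E}
    (hz : z ∈ (extChartAt 𝓘(ℝ, E) x₀).target) : vrExt x₀ Z z = vr x₀ Z z := if_pos hz

theorem vrExt_of_notMem {x₀ : L} {Z : VField E L} {K : Set L} (hZ : ∀ x ∉ K, Z x = 0) {z : E}
    (hz : z ∉ extChartAt 𝓘(ℝ, E) x₀ '' K) : vrExt x₀ Z z = 0 := by
  by_cases h : z ∈ (extChartAt 𝓘(ℝ, E) x₀).target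
  · rw [vrExt_of_mem Z h, vr, hZ, map_zero]
    exact fun hK => hz ⟨_, hK, ext_cs h⟩
  · exact if_neg h

theorem isCompact_ext_image {x₀ : L} {K : Set L} (hK : IsCompact K)
    (hKs : K ⊆ (chartAt E x₀).source) : IsCompact (extChartAt 𝓘(ℝ, E) x₀ '' K) :=
  hK.image_of_continuousOn ((continuousOn_extChartAt x₀).mono (by rwa [extChartAt_source]))

/-- The image of `K` is compact, hence closed in the model space, so extension by zero stays smooth
at points outside the chart target. -/
theorem contDiff_vrExt {x₀ : L} {Z : VField E L} {K : Set L} (hZs : SmoothVF Z)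
    (hZ : ∀ x ∉ K, Z x = 0) (hK : IsCompact K) (hKs : K ⊆ (chartAt E x₀).source) :
    ContDiff ℝ ∞ (vrExt x₀ Z) := by
  rw [contDiff_iff_contDiffAt]
  intro z
  by_cases hz : z ∈ (extChartAt 𝓘(ℝ, E) x₀).target
  · have h1 := (Bundle.Trivialization.contMDiffOn_section_baseSet_iff (IB := 𝓘(ℝ, E)) (n := ∞)
        (s := Z) (trivializationAt E (TangentSpace 𝓘(ℝ, E)) x₀)).1 hZs.contMDiffOn
    have h2 : ContMDiffAt 𝓘(ℝ, E) 𝓘(ℝ, E) ∞ (fun x => tr x₀ x (Z x)) (cs x₀ z) := by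
      refine (h1.contMDiffAt ((chartAt E x₀).open_source.mem_nhds
        (cs_mem_source hz))).congr_of_eventuallyEq ?_
      filter_upwards [(chartAt E x₀).open_source.mem_nhds (cs_mem_source hz)] with x hx
      exact (trivializationAt E (TangentSpace 𝓘(ℝ, E)) x₀).continuousLinearMapAt_apply_of_mem
        (R := ℝ) hx _
    refine (ContMDiffAt.comp z h2 (contMDiffAt_cs hz)).contDiffAt.congr_of_eventuallyEq ?_
    filter_upwards [(isOpen_extChartAt_target x₀).mem_nhds hz] with w hw
    exact vrExt_of_mem Z hw
  · have hcl := (isCompact_ext_image hK hKs).isClosed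
    refine (contDiffAt_const (c := (0 : E))).congr_of_eventuallyEq ?_
    have hz' : z ∉ extChartAt 𝓘(ℝ, E) x₀ '' K := by
      rintro ⟨x, hx, rfl⟩
      exact hz (ext_mem_target (hKs hx))
    filter_upwards [hcl.isOpen_compl.mem_nhds hz'] with w hw
    exact vrExt_of_notMem hZ hw

theorem hasDerivAt_ext_cs {x₀ x₁ x : L} (hx : x ∈ (chartAt E x₀).source)
    (hx₁ : x ∈ (chartAt E x₁).source) {c : ℝ → E} {c' : E} (hc : HasDerivAt c c' 0)
    (hc0 : c 0 = extChartAt 𝓘(ℝ, E) x₀ x) :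
    HasDerivAt (fun s => extChartAt 𝓘(ℝ, E) x₁ (cs x₀ (c s))) (tr x₁ x (trs x₀ x c')) 0 := by
  have h1 : HasMFDerivAt 𝓘(ℝ, E) 𝓘(ℝ, E) (cs x₀) (extChartAt 𝓘(ℝ, E) x₀ x)
      (trs x₀ x : E →L[ℝ] E) := by
    have h2 := ((contMDiffAt_cs (ext_mem_target hx)).mdifferentiableAt (by simp)).hasMFDerivAt
    have h3 := trs_eq_mfderiv hx
    rw [modelWithCornersSelf_coe, range_id, mfderivWithin_univ] at h3
    have h4 : (trs x₀ x : E →L[ℝ] E) = mfderiv 𝓘(ℝ, E) 𝓘(ℝ, E) (cs x₀)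
      (extChartAt 𝓘(ℝ, E) x₀ x) := h3
    rw [h4]
    exact h2
  have h2 : HasMFDerivAt 𝓘(ℝ, E) 𝓘(ℝ, E) (extChartAt 𝓘(ℝ, E) x₁)
      (cs x₀ (extChartAt 𝓘(ℝ, E) x₀ x)) (tr x₁ x : E →L[ℝ] E) := by
    rw [cs_ext hx, tr_eq_mfderiv hx₁]
    exact (mdifferentiableAt_extChartAt hx₁).hasMFDerivAt
  have h3 : HasFDerivAt (fun z => extChartAt 𝓘(ℝ, E) x₁ (cs x₀ z))
      ((tr x₁ x : E →L[ℝ] E) ∘L (trs x₀ x : E →L[ℝ] E)) (extChartAt 𝓘(ℝ, E) x₀ x) :=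
    hasMFDerivAt_iff_hasFDerivAt.1 (h2.comp _ h1)
  exact HasFDerivAt.comp_hasDerivAt_of_eq (0 : ℝ) h3 hc hc0.symm

/-- A smooth vector field with compact support in a chart is the velocity of a smooth family of
diffeomorphisms with the same support. -/
theorem exists_local_flow {x₀ : L} {Z : VField E L} {K : Set L} (hZs : SmoothVF Z)
    (hZ : ∀ x ∉ K, Z x = 0) (hK : IsCompact K) (hKs : K ⊆ (chartAt E x₀).source) :
    ∃ r : ℝ, 0 < r ∧ ∃ Φ : ℝ → (L ≃ₘ^∞⟮𝓘(ℝ, E), 𝓘(ℝ, E)⟯ L),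
      IsIsotopy (Ioo (-r) r) Φ ∧ HasVelocity (fun s => Φ s) Z ∧ ∀ s, ∀ x ∉ K, Φ s x = x := by
  set T := (extChartAt 𝓘(ℝ, E) x₀).target with hT
  set K' := extChartAt 𝓘(ℝ, E) x₀ '' K with hK'
  have hK'T : K' ⊆ T := by rintro _ ⟨x, hx, rfl⟩; exact ext_mem_target (hKs hx)
  set v := vrExt x₀ Z with hv
  have hvs : ContDiff ℝ ∞ v := contDiff_vrExt hZs hZ hK hKs
  have hvK : ∀ z ∉ K', v z = 0 := fun z hz => vrExt_of_notMem hZ hz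
  have hvc : HasCompactSupport v := HasCompactSupport.intro (isCompact_ext_image hK hKs) hvK
  obtain ⟨r, hr, hbij⟩ := exists_perturbation hvs hvc
  -- Only the velocity at `s = 0` matters, so straight lines replace the flow and no differential
  -- equation has to be solved.
  let f : ℝ → E → E := fun s z => z + s • v z
  let g : ℝ → E → E := fun s => Function.invFun (f s)
  have hgf : ∀ s, |s| < r → ∀ z, g s (f s z) = z := fun s hs =>
    Function.leftInverse_invFun (hbij s hs).1.1
  have hfg : ∀ s, |s| < r → ∀ z, f s (g s z) = z := fun s hs =>
    Function.rightInverse_invFun (hbij s hs).1.2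
  have hfK : ∀ s, ∀ z ∉ K', f s z = z := fun s z hz => by simp [f, hvK z hz]
  have hgK : ∀ s, |s| < r → ∀ z ∉ K', g s z = z := fun s hs z hz => by
    conv_lhs => rw [← hfK s z hz]
    exact hgf s hs z
  -- If `f s z` is outside the support it is a fixed point of `f s`, so injectivity gives `f s z =
  -- z`.
  have hfT : ∀ s, |s| < r → ∀ z ∈ T, f s z ∈ T := by
    intro s hs z hz
    by_cases hfz : f s z ∈ K'
    · exact hK'T hfz
    · have h1 : f s (f s z) = f s z := hfK s _ hfz
      rw [(hbij s hs).1.1 h1]; exact hz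
  have hgT : ∀ s, |s| < r → ∀ z ∈ T, g s z ∈ T := by
    intro s hs z hz
    by_cases hgz : g s z ∈ K'
    · exact hK'T hgz
    · have h1 := hfK s _ hgz
      rw [hfg s hs] at h1
      rw [← h1]; exact hz
  have hfs : ContDiff ℝ ∞ fun p : ℝ × E => f p.1 p.2 :=
    contDiff_snd.add (contDiff_fst.smul (hvs.comp contDiff_snd))
  have hnhds : ∀ s, |s| < r → ∀ᶠ s' in 𝓝 s, |s'| < r := fun s hs =>
    continuous_abs.continuousAt.eventually (gt_mem_nhds hs)
  have hgs : ∀ s, |s| < r → ∀ z, ContDiffAt ℝ ∞ (fun p : ℝ × E => g p.1 p.2) (s, z) := by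
    intro s hs z
    refine contDiffAt_fibrewise_inverse hfs ((hnhds s hs).mono hgf) (hfg s hs z) ?_
    have h1 : fderiv ℝ (f s) (g s z) = ContinuousLinearMap.id ℝ E + s • fderiv ℝ v (g s z) :=
      ((hasFDerivAt_id _).add
        ((hvs.differentiable (by simp) (g s z)).hasFDerivAt.const_smul s)).fderiv
    rw [h1]
    exact (hbij s hs).2 _
  have hKcs : ∀ z ∈ T, cs x₀ z ∉ K → z ∉ K' := by
    rintro _ hz hzK ⟨x, hx, rfl⟩
    rw [cs_ext (hKs hx)] at hzK
    exact hzK hx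
  have hsm : ∀ s, |s| < r → ∀ x, ContMDiffAt (𝓘(ℝ, ℝ).prod 𝓘(ℝ, E)) 𝓘(ℝ, E) ∞
      (fun p : ℝ × L => liftChart x₀ (f p.1) p.2) (s, x) := fun s hs x =>
    contMDiffAt_liftChart hK.isClosed hKs
      (Eventually.of_forall fun s z hz hzK => hfK s z (hKcs z hz hzK)) hfs.contDiffAt (hfT s hs)
  have hsm' : ∀ s, |s| < r → ∀ x, ContMDiffAt (𝓘(ℝ, ℝ).prod 𝓘(ℝ, E)) 𝓘(ℝ, E) ∞
      (fun p : ℝ × L => liftChart x₀ (g p.1) p.2) (s, x) := fun s hs x =>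
    contMDiffAt_liftChart hK.isClosed hKs
      ((hnhds s hs).mono fun s hs z hz hzK => hgK s hs z (hKcs z hz hzK)) (hgs s hs _) (hgT s hs)
  have hslice : ∀ {h : ℝ → E → E} {s : ℝ}, (∀ x, ContMDiffAt (𝓘(ℝ, ℝ).prod 𝓘(ℝ, E)) 𝓘(ℝ, E) ∞
      (fun p : ℝ × L => liftChart x₀ (h p.1) p.2) (s, x)) →
      ContMDiff 𝓘(ℝ, E) 𝓘(ℝ, E) ∞ (liftChart x₀ (h s)) := fun hh x =>
    ContMDiffAt.comp_of_eq (hh x) (contMDiffAt_const.prodMk contMDiffAt_id) rfl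
  -- The identity is a default value for `|s| ≥ r`; smoothness in `s` is claimed only on the open
  -- interval.
  let Φ : ℝ → (L ≃ₘ^∞⟮𝓘(ℝ, E), 𝓘(ℝ, E)⟯ L) := fun s =>
    if hs : |s| < r then
      { toFun := liftChart x₀ (f s)
        invFun := liftChart x₀ (g s)
        left_inv := liftChart_leftInverse (hfT s hs) (hgf s hs)
        right_inv := liftChart_leftInverse (hgT s hs) (hfg s hs)
        contMDiff_toFun := hslice (hsm s hs)
        contMDiff_invFun := hslice (hsm' s hs) }
    else Diffeomorph.refl 𝓘(ℝ, E) L ∞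
  have hΦ : ∀ s, |s| < r → ∀ x, Φ s x = liftChart x₀ (f s) x := fun s hs x => by
    simp only [Φ, dif_pos hs]; rfl
  have hΦ' : ∀ s, |s| < r → ∀ x, (Φ s).symm x = liftChart x₀ (g s) x := fun s hs x => by
    simp only [Φ, dif_pos hs]; rfl
  have hid : ∀ s, ∀ x ∉ K, liftChart x₀ (f s) x = x := fun s x hx =>
    liftChart_eq_self (fun z hz hzK => hfK s z (hKcs z hz hzK)) hx
  have hf0 : ∀ x, liftChart x₀ (f 0) x = x := fun x =>
    liftChart_eq_self (K := ∅) (fun z _ _ => by simp [f]) (notMem_empty x)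
  have h0r : |(0 : ℝ)| < r := by rwa [abs_zero]
  have hc1 : ∀ (s : ℝ) (x : L), ContinuousAt (fun p : ℝ × L => p.1) (s, x) := fun s x =>
    continuousAt_fst
  refine ⟨r, hr, Φ, ⟨fun s hs x => ?_, fun s hs x => ?_, fun x => ?_⟩, fun x₁ x hx₁ => ?_,
    fun s x hx => ?_⟩
  · refine (hsm s (abs_lt.2 hs) x).congr_of_eventuallyEq ?_
    filter_upwards [(hc1 s x).eventually (hnhds s (abs_lt.2 hs))] with p hp
    exact hΦ _ hp _
  · refine (hsm' s (abs_lt.2 hs) x).congr_of_eventuallyEq ?_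
    filter_upwards [(hc1 s x).eventually (hnhds s (abs_lt.2 hs))] with p hp
    exact hΦ' _ hp _
  · rw [hΦ 0 h0r, hf0]
  · have hev : (fun s => extChartAt 𝓘(ℝ, E) x₁ (Φ s x))
        =ᶠ[𝓝 0] fun s => extChartAt 𝓘(ℝ, E) x₁ (liftChart x₀ (f s) x) := by
      filter_upwards [hnhds 0 h0r] with s hs
      rw [hΦ s hs]
    refine HasDerivAt.congr_of_eventuallyEq ?_ hev
    by_cases hx : x ∈ (chartAt E x₀).source
    · simp only [liftChart_of_mem _ hx]
      have h1 : HasDerivAt (fun s : ℝ => f s (extChartAt 𝓘(ℝ, E) x₀ x))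
          (v (extChartAt 𝓘(ℝ, E) x₀ x)) 0 := by
        have h1 := ((hasDerivAt_id (0 : ℝ)).smul_const (v (extChartAt 𝓘(ℝ, E) x₀ x))).const_add
          (extChartAt 𝓘(ℝ, E) x₀ x)
        rw [one_smul] at h1
        exact h1
      have h2 := hasDerivAt_ext_cs hx hx₁ h1 (by simp [f])
      have h3 : v (extChartAt 𝓘(ℝ, E) x₀ x) = tr x₀ x (Z x) := by
        rw [hv, vrExt_of_mem Z (ext_mem_target hx), vr, cs_ext hx]
      rw [h3, trs_tr hx] at h2
      exact h2
    · have hxK : x ∉ K := fun h => hx (hKs h)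
      rw [hZ x hxK, map_zero]
      simp only [hid _ x hxK]
      exact hasDerivAt_const _ _
  · by_cases hs : |s| < r
    · rw [hΦ s hs, hid s x hx]
    · simp only [Φ, dif_neg hs]; rfl

end LocalFlow

/-! ### Composing an isotopy with one local perturbation. -/

section Step

/-- A smooth reparametrization of time, equal to the identity near `0` and vanishing for
`|t| ≥ η`. -/
theorem exists_time_cutoff {η : ℝ} (hη : 0 < η) :
    ∃ σ : ℝ → ℝ, ContDiff ℝ ∞ σ ∧ (∀ᶠ t in 𝓝 0, σ t = t) ∧ (∀ t, η ≤ |t| → σ t = 0) ∧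
      ∀ t, |σ t| ≤ η := by
  let f : ContDiffBump (0 : ℝ) := ⟨η / 2, η, by positivity, by linarith⟩
  have hz : ∀ t, η ≤ |t| → t * f t = 0 := fun t ht => by
    rw [f.zero_of_le_dist (by simpa [Real.dist_eq] using ht), mul_zero]
  refine ⟨fun t => t * f t, contDiff_id.mul f.contDiff, ?_, hz, fun t => ?_⟩
  · filter_upwards [f.eventuallyEq_one] with t ht
    rw [ht]; simp
  · change |t * f t| ≤ η
    rcases le_or_gt η |t| with ht | ht
    · rw [hz t ht, abs_zero]; exact hη.le
    · rw [abs_mul, abs_of_nonneg f.nonneg]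
      calc |t| * f t ≤ η * 1 := mul_le_mul ht.le f.le_one f.nonneg hη.le
        _ = η := mul_one η

variable {E : Type*} [NormedAddCommGroup E] [NormedSpace ℝ E]
  {L : Type*} [TopologicalSpace L] [ChartedSpace E L] [IsManifold 𝓘(ℝ, E) ∞ L]

/-- At `(0, x)` the map `(s, z) ↦ φ_s(z)` has time derivative `Z` and, as `φ_0` is the identity,
space derivative the identity; with `σ'(0) = 1` the chain rule adds the velocities. -/
theorem HasVelocity.comp {Ψ φ : ℝ → L → L} {W Z : VField E L} {σ : ℝ → ℝ}
    (hW : HasVelocity Ψ W) (hZ : HasVelocity φ Z) (hσ : HasDerivAt σ 1 0) (hσ0 : σ 0 = 0)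
    (hΨ : ∀ x, ContinuousAt (fun t => Ψ t x) 0) (hΨ0 : ∀ x, Ψ 0 x = x)
    (hφ : ∀ x, ContMDiffAt (𝓘(ℝ, ℝ).prod 𝓘(ℝ, E)) 𝓘(ℝ, E) ∞ (fun p : ℝ × L => φ p.1 p.2) (0, x))
    (hφ0 : ∀ x, φ 0 x = x) : HasVelocity (fun t x => φ (σ t) (Ψ t x)) (W + Z) := by
  intro x₁ x hx
  set ζ := extChartAt 𝓘(ℝ, E) x₁ x with hζ
  have hζT : ζ ∈ (extChartAt 𝓘(ℝ, E) x₁).target := ext_mem_target hx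
  have hcs : cs x₁ ζ = x := cs_ext hx
  let G : ℝ × E → E := fun p => mr x₁ φ p.1 p.2
  have hG : DifferentiableAt ℝ G (0, ζ) := by
    have h1 : ContMDiffAt 𝓘(ℝ, ℝ × E) (𝓘(ℝ, ℝ).prod 𝓘(ℝ, E)) ∞
        (fun p : ℝ × E => (p.1, cs x₁ p.2)) (0, ζ) :=
      contDiff_fst.contMDiff.contMDiffAt.prodMk
        (ContMDiffAt.comp_of_eq (contMDiffAt_cs hζT) contDiff_snd.contMDiff.contMDiffAt rfl)
    have h2 := ContMDiffAt.comp_of_eq (hφ x) h1 (by simp only [hcs])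
    have h3 : ContMDiffAt 𝓘(ℝ, E) 𝓘(ℝ, E) ∞ (extChartAt 𝓘(ℝ, E) x₁) x :=
      contMDiffAt_extChartAt' hx
    exact (ContMDiffAt.comp_of_eq h3 h2
      (by simp only [Function.comp_apply, hcs, hφ0])).contDiffAt.differentiableAt
      (by simp)
  have hG1 : fderiv ℝ G (0, ζ) (1, 0) = tr x₁ x (Z x) := by
    have h1 : HasDerivAt (fun s : ℝ => (s, ζ)) ((1 : ℝ), (0 : E)) 0 :=
      (hasDerivAt_id 0).prodMk (hasDerivAt_const 0 _)
    have h2 := hZ x₁ x hx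
    refine (hG.hasFDerivAt.comp_hasDerivAt (0 : ℝ) h1).unique ?_
    refine h2.congr_of_eventuallyEq (Eventually.of_forall fun s => ?_)
    change extChartAt 𝓘(ℝ, E) x₁ (φ s (cs x₁ ζ)) = _
    rw [hζ, cs_ext hx]
  have hG2 : ∀ u, fderiv ℝ G (0, ζ) (0, u) = u := by
    intro u
    have h1 : HasFDerivAt (fun y : E => ((0 : ℝ), y)) (ContinuousLinearMap.inr ℝ ℝ E) ζ := by
      simpa using! (hasFDerivAt_prodMk_right (𝕜 := ℝ) (0 : ℝ) ζ)
    have h2 : (G ∘ fun y : E => ((0 : ℝ), y)) =ᶠ[𝓝 ζ] id := by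
      filter_upwards [(isOpen_extChartAt_target x₁).mem_nhds hζT] with z hz
      exact mr_zero hφ0 hz
    exact DFunLike.congr_fun ((hG.hasFDerivAt.comp ζ h1).unique
      ((hasFDerivAt_id ζ).congr_of_eventuallyEq h2)) u
  have hz := hW x₁ x hx
  have h1 := HasFDerivAt.comp_hasDerivAt_of_eq (0 : ℝ) hG.hasFDerivAt (hσ.prodMk hz)
    (by simp [hσ0, hΨ0, hζ])
  have h2 : fderiv ℝ G (0, ζ) (1, tr x₁ x (W x)) = tr x₁ x ((W + Z) x) := by
    have h3 : ((1 : ℝ), tr x₁ x (W x)) = (0, tr x₁ x (W x)) + (1, 0) := by simp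
    rw [h3, map_add, hG1, hG2, Pi.add_apply, map_add]
  rw [h2] at h1
  refine h1.congr_of_eventuallyEq ?_
  have h3 : ∀ᶠ t in 𝓝 (0 : ℝ), Ψ t x ∈ (chartAt E x₁).source := by
    refine (hΨ x).eventually ?_
    simp only [hΨ0]
    exact (chartAt E x₁).open_source.mem_nhds hx
  filter_upwards [h3] with t ht
  change _ = extChartAt 𝓘(ℝ, E) x₁ (φ (σ t) (cs x₁ (extChartAt 𝓘(ℝ, E) x₁ (Ψ t x))))
  rw [cs_ext ht]

variable [FiniteDimensional ℝ E] [T2Space L]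
  {F : LeviFlatStructure E L} {γ : Form1 E L} {X : VField E L} {J : Set ℝ}
  {α : ℝ → Form1 E L} {S : ℝ → EndField E L}

/-- Composition of an isotopy with the flow of a vector field supported in a chart, with small
support in time. -/
theorem exists_isotopy_step (h : IsDefiningCouple F.ξ γ X) (hJ : IsOpen J)
    (hc : IsPairCurve F X J α S) {Ψ : ℝ → (L ≃ₘ^∞⟮𝓘(ℝ, E), 𝓘(ℝ, E)⟯ L)}
    (hΨ : IsIsotopy J Ψ) (had : ∀ t ∈ J, ∀ y, Admissible F γ X (α t) (S t)
      (mfderiv 𝓘(ℝ, E) 𝓘(ℝ, E) (Ψ t).symm y)) {η₀ : ℝ} (hη₀ : 0 < η₀) (hη₀J : Icc (-η₀) η₀ ⊆ J)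
    {x₀ : L} {Z : VField E L} {K : Set L} (hZs : SmoothVF Z)
    (hZ : ∀ x ∉ K, Z x = 0) (hK : IsCompact K) (hKs : K ⊆ (chartAt E x₀).source) :
    ∃ Ψ' : ℝ → (L ≃ₘ^∞⟮𝓘(ℝ, E), 𝓘(ℝ, E)⟯ L), (IsIsotopy J Ψ' ∧
      ∀ t ∈ J, ∀ y, Admissible F γ X (α t) (S t) (mfderiv 𝓘(ℝ, E) 𝓘(ℝ, E) (Ψ' t).symm y)) ∧
      (∀ t, η₀ ≤ |t| → Ψ' t = Ψ t) ∧ (∀ t x, Ψ t x ∉ K → Ψ' t x = Ψ t x) ∧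
      (∀ t, ∀ y ∉ K, (Ψ' t).symm y = (Ψ t).symm y) ∧
      ∀ W, HasVelocity (fun t => Ψ t) W → HasVelocity (fun t => Ψ' t) (W + Z) := by
  obtain ⟨r, hr, φ, hφ, hφv, hφK⟩ := exists_local_flow hZs hZ hK hKs
  have h0r : (0 : ℝ) ∈ Ioo (-r) r := ⟨neg_lt_zero.2 hr, hr⟩
  have hφK' : ∀ s, ∀ y ∉ K, (φ s).symm y = y := fun s y hy => by
    conv_lhs => rw [← hφK s y hy]
    exact (φ s).symm_apply_apply y
  have hφ0 : φ 0 = Diffeomorph.refl 𝓘(ℝ, E) L ∞ := Diffeomorph.ext hφ.zero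
  -- admissibility for small parameters
  have hO : ∀ q ∈ Icc (-η₀) η₀ ×ˢ K, ∀ᶠ p : ℝ × (ℝ × L) in 𝓝 (0, q),
      Admissible F γ X (α p.2.1) (S p.2.1)
        (mfderiv 𝓘(ℝ, E) 𝓘(ℝ, E) (fun y => (Ψ p.2.1).symm ((φ p.1).symm y)) p.2.2) := by
    rintro ⟨t, y⟩ ⟨ht, -⟩
    have htJ : t ∈ J := hη₀J ht
    have hΘ0 : (fun y => (Ψ t).symm ((φ 0).symm y)) = (Ψ t).symm := by rw [hφ0]; rfl
    refine eventually_admissible_param h hJ hc (p₀ := ((0 : ℝ), (t, y)))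
      (IN := 𝓘(ℝ, ℝ).prod (𝓘(ℝ, ℝ).prod 𝓘(ℝ, E)))
      (τ := fun p : ℝ × (ℝ × L) => p.2.1) (y := fun p : ℝ × (ℝ × L) => p.2.2)
      (Θ := fun p : ℝ × (ℝ × L) => fun y => (Ψ p.2.1).symm ((φ p.1).symm y))
      contMDiff_snd.fst.contMDiffAt htJ contMDiff_snd.snd.contMDiffAt ?_ ?_ ?_
    · have h1 : ContMDiffAt ((𝓘(ℝ, ℝ).prod (𝓘(ℝ, ℝ).prod 𝓘(ℝ, E))).prod 𝓘(ℝ, E)) 𝓘(ℝ, E) ∞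
          (fun q : (ℝ × (ℝ × L)) × L => (φ q.1.1).symm q.2) (((0 : ℝ), (t, y)), y) :=
        ContMDiffAt.comp_of_eq (f := fun q : (ℝ × (ℝ × L)) × L => (q.1.1, q.2))
          (hφ.smooth_symm 0 h0r y) (contMDiff_fst.fst.prodMk contMDiff_snd).contMDiffAt rfl
      have h2 : ContMDiffAt ((𝓘(ℝ, ℝ).prod (𝓘(ℝ, ℝ).prod 𝓘(ℝ, E))).prod 𝓘(ℝ, E)) 𝓘(ℝ, ℝ) ∞
          (fun q : (ℝ × (ℝ × L)) × L => q.1.2.1) (((0 : ℝ), (t, y)), y) :=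
        contMDiff_fst.snd.fst.contMDiffAt
      exact ContMDiffAt.comp_of_eq (hΨ.smooth_symm t htJ y) (h2.prodMk h1)
        (by simp only [hφ.symm_zero, id])
    · change (mfderiv 𝓘(ℝ, E) 𝓘(ℝ, E) (fun y => (Ψ t).symm ((φ 0).symm y)) y).IsInvertible
      rw [hΘ0]
      exact mfderiv_diffeomorph_isInvertible (Ψ t).symm y
    · exact (had t htJ y).congr (Filter.EventuallyEq.of_eq hΘ0.symm)
  -- Compactness of `[-η₀, η₀] × K` gives one bound on `s` valid for all these times and points.
  have hev := IsCompact.eventually_forall_of_forall_eventually (x₀ := (0 : ℝ))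
    (P := fun (s : ℝ) (q : ℝ × L) => Admissible F γ X (α q.1) (S q.1)
      (mfderiv 𝓘(ℝ, E) 𝓘(ℝ, E) (fun y => (Ψ q.1).symm ((φ s).symm y)) q.2))
    (isCompact_Icc.prod hK) hO
  obtain ⟨δ, hδ, hδO⟩ := Metric.eventually_nhds_iff.1 hev
  -- `η ≤ η₀` confines the change in time, `η < δ` keeps the perturbed map admissible, and `η < r`
  -- keeps `σ` in the range where `φ` is smooth.
  set η := min η₀ (min (δ / 2) (r / 2)) with hη
  have hη0 : 0 < η := by positivity
  have hηη₀ : η ≤ η₀ := min_le_left _ _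
  have hηδ : η < δ := ((min_le_right _ _).trans (min_le_left _ _)).trans_lt (by linarith)
  have hηr : η < r := ((min_le_right _ _).trans (min_le_right _ _)).trans_lt (by linarith)
  obtain ⟨σ, hσs, hσ1, hσ0, hση⟩ := exists_time_cutoff hη0
  have hσr : ∀ t, σ t ∈ Ioo (-r) r := fun t => abs_lt.1 ((hση t).trans_lt hηr)
  have hσz : σ 0 = 0 := hσ1.self_of_nhds
  have hφσ : ∀ t, η ≤ |t| → φ (σ t) = Diffeomorph.refl 𝓘(ℝ, E) L ∞ := fun t ht => by
    rw [hσ0 t ht, hφ0]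
  let Ψ' : ℝ → (L ≃ₘ^∞⟮𝓘(ℝ, E), 𝓘(ℝ, E)⟯ L) := fun t => (Ψ t).trans (φ (σ t))
  have hΨ' : ∀ t x, Ψ' t x = φ (σ t) (Ψ t x) := fun t x => rfl
  have hΨs : ∀ t y, (Ψ' t).symm y = (Ψ t).symm ((φ (σ t)).symm y) := fun t y => rfl
  have hσm : ContMDiff 𝓘(ℝ, ℝ) 𝓘(ℝ, ℝ) ∞ σ := hσs.contMDiff
  have hout : ∀ t, ∀ y ∉ K, (Ψ' t).symm y = (Ψ t).symm y := fun t y hy => by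
    rw [hΨs, hφK' _ y hy]
  have hlarge : ∀ t, η ≤ |t| → Ψ' t = Ψ t := fun t ht => Diffeomorph.ext fun x => by
    rw [hΨ', hφσ t ht]; rfl
  refine ⟨Ψ', ⟨⟨fun t ht x => ?_, fun t ht y => ?_, fun x => ?_⟩, fun t ht y => ?_⟩,
    fun t ht => hlarge t (hηη₀.trans ht), fun t x hx => by rw [hΨ', hφK _ _ hx], hout,
    fun W hW => ?_⟩
  · have h1 : ContMDiffAt (𝓘(ℝ, ℝ).prod 𝓘(ℝ, E)) 𝓘(ℝ, ℝ) ∞ (fun p : ℝ × L => σ p.1) (t, x) :=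
      (hσm.comp contMDiff_fst).contMDiffAt
    exact ContMDiffAt.comp_of_eq (hφ.smooth (σ t) (hσr t) (Ψ t x))
      (h1.prodMk (hΨ.smooth t ht x)) rfl
  · have h1 : ContMDiffAt (𝓘(ℝ, ℝ).prod 𝓘(ℝ, E)) 𝓘(ℝ, ℝ) ∞ (fun p : ℝ × L => σ p.1) (t, y) :=
      (hσm.comp contMDiff_fst).contMDiffAt
    have h2 : ContMDiffAt (𝓘(ℝ, ℝ).prod 𝓘(ℝ, E)) 𝓘(ℝ, E) ∞
        (fun p : ℝ × L => (φ (σ p.1)).symm p.2) (t, y) :=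
      ContMDiffAt.comp_of_eq (hφ.smooth_symm (σ t) (hσr t) y) (h1.prodMk contMDiffAt_snd) rfl
    exact ContMDiffAt.comp_of_eq (hΨ.smooth_symm t ht _) (contMDiffAt_fst.prodMk h2) rfl
  · rw [hΨ', hσz, hΨ.zero, hφ.zero]
  -- For `|t| ≥ η` nothing has changed. For smaller `t` the compactness bound handles the points of
  -- `K`, and off `K` the inverse is locally the old one.
  · rcases le_or_gt η |t| with htη | htη
    · rw [hlarge t htη]; exact had t ht y
    · by_cases hy : y ∈ K
      · have h1 := hδO (y := σ t) (by
          rw [Real.dist_eq, sub_zero]; exact (hση t).trans_lt hηδ) (t, y)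
          ⟨abs_le.1 (htη.le.trans hηη₀), hy⟩
        exact h1
      · refine (had t ht y).congr ?_
        filter_upwards [hK.isClosed.isOpen_compl.mem_nhds hy] with y' hy'
        exact (hout t y' hy').symm
  · refine hW.comp hφv ?_ hσz (fun x => ?_) hΨ.zero (hφ.smooth 0 h0r) hφ.zero
    · exact (hasDerivAt_id (0 : ℝ)).congr_of_eventuallyEq hσ1
    · have h0J : (0 : ℝ) ∈ J := hη₀J ⟨by linarith, hη₀.le⟩
      exact (contMDiff_apply_family (Φ := fun t => Ψ t) (hΨ.smooth 0 h0J x)).continuousAt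

end Step

/-! ### Locally finite infinite compositions and isotopies with prescribed velocity. -/

section Limit

variable {E : Type*} [NormedAddCommGroup E] [NormedSpace ℝ E]
  {L : Type*} [TopologicalSpace L] [ChartedSpace E L] [IsManifold 𝓘(ℝ, E) ∞ L]

/-- A sequence of isotopies, whose successive modifications are supported in shrinking intervals
of time and in a locally finite family of subsets, converges locally in finitely many steps. -/
theorem exists_limit_isotopy {J : Set ℝ} (h0 : (0 : ℝ) ∈ J)
    {Ψ : ℕ → ℝ → (L ≃ₘ^∞⟮𝓘(ℝ, E), 𝓘(ℝ, E)⟯ L)} (hΨ : ∀ n, IsIsotopy J (Ψ n))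
    {δ : ℕ → ℝ} (hδ : Tendsto δ atTop (𝓝 0)) {K : ℕ → Set L} (hK : LocallyFinite K)
    (htime : ∀ n t, δ n ≤ |t| → Ψ (n + 1) t = Ψ n t)
    (hspace : ∀ n t x, Ψ n t x ∉ K n → Ψ (n + 1) t x = Ψ n t x)
    (hsymm : ∀ n t, ∀ y ∉ K n, (Ψ (n + 1) t).symm y = (Ψ n t).symm y) :
    ∃ Φ : ℝ → (L ≃ₘ^∞⟮𝓘(ℝ, E), 𝓘(ℝ, E)⟯ L), (∀ t, ∃ n, Φ t = Ψ n t) ∧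
      ∀ t x, ∃ M₀, ∀ M ≥ M₀, ∀ᶠ p in 𝓝 (t, x),
        Φ p.1 p.2 = Ψ M p.1 p.2 ∧ (Φ p.1).symm p.2 = (Ψ M p.1).symm p.2 := by
  -- Away from `t = 0` the sequence is eventually constant, uniformly on `|t| ≥ t₁`, because `δ n <
  -- t₁` for large `n`.
  have hstab : ∀ (t₁ : ℝ), 0 < t₁ → ∃ M₀, ∀ M ≥ M₀, ∀ n ≥ M, ∀ t, t₁ ≤ |t| → Ψ n t = Ψ M t := by
    intro t₁ ht₁
    obtain ⟨M₀, hM₀⟩ := eventually_atTop.1 (hδ.eventually_lt_const ht₁)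
    refine ⟨M₀, fun M hM n hn t ht => ?_⟩
    induction n, hn using Nat.le_induction with
    | base => rfl
    | succ n hn ih => rw [htime n t ((hM₀ n (hM.le.trans hn)).le.trans ht), ih]
  have hex : ∀ t, ∃ N, ∀ n ≥ N, Ψ n t = Ψ N t := by
    intro t
    rcases eq_or_ne t 0 with rfl | ht
    · exact ⟨0, fun n _ => Diffeomorph.ext fun x => by rw [(hΨ n).zero, (hΨ 0).zero]⟩
    · obtain ⟨M₀, hM₀⟩ := hstab |t| (abs_pos.2 ht)
      exact ⟨M₀, fun n hn => hM₀ M₀ le_rfl n hn t le_rfl⟩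
  choose N hN using hex
  refine ⟨fun t => Ψ (N t) t, fun t => ⟨N t, rfl⟩, fun t₀ x₀ => ?_⟩
  rcases eq_or_ne t₀ 0 with rfl | ht₀
  -- At `t = 0` the time cutoffs give no uniform bound. A neighbourhood `U` of `x₀` meets finitely
  -- many `K n`, and for `p` near `(0, x₀)` the point and its image under `Ψ M` both lie in `U`, so
  -- later steps fix them.
  · obtain ⟨U, hU, hfin⟩ := hK x₀
    obtain ⟨B, hB⟩ := hfin.bddAbove
    have hout : ∀ n ≥ B + 1, ∀ y ∈ U, y ∉ K n := fun n hn y hy hyK => by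
      have := hB (show n ∈ {i | (K i ∩ U).Nonempty} from ⟨y, hyK, hy⟩)
      omega
    refine ⟨B + 1, fun M hM => ?_⟩
    have hcont : ∀ᶠ p : ℝ × L in 𝓝 (0, x₀), Ψ M p.1 p.2 ∈ U := by
      refine ((hΨ M).smooth 0 h0 x₀).continuousAt.eventually ?_
      simp only [(hΨ M).zero]
      exact hU
    filter_upwards [hcont,
      (continuousAt_snd (p := ((0 : ℝ), x₀))).preimage_mem_nhds hU] with p hp hp2
    have h1 : ∀ n ≥ M, Ψ n p.1 p.2 = Ψ M p.1 p.2 ∧ (Ψ n p.1).symm p.2 = (Ψ M p.1).symm p.2 := by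
      intro n hn
      induction n, hn using Nat.le_induction with
      | base => exact ⟨rfl, rfl⟩
      | succ n hn ih =>
        have hn' : n ≥ B + 1 := hM.le.trans hn
        refine ⟨?_, ?_⟩
        · rw [hspace n _ _ (by rw [ih.1]; exact hout n hn' _ hp), ih.1]
        · rw [hsymm n _ _ (hout n hn' _ hp2), ih.2]
    have h2 := h1 (max M (N p.1)) (le_max_left _ _)
    rwa [hN p.1 (max M (N p.1)) (le_max_right _ _)] at h2
  · obtain ⟨M₀, hM₀⟩ := hstab (|t₀| / 2) (by positivity)
    refine ⟨M₀, fun M hM => ?_⟩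
    have hlarge : ∀ᶠ t in 𝓝 t₀, |t₀| / 2 < |t| :=
      continuous_abs.continuousAt.eventually (lt_mem_nhds (half_lt_self (abs_pos.2 ht₀)))
    filter_upwards [(continuousAt_fst (p := (t₀, x₀))).eventually hlarge] with p hp
    have h1 : Ψ (N p.1) p.1 = Ψ M p.1 := by
      rw [← hN p.1 (max M (N p.1)) (le_max_right _ _)]
      exact hM₀ M hM _ (le_max_left _ _) p.1 hp.le
    exact ⟨by rw [h1], by rw [h1]⟩

/-- A countable smooth partition of unity with compact supports in chart domains. -/
theorem exists_chart_partition [FiniteDimensional ℝ E] [T2Space L] [SecondCountableTopology L]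
    [Nonempty L] : ∃ (c : ℕ → L) (ρ : SmoothPartitionOfUnity ℕ 𝓘(ℝ, E) L univ),
      ∀ n, IsCompact (tsupport (ρ n)) ∧ tsupport (ρ n) ⊆ (chartAt E (c n)).source := by
  have : LocallyCompactSpace L := ChartedSpace.locallyCompactSpace E L
  -- Subordination to interiors of compact sets, rather than to chart domains, is what makes the
  -- supports compact.
  have h1 : ∀ x : L, ∃ C, IsCompact C ∧ x ∈ interior C ∧ C ⊆ (chartAt E x).source := fun x =>
    exists_compact_subset (chartAt E x).open_source (mem_chart_source E x)
  choose C hC hxC hCs using h1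
  obtain ⟨s, hs, hsU⟩ := TopologicalSpace.countable_cover_nhds
    (f := fun x => interior (C x)) fun x => isOpen_interior.mem_nhds (hxC x)
  have hne : s.Nonempty := by
    by_contra hne
    rw [not_nonempty_iff_eq_empty.1 hne, biUnion_empty] at hsU
    exact empty_ne_univ hsU
  obtain ⟨c, hc⟩ := hs.exists_eq_range hne
  obtain ⟨ρ, hρ⟩ := SmoothPartitionOfUnity.exists_isSubordinate 𝓘(ℝ, E) isClosed_univ
    (fun n => interior (C (c n))) (fun n => isOpen_interior) (by
      rw [← hsU, hc, biUnion_range])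
  exact ⟨c, ρ, fun n => ⟨(hC (c n)).of_isClosed_subset (isClosed_tsupport _)
    ((hρ n).trans interior_subset), ((hρ n).trans interior_subset).trans (hCs (c n))⟩⟩

theorem hasVelocity_refl : HasVelocity (E := E) (fun (_ : ℝ) (x : L) => x) 0 := fun x₀ x _ => by
  rw [Pi.zero_apply, map_zero]
  exact hasDerivAt_const _ _

theorem isIsotopy_refl (J : Set ℝ) :
    IsIsotopy J (fun _ => Diffeomorph.refl 𝓘(ℝ, E) L ∞) :=
  ⟨fun _ _ _ => contMDiffAt_snd, fun _ _ _ => contMDiffAt_snd, fun _ => rfl⟩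

variable [FiniteDimensional ℝ E] [T2Space L] [SecondCountableTopology L]
  {F : LeviFlatStructure E L} {γ : Form1 E L} {X : VField E L}
  {α : ℝ → Form1 E L} {S : ℝ → EndField E L}

/-- Every smooth vector field is the velocity of an isotopy along which the curve `(α_t, S_t)`
stays in the domain of the parametrization by pairs. -/
theorem exists_admissible_isotopy (h : IsDefiningCouple F.ξ γ X) {ε : ℝ} (hε : 0 < ε)
    (hc : IsPairCurve F X (Ioo (-ε) ε) α S)
    (hinv : ∀ t ∈ Ioo (-ε) ε, ∀ x, (onePlus (S t) x).IsInvertible) {Y : VField E L}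
    (hY : SmoothVF Y) :
    ∃ Φ : ℝ → (L ≃ₘ^∞⟮𝓘(ℝ, E), 𝓘(ℝ, E)⟯ L), IsIsotopy (Ioo (-ε) ε) Φ ∧
      HasVelocity (fun t => Φ t) Y ∧ ∀ t ∈ Ioo (-ε) ε, ∀ y, Admissible F γ X (α t) (S t)
        (mfderiv 𝓘(ℝ, E) 𝓘(ℝ, E) (Φ t).symm y) := by
  have h0 : (0 : ℝ) ∈ Ioo (-ε) ε := ⟨neg_lt_zero.2 hε, hε⟩
  rcases isEmpty_or_nonempty L with hL | hL
  · exact ⟨_, isIsotopy_refl _, fun x₀ => hL.elim x₀, fun _ _ y => hL.elim y⟩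
  obtain ⟨c, ρ, hρ⟩ := exists_chart_partition (E := E) (L := L)
  let T := {Ψ : ℝ → (L ≃ₘ^∞⟮𝓘(ℝ, E), 𝓘(ℝ, E)⟯ L) // IsIsotopy (Ioo (-ε) ε) Ψ ∧
    ∀ t ∈ Ioo (-ε) ε, ∀ y, Admissible F γ X (α t) (S t) (mfderiv 𝓘(ℝ, E) 𝓘(ℝ, E) (Ψ t).symm y)}
  let Z : ℕ → VField E L := fun n x => ρ n x • Y x
  -- The shift by `2` keeps `[-δ n, δ n]` inside the open interval already for `n = 0`.
  let δ : ℕ → ℝ := fun n => ε / (n + 2)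
  have hδ : Tendsto δ atTop (𝓝 0) :=
    (tendsto_natCast_atTop_atTop.atTop_add tendsto_const_nhds).const_div_atTop ε
  have hstep : ∀ (n : ℕ) (Ψ : T), ∃ Ψ' : T, (∀ t, δ n ≤ |t| → Ψ'.1 t = Ψ.1 t) ∧
      (∀ t x, Ψ.1 t x ∉ tsupport (ρ n) → Ψ'.1 t x = Ψ.1 t x) ∧
      (∀ t, ∀ y ∉ tsupport (ρ n), (Ψ'.1 t).symm y = (Ψ.1 t).symm y) ∧
      ∀ W, HasVelocity (fun t => Ψ.1 t) W → HasVelocity (fun t => Ψ'.1 t) (W + Z n) := by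
    intro n Ψ
    have hδ0 : 0 < δ n := by positivity
    have hδε : δ n < ε := div_lt_self hε (by have : (0 : ℝ) ≤ n := n.cast_nonneg; linarith)
    obtain ⟨Ψ', h1, h2⟩ := exists_isotopy_step h isOpen_Ioo hc Ψ.2.1 Ψ.2.2 hδ0
      (fun t ht => ⟨by linarith [ht.1], by linarith [ht.2]⟩)
      (hY.smul (f := ρ n) (ρ n).contMDiff)
      (Z := Z n) (fun x hx => by
        change ρ n x • Y x = 0
        rw [image_eq_zero_of_notMem_tsupport hx, zero_smul]) (hρ n).1 (hρ n).2
    exact ⟨⟨Ψ', h1⟩, h2⟩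
  choose f hf using hstep
  let Ψ₀ : T := ⟨fun _ => Diffeomorph.refl 𝓘(ℝ, E) L ∞, isIsotopy_refl _, fun t ht y =>
    admissible_id h (hc.antilinear t ht) (hinv t ht) y⟩
  let Ψ : ℕ → T := fun n => Nat.rec Ψ₀ (fun n Ψ => f n Ψ) n
  have hΨ : ∀ n, Ψ (n + 1) = f n (Ψ n) := fun n => rfl
  have hvel : ∀ n, HasVelocity (fun t => (Ψ n).1 t) (∑ i ∈ Finset.range n, Z i) := by
    intro n
    induction n with
    | zero => exact hasVelocity_refl
    | succ n ih => rw [Finset.sum_range_succ, hΨ]; exact (hf n (Ψ n)).2.2.2 _ ih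
  obtain ⟨Φ, hΦ, hloc⟩ := exists_limit_isotopy h0 (Ψ := fun n => (Ψ n).1) (fun n => (Ψ n).2.1) hδ
    ρ.locallyFinite.closure (fun n => (hf n (Ψ n)).1) (fun n => (hf n (Ψ n)).2.1)
    (fun n => (hf n (Ψ n)).2.2.1)
  refine ⟨Φ, ⟨fun t ht x => ?_, fun t ht x => ?_, fun x => ?_⟩, fun x₁ x hx => ?_, fun t ht y => ?_⟩
  · obtain ⟨M, hM⟩ := hloc t x
    exact ((Ψ M).2.1.smooth t ht x).congr_of_eventuallyEq ((hM M le_rfl).mono fun p hp => hp.1)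
  · obtain ⟨M, hM⟩ := hloc t x
    exact ((Ψ M).2.1.smooth_symm t ht x).congr_of_eventuallyEq ((hM M le_rfl).mono fun p hp => hp.2)
  · obtain ⟨n, hn⟩ := hΦ 0
    rw [hn]; exact (Ψ n).2.1.zero x
  · obtain ⟨M₀, hM₀⟩ := hloc 0 x
    have hfin : {n | ρ n x ≠ 0}.Finite := ρ.locallyFinite.point_finite x
    obtain ⟨B, hB⟩ := hfin.bddAbove
    -- Beyond `B` every `ρ i` vanishes at `x`, so this stage already has velocity `Y x` at `x`;
    -- being past `M₀`, it agrees with `Φ` near `(0, x)`.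
    have hsum : ∑ i ∈ Finset.range (max M₀ (B + 1)), ρ i x = 1 := by
      rw [← ρ.sum_eq_one (mem_univ x)]
      refine (finsum_eq_sum_of_support_subset _ fun n hn => ?_).symm
      have := hB (show n ∈ {n | ρ n x ≠ 0} from hn)
      simp only [Finset.coe_range, mem_Iio]
      omega
    have h1 := hvel (max M₀ (B + 1)) x₁ x hx
    have h2 : (∑ i ∈ Finset.range (max M₀ (B + 1)), Z i) x = Y x := by
      rw [Finset.sum_apply]
      change ∑ i ∈ _, ρ i x • Y x = Y x
      rw [← Finset.sum_smul, hsum, one_smul]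
    rw [h2] at h1
    refine h1.congr_of_eventuallyEq ?_
    have h3 : ContinuousAt (fun t : ℝ => (t, x)) 0 := by fun_prop
    filter_upwards [h3.eventually (hM₀ _ (le_max_left _ _))] with t ht
    rw [ht.1]
  · obtain ⟨n, hn⟩ := hΦ t
    rw [hn]; exact (Ψ n).2.2 t ht y

end Limit

/-! ### The two equivalences of part 2. -/

section Equivalence

variable {E : Type*} [NormedAddCommGroup E] [NormedSpace ℝ E] [FiniteDimensional ℝ E]
  {L : Type*} [TopologicalSpace L] [T2Space L] [SecondCountableTopology L] [ChartedSpace E L]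
  [IsManifold 𝓘(ℝ, E) ∞ L] {F : LeviFlatStructure E L} {γ : Form1 E L} {X : VField E L}
  {I : Set ℝ} {α : ℝ → Form1 E L} {S : ℝ → EndField E L} {β β' : Form1 E L} {P P' : EndField E L}

theorem exists_symm_Ioo_subset (hI : IsOpen I) (h0 : (0 : ℝ) ∈ I) :
    ∃ ε > 0, Ioo (-ε) ε ⊆ I := by
  obtain ⟨ε, hε, hεI⟩ := Metric.isOpen_iff.1 hI 0 h0
  rw [Real.ball_eq_Ioo, zero_sub, zero_add] at hεI
  exact ⟨ε, hε, hεI⟩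

theorem movesTo_of_differByField (hγX : IsDefiningCouple F.ξ γ X) (hI : IsOpen I)
    (h0 : (0 : ℝ) ∈ I) (hc : IsPairCurve F X I α S)
    (hinv : ∀ t ∈ I, ∀ x, (onePlus (S t) x).IsInvertible) (ht : HasTangent α S β P)
    (hP : IsForm01 F X P) (hP' : IsForm01 F X P') {Y : VField E L} (hY : SmoothVF Y)
    (hd : DifferByField F γ X β P β' P' Y) : MovesTo F γ X I α S β' P' := by
  obtain ⟨ε, hε, hεI⟩ := exists_symm_Ioo_subset hI h0
  obtain ⟨Φ, hΦ, hv, had⟩ := exists_admissible_isotopy hγX hε (hc.mono hεI)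
    (fun t ht => hinv t (hεI ht)) hY
  exact movesTo_of_isotopy hγX hε hεI hc hinv ht hP hP' hY hd hΦ hv had

theorem movesTo_iff (hγX : IsDefiningCouple F.ξ γ X) (hI : IsOpen I)
    (h0 : (0 : ℝ) ∈ I) (hc : IsPairCurve F X I α S)
    (hinv : ∀ t ∈ I, ∀ x, (onePlus (S t) x).IsInvertible) (ht : HasTangent α S β P)
    (hP : IsForm01 F X P) (hP' : IsForm01 F X P') :
    MovesTo F γ X I α S β' P' ↔
      ∃ Y : VField E L, SmoothVF Y ∧ DifferByField F γ X β P β' P' Y :=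
  ⟨fun hm => hm.exists_differByField hγX hc ht hP, fun ⟨_, hY, hd⟩ =>
    movesTo_of_differByField hγX hI h0 hc hinv ht hP hP' hY hd⟩

/-- Necessity holds for whichever curve realises the equivalence. For sufficiency the given curve,
restricted to a symmetric interval, serves as the curve tangent to `(β, P)`. -/
theorem tangentEquiv_iff (hγX : IsDefiningCouple F.ξ γ X) (hI : IsOpen I)
    (h0 : (0 : ℝ) ∈ I) (hc : IsPairCurve F X I α S)
    (hinv : ∀ t ∈ I, ∀ x, (onePlus (S t) x).IsInvertible) (ht : HasTangent α S β P)
    (hP : IsForm01 F X P) (hP' : IsForm01 F X P') :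
    TangentEquiv F γ X β P β' P' ↔
      ∃ Y : VField E L, SmoothVF Y ∧ DifferByField F γ X β P β' P' Y := by
  constructor
  · rintro ⟨ε, -, α₁, S₁, hc₁, ht₁, hm⟩
    exact hm.exists_differByField hγX hc₁ ht₁ hP
  · rintro ⟨Y, hY, hd⟩
    obtain ⟨ε, hε, hεI⟩ := exists_symm_Ioo_subset hI h0
    exact ⟨ε, hε, α, S, hc.mono hεI, ht, movesTo_of_differByField hγX isOpen_Ioo
      ⟨neg_lt_zero.2 hε, hε⟩ (hc.mono hεI) (fun t ht => hinv t (hεI ht)) ht hP hP' hY hd⟩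

end Equivalence

end LeviFlat

end

theorem mainTheorem3
    {E : Type*} [NormedAddCommGroup E] [NormedSpace ℝ E] [FiniteDimensional ℝ E]
    {L : Type*} [TopologicalSpace L] [T2Space L] [SecondCountableTopology L]
    [ChartedSpace E L] [IsManifold 𝓘(ℝ, E) ∞ L]
    (F : LeviFlat.LeviFlatStructure E L)
    (γ : LeviFlat.Form1 E L) (X : LeviFlat.VField E L)
    (hγX : LeviFlat.IsDefiningCouple F.ξ γ X)
    (I : Set ℝ) (hI : IsOpen I) (hIc : I.OrdConnected) (h0 : (0 : ℝ) ∈ I)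
    (D : ℝ → LeviFlat.LeviFlatStructure E L)
    (α : ℝ → LeviFlat.Form1 E L) (S : ℝ → LeviFlat.EndField E L)
    (hD : LeviFlat.IsDeformationGivenBy F γ X I D α S)
    (β : LeviFlat.Form1 E L) (P : LeviFlat.EndField E L)
    (hβ : LeviFlat.IsZ1 X β) (hP : LeviFlat.IsForm01 F X P)
    (hαS : LeviFlat.HasTangent α S β P) :
    LeviFlat.LinearizedEq F γ X β P ∧
    ∀ (β' : LeviFlat.Form1 E L) (P' : LeviFlat.EndField E L),
      LeviFlat.IsZ1 X β' → LeviFlat.IsForm01 F X P' → LeviFlat.LinearizedEq F γ X β' P' →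
      (LeviFlat.TangentEquiv F γ X β P β' P' ↔
        ∃ Y : LeviFlat.VField E L, LeviFlat.SmoothVF Y ∧
          LeviFlat.DifferByField F γ X β P β' P' Y) ∧
      (LeviFlat.MovesTo F γ X I α S β' P' ↔
        ∃ Y : LeviFlat.VField E L, LeviFlat.SmoothVF Y ∧
          LeviFlat.DifferByField F γ X β P β' P' Y) := by
  refine ⟨LeviFlat.linearizedEq_of_deformation hγX hI h0 hD hβ hP hαS,
    fun β' P' _ hP' _ => ⟨?_, ?_⟩⟩
  · exact LeviFlat.tangentEquiv_iff hγX hI h0 hD.curve hD.invertible hαS hP hP'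
  · exact LeviFlat.movesTo_iff hγX hI h0 hD.curve hD.invertible hαS hP hP'
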